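/- Let $\mathbb{F}$ be a field of characteristic $p>3$, let $m,n\ge 3$ be integers and let $\underline{t}=(t_1,\dots,t_m)$ be a tuple of positive integers. Let $\mathfrak{A}(m)$ be the divided power algebra over $\mathbb{F}$ with basis $\{x^{(\alpha)}\mid\alpha\in\mathbb{N}_0^m\}$ and product $x^{(\alpha)}x^{(\beta)}=\prod_{i=1}^m\binom{\alpha_i+\beta_i}{\alpha_i}\,x^{(\alpha+\beta)}$, let $\Lambda(n)$ be the exterior superalgebra over $\mathbb{F}$ in the variables $x_{m+1},\dots,x_{m+n}$, and let $\mathfrak{A}(m,n)=\mathfrak{A}(m)\otimes_{\mathbb{F}}\Lambda(n)$, with the $\mathbb{Z}_2$-grading in which $\mathfrak{A}(m)$ is even and $\Lambda(n)$ has its natural grading. Let $\mathfrak{A}(m,n;\underline{t})$ be the span of the elements $x^{(\alpha)}b$ with $b\in\Lambda(n)$ and $\alpha_i\le p^{t_i}-1$ for all $i$. For $1\le i\le m$ let $D_i$ be the linear operator on $\mathfrak{A}(m,n)$ with $D_i(x^{(\alpha)}b)=x^{(\alpha-\varepsilon_i)}b$ (which is $0$ if $\alpha_i=0$), where $\varepsilon_i$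 is the $i$-th unit vector, and for $m<r\le m+n$ let $D_r(x^{(\alpha)}b)=x^{(\alpha)}\,\partial b/\partial x_r$, where $\partial/\partial x_r$ is the odd superderivation of $\Lambda(n)$ with $\partial x_s/\partial x_r=\delta_{rs}$. Let $$W(m,n;\underline{t})=\Big\{\sum_{r=1}^{m+n}f_rD_r\;\Big|\;f_r\in\mathfrak{A}(m,n;\underline{t})\Big\}$$ be the generalized Witt Lie superalgebra, with the supercommutator of operators as bracket, and let $\mathcal{W}=W(m,n;\underline{t})_{\overline{0}}$ be its even part, which is a Lie algebra under the commutator. Then the outer derivation algebra $\mathrm{Der}_{\mathrm{out}}(\mathcal{W})=\mathrm{Der}(\mathcal{W})/\mathrm{ad}\,\mathcal{W}$ is an abelian Lie algebra, and it is finite-dimensional over $\mathbb{F}$, of dimension $\sum_{i=1}^m t_i-m$. -/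

import Mathlib

open scoped TensorProduct

noncomputable section

namespace CartanW

attribute [local instance] LieRing.ofAssociativeRing

/-! ### The divided power algebra `𝔄(m)` -/

/-- The underlying space of the divided power algebra in `m` variables over `F`:
the free module on the divided power monomials `x^(α)`, `α ∈ ℕ^m`. -/
def DividedPow (F : Type*) [Field F] (m : ℕ) : Type _ := (Fin m → ℕ) →₀ F

/-- The multi-binomial coefficient `∏ i, (α i + β i choose α i)`. -/
def binom {m : ℕ} (α β : Fin m → ℕ) : ℕ := ∏ i, (α i + β i).choose (α i)

namespace DividedPow

variable {F : Type*} [Field F] {m : ℕ}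

instance : AddCommGroup (DividedPow F m) := inferInstanceAs (AddCommGroup ((Fin m → ℕ) →₀ F))

instance : Module F (DividedPow F m) := inferInstanceAs (Module F ((Fin m → ℕ) →₀ F))

/-- The monomials `x^(α)` as a basis. -/
def basis (F : Type*) [Field F] (m : ℕ) : Module.Basis (Fin m → ℕ) F (DividedPow F m) :=
  Module.Basis.ofRepr (LinearEquiv.refl F ((Fin m → ℕ) →₀ F))

/-- The divided power monomial `x^(α)`. -/
def mon (F : Type*) [Field F] {m : ℕ} (α : Fin m → ℕ) : DividedPow F m := basis F m α

/-- The product, determined by `x^(α) x^(β) = binom α β x^(α+β)`. -/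
def mulHom (F : Type*) [Field F] (m : ℕ) :
    DividedPow F m →ₗ[F] DividedPow F m →ₗ[F] DividedPow F m :=
  (basis F m).constr F fun α => (basis F m).constr F fun β => (binom α β : F) • mon F (α + β)

theorem mulHom_mon (α β : Fin m → ℕ) :
    mulHom F m (mon F α) (mon F β) = (binom α β : F) • mon F (α + β) := by
  simp [mulHom, mon, Module.Basis.constr_basis]

theorem ext_mon {N : Type*} [AddCommGroup N] [Module F N] {f g : DividedPow F m →ₗ[F] N}
    (h : ∀ α, f (mon F α) = g (mon F α)) : f = g :=
  (basis F m).ext h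

theorem binom_comm (α β : Fin m → ℕ) : binom α β = binom β α := by
  unfold binom
  refine Finset.prod_congr rfl fun i _ => ?_
  rw [Nat.choose_symm_add, add_comm]

theorem binom_assoc (α β γ : Fin m → ℕ) :
    binom α β * binom (α + β) γ = binom β γ * binom α (β + γ) := by
  unfold binom
  rw [← Finset.prod_mul_distrib, ← Finset.prod_mul_distrib]
  refine Finset.prod_congr rfl fun i _ => ?_
  simp only [Pi.add_apply]
  have h (i j : ℕ) : (i + j).choose i * i.factorial * j.factorial = (i + j).factorial := by
    rw [Nat.choose_symm_add]
    exact Nat.add_choose_mul_factorial_mul_factorial i j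
  have h1 := h (α i) (β i)
  have h2 := h (α i + β i) (γ i)
  have h3 := h (β i) (γ i)
  have h4 := h (α i) (β i + γ i)
  have e : α i + β i + γ i = α i + (β i + γ i) := by ring
  rw [← h1] at h2
  rw [← h3] at h4
  rw [e] at h2 ⊢
  rw [← h4] at h2
  have hpos : 0 < (α i).factorial * (β i).factorial * (γ i).factorial := by positivity
  apply Nat.eq_of_mul_eq_mul_right hpos
  linarith

theorem mulHom_comm (a b : DividedPow F m) : mulHom F m a b = mulHom F m b a := by
  have h : mulHom F m = (mulHom F m).flip := by
    refine ext_mon fun α => ext_mon fun β => ?_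
    rw [LinearMap.flip_apply, mulHom_mon, mulHom_mon, binom_comm, add_comm]
  exact congrArg (fun f => f a b) h

theorem mulHom_assoc (a b c : DividedPow F m) :
    mulHom F m (mulHom F m a b) c = mulHom F m a (mulHom F m b c) := by
  have h : (LinearMap.llcomp F _ _ _ (mulHom F m)).comp (mulHom F m) =
      ((LinearMap.llcomp F _ _ _).flip (mulHom F m)).comp
        ((LinearMap.llcomp F (DividedPow F m) (DividedPow F m) (DividedPow F m)).comp
          (mulHom F m)) := by
    refine ext_mon fun α => ext_mon fun β => ext_mon fun γ => ?_
    simp only [LinearMap.comp_apply, LinearMap.llcomp_apply, LinearMap.flip_apply, mulHom_mon,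
      map_smul, LinearMap.smul_apply, smul_smul]
    rw [← Nat.cast_mul, ← Nat.cast_mul, binom_assoc, add_assoc]
  exact congrArg (fun f => f a b c) h

theorem mulHom_one (a : DividedPow F m) : mulHom F m (mon F 0) a = a := by
  have h : mulHom F m (mon F 0) = LinearMap.id := by
    refine ext_mon fun α => ?_
    rw [mulHom_mon]
    simp [binom]
  exact congrArg (fun f => f a) h

instance : Mul (DividedPow F m) := ⟨fun a b => mulHom F m a b⟩

instance : One (DividedPow F m) := ⟨mon F 0⟩

theorem mul_def (a b : DividedPow F m) : a * b = mulHom F m a b := rfl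

instance : CommRing (DividedPow F m) :=
  { (inferInstance : AddCommGroup (DividedPow F m)) with
    mul := (· * ·)
    one := 1
    left_distrib := fun a b c => by simp [mul_def]
    right_distrib := fun a b c => by simp [mul_def]
    zero_mul := fun a => by simp [mul_def]
    mul_zero := fun a => by simp [mul_def]
    mul_assoc := mulHom_assoc
    one_mul := mulHom_one
    mul_one := fun a => (mulHom_comm a _).trans (mulHom_one a)
    mul_comm := mulHom_comm }

instance : Algebra F (DividedPow F m) :=
  Algebra.ofModule (fun r a b => by simp [mul_def]) (fun r a b => by simp [mul_def])

theorem mon_mul_mon (α β : Fin m → ℕ) :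
    mon F α * mon F β = (binom α β : F) • mon F (α + β) := mulHom_mon α β

/-- The derivation `D_i` of the divided power algebra: `x^(α) ↦ x^(α - ε_i)`, understood as `0`
when `α i = 0`. -/
def der (F : Type*) [Field F] {m : ℕ} (i : Fin m) : DividedPow F m →ₗ[F] DividedPow F m :=
  (basis F m).constr F fun α => if α i = 0 then 0 else mon F (α - Pi.single i 1)

theorem der_mon (i : Fin m) (α : Fin m → ℕ) :
    der F i (mon F α) = if α i = 0 then 0 else mon F (α - Pi.single i 1) := by
  simp [der, mon, Module.Basis.constr_basis]

end DividedPow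

/-! ### The superalgebra `𝔄(m,n)` -/

/-- The exterior superalgebra in `n` variables. -/
abbrev Ext (F : Type*) [Field F] (n : ℕ) : Type _ := ExteriorAlgebra F (Fin n → F)

/-- `𝔄(m,n)`, the tensor product of the divided power algebra and the exterior superalgebra
(the first factor is purely even, so the product is the one of the ordinary tensor product). -/
abbrev Alg (F : Type*) [Field F] (m n : ℕ) : Type _ := DividedPow F m ⊗[F] Ext F n

variable {F : Type*} [Field F] {m n : ℕ}

/-- The homogeneous component of `𝔄(m,n)` of parity `θ`. -/
def Alg.parity (F : Type*) [Field F] (m n : ℕ) (θ : ZMod 2) : Submodule F (Alg F m n) :=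
  Submodule.span F {z | ∃ (a : DividedPow F m) (b : Ext F n),
    b ∈ CliffordAlgebra.evenOdd (0 : QuadraticForm F (Fin n → F)) θ ∧ z = a ⊗ₜ b}

/-- `𝔄(m,n;t)`, spanned by the elements `x^(α) b` with `α i ≤ p ^ t i - 1` for all `i` and `b` in
the exterior algebra. -/
def Alg.trunc (F : Type*) [Field F] (p m n : ℕ) (t : Fin m → ℕ) : Submodule F (Alg F m n) :=
  Submodule.span F {z | ∃ (α : Fin m → ℕ) (b : Ext F n),
    (∀ i, α i < p ^ t i) ∧ z = DividedPow.mon F α ⊗ₜ b}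

/-- The superderivation `∂/∂x_k` of the exterior algebra: the left contraction with the `k`-th
coordinate function. -/
def Ext.der (F : Type*) [Field F] {n : ℕ} (k : Fin n) : Ext F n →ₗ[F] Ext F n :=
  CliffordAlgebra.contractLeft (Q := (0 : QuadraticForm F (Fin n → F)))
    (LinearMap.proj k : (Fin n → F) →ₗ[F] F)

/-- The superderivations `D_r` of `𝔄(m,n)`. The index set `Y = Y₀ ∪ Y₁` is `Fin m ⊕ Fin n`. -/
def D (F : Type*) [Field F] {m n : ℕ} : Fin m ⊕ Fin n → Module.End F (Alg F m n)
  | Sum.inl i => TensorProduct.map (DividedPow.der F i) LinearMap.id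
  | Sum.inr k => TensorProduct.map LinearMap.id (Ext.der F k)

/-- The component of parity `θ` of `End V` for a superspace `V` with components `V₀`, `V₁`. -/
def endParity {V : Type*} [AddCommGroup V] [Module F V] (P : ZMod 2 → Submodule F V) (θ : ZMod 2) :
    Submodule F (Module.End F V) where
  carrier := {A | ∀ μ, ∀ v ∈ P μ, A v ∈ P (θ + μ)}
  add_mem' hA hB μ v hv := add_mem (hA μ v hv) (hB μ v hv)
  zero_mem' _ _ _ := zero_mem _
  smul_mem' c _ hA μ v hv := Submodule.smul_mem _ c (hA μ v hv)

/-- The operator `∑_r f_r D_r`. -/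
def vectorField (f : Fin m ⊕ Fin n → Alg F m n) : Module.End F (Alg F m n) :=
  ∑ r, LinearMap.mulLeft F (f r) ∘ₗ D F r

theorem vectorField_apply (f : Fin m ⊕ Fin n → Alg F m n) (h : Alg F m n) :
    vectorField f h = ∑ r, f r * D F r h := by
  simp only [vectorField, LinearMap.sum_apply, LinearMap.comp_apply, LinearMap.mulLeft_apply]

/-- The generalized Witt superalgebra `W(m,n;t)`: all operators `∑_r f_r D_r` with coefficients
`f_r` in `𝔄(m,n;t)`. -/
def W (F : Type*) [Field F] (p m n : ℕ) (t : Fin m → ℕ) :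
    Submodule F (Module.End F (Alg F m n)) where
  carrier := {A | ∃ f : Fin m ⊕ Fin n → Alg F m n,
    (∀ r, f r ∈ Alg.trunc F p m n t) ∧ A = vectorField f}
  add_mem' := by
    rintro _ _ ⟨f, hf, rfl⟩ ⟨g, hg, rfl⟩
    refine ⟨f + g, fun r => add_mem (hf r) (hg r), LinearMap.ext fun h => ?_⟩
    rw [LinearMap.add_apply]
    simp only [vectorField_apply, Pi.add_apply, add_mul, Finset.sum_add_distrib]
  zero_mem' := ⟨0, fun _ => zero_mem _, LinearMap.ext fun h => by simp [vectorField_apply]⟩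
  smul_mem' := by
    rintro c _ ⟨f, hf, rfl⟩
    refine ⟨c • f, fun r => Submodule.smul_mem _ c (hf r), LinearMap.ext fun h => ?_⟩
    rw [LinearMap.smul_apply]
    simp only [vectorField_apply, Pi.smul_apply, smul_mul_assoc, Finset.smul_sum]

/-! ### Auxiliary facts: the even part of `W(m,n;t)` is closed under the commutator -/

open CliffordAlgebra in
theorem Ext.der_mul (k : Fin n) (a b : Ext F n) :
    Ext.der F k (a * b) = Ext.der F k a * b + involute a * Ext.der F k b := by
  unfold Ext.der
  induction a using CliffordAlgebra.left_induction with
  | algebraMap r =>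
    rw [contractLeft_algebraMap_mul, contractLeft_algebraMap, AlgHom.commutes, zero_mul, zero_add]
  | add x y hx hy => rw [add_mul, map_add, hx, hy, map_add, map_add, add_mul, add_mul]; abel
  | ι_mul x v hx =>
    rw [mul_assoc, contractLeft_ι_mul, hx, contractLeft_ι_mul, map_mul, involute_ι]
    simp only [mul_add, sub_mul, smul_mul_assoc, neg_mul, mul_assoc]
    abel

open CliffordAlgebra in
theorem Ext.ι_comm (v : Fin n → F) (b : Ext F n) :
    ι (0 : QuadraticForm F (Fin n → F)) v * involute b = b * ι 0 v := by
  induction b using CliffordAlgebra.left_induction with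
  | algebraMap r => rw [AlgHom.commutes, Algebra.commutes]
  | add x y hx hy => rw [map_add, mul_add, hx, hy, add_mul]
  | ι_mul x w hx =>
    have h : ι (0 : QuadraticForm F (Fin n → F)) v * ι 0 w = - (ι 0 w * ι 0 v) :=
      eq_neg_of_add_eq_zero_left (ExteriorAlgebra.ι_add_mul_swap v w)
    rw [map_mul, involute_ι, neg_mul, mul_neg, ← mul_assoc, h, neg_mul, neg_neg, mul_assoc, hx,
      mul_assoc]

open CliffordAlgebra in
theorem Ext.ι_ι_comm (v w : Fin n → F) (b : Ext F n) :
    ι (0 : QuadraticForm F (Fin n → F)) v * ι 0 w * b = b * (ι 0 v * ι 0 w) := by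
  have h := Ext.ι_comm w (involute b)
  rw [involute_involute] at h
  rw [mul_assoc, h, ← mul_assoc, Ext.ι_comm, mul_assoc]

open CliffordAlgebra in
theorem Ext.even_comm {a : Ext F n} (ha : a ∈ evenOdd (0 : QuadraticForm F (Fin n → F)) 0)
    (b : Ext F n) : a * b = b * a := by
  induction a, ha using CliffordAlgebra.even_induction with
  | algebraMap r => rw [Algebra.commutes]
  | add x y _ _ hx hy => rw [add_mul, hx, hy, mul_add]
  | ι_mul_ι_mul v w x _ hx => rw [mul_assoc, hx, ← mul_assoc, Ext.ι_ι_comm, mul_assoc]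

open CliffordAlgebra in
theorem Ext.odd_comm {a : Ext F n} (ha : a ∈ evenOdd (0 : QuadraticForm F (Fin n → F)) 1)
    (b : Ext F n) : a * involute b = b * a := by
  induction a, ha using CliffordAlgebra.odd_induction with
  | ι v => exact Ext.ι_comm v b
  | add x y _ _ hx hy => rw [add_mul, hx, hy, mul_add]
  | ι_mul_ι_mul v w x _ hx => rw [mul_assoc, hx, ← mul_assoc, Ext.ι_ι_comm, mul_assoc]

/-- The parity automorphism of `𝔄(m,n)`. -/
def Alg.sigma (F : Type*) [Field F] (m n : ℕ) : Alg F m n →ₗ[F] Alg F m n :=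
  TensorProduct.map LinearMap.id
    (CliffordAlgebra.involute (Q := (0 : QuadraticForm F (Fin n → F)))).toLinearMap

theorem Alg.even_comm {f : Alg F m n} (hf : f ∈ Alg.parity F m n 0) (g : Alg F m n) :
    f * g = g * f := by
  induction hf using Submodule.span_induction with
  | mem x hx =>
    obtain ⟨a, b, hb, rfl⟩ := hx
    induction g using TensorProduct.induction_on with
    | zero => simp
    | add x y hx hy => rw [mul_add, hx, hy, add_mul]
    | tmul c d =>
      rw [Algebra.TensorProduct.tmul_mul_tmul, Algebra.TensorProduct.tmul_mul_tmul, mul_comm a,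
        Ext.even_comm hb]
  | zero => simp
  | add x y _ _ hx hy => rw [add_mul, hx, hy, mul_add]
  | smul c x _ hx => rw [smul_mul_assoc, hx, mul_smul_comm]

theorem Alg.odd_comm {f : Alg F m n} (hf : f ∈ Alg.parity F m n 1) (g : Alg F m n) :
    f * Alg.sigma F m n g = g * f := by
  induction hf using Submodule.span_induction with
  | mem x hx =>
    obtain ⟨a, b, hb, rfl⟩ := hx
    induction g using TensorProduct.induction_on with
    | zero => simp
    | add x y hx hy => rw [map_add, mul_add, hx, hy, add_mul]
    | tmul c d =>
      rw [Alg.sigma, TensorProduct.map_tmul, Algebra.TensorProduct.tmul_mul_tmul,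
        Algebra.TensorProduct.tmul_mul_tmul, LinearMap.id_apply, mul_comm a,
        AlgHom.toLinearMap_apply, Ext.odd_comm hb]
  | zero => simp
  | add x y _ _ hx hy => rw [add_mul, hx, hy, mul_add]
  | smul c x _ hx => rw [smul_mul_assoc, hx, mul_smul_comm]

theorem DividedPow.der_mul (i : Fin m) (a b : DividedPow F m) :
    DividedPow.der F i (a * b) = DividedPow.der F i a * b + a * DividedPow.der F i b := by
  have h : (LinearMap.mul F (DividedPow F m)).compr₂ (DividedPow.der F i) =
      (LinearMap.mul F (DividedPow F m)).comp (DividedPow.der F i) +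
        (LinearMap.mul F (DividedPow F m)).compl₂ (DividedPow.der F i) := by
    refine DividedPow.ext_mon fun α => DividedPow.ext_mon fun β => ?_
    simp only [LinearMap.compr₂_apply, LinearMap.add_apply, LinearMap.comp_apply,
      LinearMap.compl₂_apply, LinearMap.mul_apply', mon_mul_mon, map_smul, der_mon, Pi.add_apply]
    have key (α β : Fin m → ℕ) (hα : α i ≠ 0) :
        α - Pi.single i 1 + β = α + β - Pi.single i 1 := by
      ext j
      by_cases hj : j = i
      · subst hj; simp; omega
      · simp [hj]
    have split (α β : Fin m → ℕ) : binom α β =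
        (α i + β i).choose (α i) * ∏ j ∈ Finset.univ.erase i, (α j + β j).choose (α j) :=
      (Finset.mul_prod_erase _ _ (Finset.mem_univ i)).symm
    have e1 (α β : Fin m → ℕ) : ∏ j ∈ Finset.univ.erase i,
        ((α - Pi.single i 1 : Fin m → ℕ) j + β j).choose ((α - Pi.single i 1 : Fin m → ℕ) j) =
          ∏ j ∈ Finset.univ.erase i, (α j + β j).choose (α j) :=
      Finset.prod_congr rfl fun j hj => by simp [Finset.ne_of_mem_erase hj]
    have e2 (α β : Fin m → ℕ) : ∏ j ∈ Finset.univ.erase i,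
        (α j + (β - Pi.single i 1 : Fin m → ℕ) j).choose (α j) =
          ∏ j ∈ Finset.univ.erase i, (α j + β j).choose (α j) :=
      Finset.prod_congr rfl fun j hj => by simp [Finset.ne_of_mem_erase hj]
    by_cases hα : α i = 0
    · by_cases hβ : β i = 0
      · simp [hα, hβ]
      · rw [if_neg (by omega), if_pos hα, if_neg hβ, zero_mul, zero_add, mon_mul_mon,
          add_comm α (β - _), key β α hβ, add_comm β α, split, split, e2]
        simp [hα]
    · by_cases hβ : β i = 0
      · rw [if_neg (by omega), if_neg hα, if_pos hβ, mul_zero, add_zero, mon_mul_mon,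
          key α β hα, split, split, e1]
        simp [hβ]
      · rw [if_neg (by omega), if_neg hα, if_neg hβ, mon_mul_mon, mon_mul_mon,
          add_comm α (β - _), key β α hβ, key α β hα, add_comm β α, ← add_smul, ← Nat.cast_add]
        congr 2
        rw [split, split, split, e1, e2, ← add_mul]
        congr 1
        obtain ⟨a, ha⟩ := Nat.exists_eq_succ_of_ne_zero hα
        obtain ⟨b, hb⟩ := Nat.exists_eq_succ_of_ne_zero hβ
        simp only [Pi.sub_apply, Pi.single_eq_same, ha, hb, Nat.succ_eq_add_one,
          Nat.add_sub_cancel]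
        rw [show a + 1 + (b + 1) = (a + b + 1) + 1 by ring, Nat.choose_succ_succ,
          show a + (b + 1) = a + b + 1 by ring, show a + 1 + b = a + b + 1 by ring]
  exact congrArg (fun f => f a b) h

theorem D_mul_inl (i : Fin m) (g h : Alg F m n) :
    D F (Sum.inl i) (g * h) = D F (Sum.inl i) g * h + g * D F (Sum.inl i) h := by
  induction g using TensorProduct.induction_on with
  | zero => simp
  | add x y hx hy => simp only [add_mul, map_add, hx, hy]; abel
  | tmul a b =>
    induction h using TensorProduct.induction_on with
    | zero => simp
    | add x y hx hy => simp only [mul_add, map_add, hx, hy]; abel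
    | tmul c d =>
      simp only [D, TensorProduct.map_tmul, Algebra.TensorProduct.tmul_mul_tmul,
        LinearMap.id_apply, DividedPow.der_mul, TensorProduct.add_tmul]

theorem D_mul_inr (k : Fin n) (g h : Alg F m n) :
    D F (Sum.inr k) (g * h) =
      D F (Sum.inr k) g * h + Alg.sigma F m n g * D F (Sum.inr k) h := by
  induction g using TensorProduct.induction_on with
  | zero => simp
  | add x y hx hy => simp only [add_mul, map_add, hx, hy]; abel
  | tmul a b =>
    induction h using TensorProduct.induction_on with
    | zero => simp
    | add x y hx hy => simp only [mul_add, map_add, hx, hy]; abel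
    | tmul c d =>
      simp only [D, Alg.sigma, TensorProduct.map_tmul, Algebra.TensorProduct.tmul_mul_tmul,
        LinearMap.id_apply, Ext.der_mul, TensorProduct.tmul_add, AlgHom.toLinearMap_apply]

/-- The parity `τ` of the index `r` (and of the superderivation `D_r`). -/
def tau : Fin m ⊕ Fin n → ZMod 2
  | Sum.inl _ => 0
  | Sum.inr _ => 1

/-- The generators `x_r` of `𝔄(m,n)`. -/
def gen (F : Type*) [Field F] {m n : ℕ} : Fin m ⊕ Fin n → Alg F m n
  | Sum.inl i => DividedPow.mon F (Pi.single i 1) ⊗ₜ 1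
  | Sum.inr k => 1 ⊗ₜ ExteriorAlgebra.ι F (Pi.single k 1)

theorem gen_mem (r : Fin m ⊕ Fin n) : gen F r ∈ Alg.parity F m n (tau r) := by
  refine Submodule.subset_span ?_
  cases r with
  | inl i => exact ⟨_, _, SetLike.one_mem_graded _, rfl⟩
  | inr k => exact ⟨_, _, CliffordAlgebra.ι_mem_evenOdd_one _ _, rfl⟩

theorem D_gen (r s : Fin m ⊕ Fin n) : D F r (gen F s) = if r = s then 1 else 0 := by
  rw [Algebra.TensorProduct.one_def]
  cases r with
  | inl i =>
    cases s with
    | inl j =>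
      simp only [D, gen, TensorProduct.map_tmul, DividedPow.der_mon, LinearMap.id_apply,
        Sum.inl.injEq]
      by_cases h : i = j
      · subst h
        rw [if_neg (by simp), if_pos rfl, tsub_self]
        rfl
      · rw [if_pos (by simp [h]), if_neg h, TensorProduct.zero_tmul]
    | inr l =>
      have : (1 : DividedPow F m) = DividedPow.mon F 0 := rfl
      simp [D, gen, this, DividedPow.der_mon]
  | inr k =>
    cases s with
    | inl j =>
      simp only [D, gen, TensorProduct.map_tmul, Ext.der, CliffordAlgebra.contractLeft_one]
      simp
    | inr l =>
      have h : Ext.der F k (ExteriorAlgebra.ι F (Pi.single l 1)) =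
          algebraMap F _ ((Pi.single l 1 : Fin n → F) k) := by
        unfold Ext.der
        exact CliffordAlgebra.contractLeft_ι (Q := (0 : QuadraticForm F (Fin n → F))) _ _
      simp only [D, gen, TensorProduct.map_tmul, LinearMap.id_apply, h, Sum.inr.injEq]
      by_cases h : k = l
      · subst h; simp
      · simp [h]

theorem vectorField_gen (f : Fin m ⊕ Fin n → Alg F m n) (r : Fin m ⊕ Fin n) :
    vectorField f (gen F r) = f r := by
  rw [vectorField_apply]
  simp only [D_gen, mul_ite, mul_one, mul_zero]
  simp only [Finset.sum_ite_eq', Finset.mem_univ, if_true]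

theorem coeff_mem {f : Fin m ⊕ Fin n → Alg F m n}
    (hf : vectorField f ∈ endParity (Alg.parity F m n) 0) (r : Fin m ⊕ Fin n) :
    f r ∈ Alg.parity F m n (tau r) := by
  have h := hf (tau r) _ (gen_mem r)
  rwa [vectorField_gen, zero_add] at h

/-- An even vector field is a derivation of the associative algebra `𝔄(m,n)`. -/
theorem vectorField_mul {f : Fin m ⊕ Fin n → Alg F m n}
    (hf : ∀ r, f r ∈ Alg.parity F m n (tau r)) (g h : Alg F m n) :
    vectorField f (g * h) = vectorField f g * h + g * vectorField f h := by
  simp only [vectorField_apply, Finset.sum_mul, Finset.mul_sum, ← Finset.sum_add_distrib]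
  refine Finset.sum_congr rfl fun r _ => ?_
  cases r with
  | inl i =>
    rw [D_mul_inl, mul_add, mul_assoc, ← mul_assoc (f _) g, Alg.even_comm (hf (Sum.inl i)) g,
      mul_assoc]
  | inr k =>
    rw [D_mul_inr, mul_add, mul_assoc, ← mul_assoc (f _) (Alg.sigma F m n g),
      Alg.odd_comm (hf (Sum.inr k)), mul_assoc]

theorem DividedPow.der_comm (i j : Fin m) (a : DividedPow F m) :
    DividedPow.der F i (DividedPow.der F j a) = DividedPow.der F j (DividedPow.der F i a) := by
  have h : (DividedPow.der F i).comp (DividedPow.der F j) =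
      (DividedPow.der F j).comp (DividedPow.der F i) := by
    refine DividedPow.ext_mon fun α => ?_
    by_cases hij : i = j
    · rw [hij]
    have hji : j ≠ i := Ne.symm hij
    simp only [LinearMap.comp_apply, der_mon]
    by_cases hi : α i = 0 <;> by_cases hj : α j = 0 <;>
      simp [hi, hj, der_mon, hij, hji, tsub_right_comm]
  exact congrArg (fun f => f a) h

theorem Ext.der_comm (k l : Fin n) (a : Ext F n) :
    Ext.der F k (Ext.der F l a) = - Ext.der F l (Ext.der F k a) :=
  CliffordAlgebra.contractLeft_comm (Q := (0 : QuadraticForm F (Fin n → F))) _ _ a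

theorem D_comm (r s : Fin m ⊕ Fin n) (h : Alg F m n) :
    D F r (D F s h) = (if tau r = 1 ∧ tau s = 1 then -1 else 1 : F) • D F s (D F r h) := by
  induction h using TensorProduct.induction_on with
  | zero => simp
  | add x y hx hy => rw [map_add, map_add, hx, hy, map_add, map_add, smul_add]
  | tmul a b =>
    cases r with
    | inl i =>
      cases s with
      | inl j => simp [D, tau, DividedPow.der_comm i j]
      | inr l => simp [D, tau]
    | inr k =>
      cases s with
      | inl j => simp [D, tau]
      | inr l =>
        simp only [D, tau, TensorProduct.map_tmul, LinearMap.id_apply, Ext.der_comm k l,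
          and_self, if_true]
        rw [← TensorProduct.tmul_smul, neg_one_smul]

theorem parity_comm {r s : Fin m ⊕ Fin n} {f g : Alg F m n}
    (hf : f ∈ Alg.parity F m n (tau r)) (hg : g ∈ Alg.parity F m n (tau s)) :
    f * g = (if tau r = 1 ∧ tau s = 1 then -1 else 1 : F) • (g * f) := by
  cases r with
  | inl i => simp [tau, Alg.even_comm (f := f) hf]
  | inr k =>
    cases s with
    | inl j => simp [tau, Alg.even_comm (f := g) hg]
    | inr l =>
      have h : Alg.sigma F m n g = (-1 : F) • g := by
        change g ∈ Alg.parity F m n 1 at hg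
        induction hg using Submodule.span_induction with
        | mem x hx =>
          obtain ⟨a, b, hb, rfl⟩ := hx
          rw [Alg.sigma, TensorProduct.map_tmul, AlgHom.toLinearMap_apply,
            CliffordAlgebra.involute_eq_of_mem_odd hb, LinearMap.id_apply, ← TensorProduct.tmul_smul,
            neg_one_smul]
        | zero => simp
        | add x y _ _ hx hy => rw [map_add, hx, hy, smul_add]
        | smul c x _ hx => rw [map_smul, hx, smul_comm]
      have h2 := Alg.odd_comm (f := f) hf g
      rw [h, mul_smul_comm] at h2
      rw [← h2, smul_smul]
      simp [tau]

theorem lie_vectorField {f g : Fin m ⊕ Fin n → Alg F m n}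
    (hf : ∀ r, f r ∈ Alg.parity F m n (tau r)) (hg : ∀ r, g r ∈ Alg.parity F m n (tau r)) :
    ⁅vectorField f, vectorField g⁆ =
      vectorField fun r => vectorField f (g r) - vectorField g (f r) := by
  refine LinearMap.ext fun h => ?_
  rw [Ring.lie_def, LinearMap.sub_apply, Module.End.mul_apply, Module.End.mul_apply]
  conv_lhs => rw [vectorField_apply g h, vectorField_apply f h, map_sum, map_sum]
  rw [vectorField_apply]
  simp only [vectorField_mul hf, vectorField_mul hg, sub_mul, Finset.sum_add_distrib,
    Finset.sum_sub_distrib]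
  have key : ∑ s, g s * vectorField f (D F s h) = ∑ r, f r * vectorField g (D F r h) := by
    simp only [vectorField_apply, Finset.mul_sum]
    rw [Finset.sum_comm]
    refine Finset.sum_congr rfl fun r _ => Finset.sum_congr rfl fun s _ => ?_
    rw [← mul_assoc, ← mul_assoc, parity_comm (hg s) (hf r), D_comm r s, smul_mul_assoc,
      mul_smul_comm, smul_smul]
    by_cases h1 : tau r = 1 <;> by_cases h2 : tau s = 1 <;> simp [h1, h2]
  rw [key]
  abel

theorem dvd_binom {p : ℕ} [hp : Fact p.Prime] {a b t : ℕ} (ha : a < p ^ t) (hb : b < p ^ t)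
    (hab : p ^ t ≤ a + b) : p ∣ (a + b).choose a := by
  rw [Nat.choose_symm_add]
  have hpos : (a + b).choose b ≠ 0 := (Nat.choose_pos (Nat.le_add_left b a)).ne'
  refine dvd_of_one_le_padicValNat ?_
  rw [padicValNat_choose' (b := max (t + 1) (Nat.log p (a + b) + 1)) (by
    rw [lt_max_iff]; right; omega)]
  refine Finset.card_pos.mpr ⟨t, ?_⟩
  rw [Finset.mem_filter, Finset.mem_Ico, Nat.mod_eq_of_lt ha, Nat.mod_eq_of_lt hb]
  refine ⟨⟨?_, by rw [lt_max_iff]; left; omega⟩, by omega⟩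
  rcases Nat.eq_zero_or_pos t with rfl | h
  · simp at ha hb hab
    omega
  · exact h

theorem trunc_mul {p : ℕ} [Fact p.Prime] [CharP F p] {t : Fin m → ℕ} {f g : Alg F m n}
    (hf : f ∈ Alg.trunc F p m n t) (hg : g ∈ Alg.trunc F p m n t) :
    f * g ∈ Alg.trunc F p m n t := by
  induction hf using Submodule.span_induction with
  | zero => simp
  | add x y _ _ hx hy => rw [add_mul]; exact add_mem hx hy
  | smul c x _ hx => rw [smul_mul_assoc]; exact Submodule.smul_mem _ c hx
  | mem x hx =>
    obtain ⟨α, b, hα, rfl⟩ := hx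
    induction hg using Submodule.span_induction with
    | zero => simp
    | add x y _ _ hx hy => rw [mul_add]; exact add_mem hx hy
    | smul c x _ hx => rw [mul_smul_comm]; exact Submodule.smul_mem _ c hx
    | mem y hy =>
      obtain ⟨β, d, hβ, rfl⟩ := hy
      rw [Algebra.TensorProduct.tmul_mul_tmul, DividedPow.mon_mul_mon, ← TensorProduct.smul_tmul']
      by_cases h : ∀ i, α i + β i < p ^ t i
      · exact Submodule.smul_mem _ _ (Submodule.subset_span ⟨_, _, h, rfl⟩)
      · push Not at h
        obtain ⟨i, hi⟩ := h
        have h0 : (binom α β : F) = 0 := by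
          rw [CharP.cast_eq_zero_iff F p]
          exact (dvd_binom (hα i) (hβ i) hi).trans (Finset.dvd_prod_of_mem _ (Finset.mem_univ i))
        rw [h0, zero_smul]
        exact zero_mem _

theorem trunc_D {p : ℕ} {t : Fin m → ℕ} (r : Fin m ⊕ Fin n) {g : Alg F m n}
    (hg : g ∈ Alg.trunc F p m n t) : D F r g ∈ Alg.trunc F p m n t := by
  induction hg using Submodule.span_induction with
  | zero => simp
  | add x y _ _ hx hy => rw [map_add]; exact add_mem hx hy
  | smul c x _ hx => rw [map_smul]; exact Submodule.smul_mem _ c hx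
  | mem y hy =>
    obtain ⟨β, d, hβ, rfl⟩ := hy
    cases r with
    | inl i =>
      simp only [D, TensorProduct.map_tmul, DividedPow.der_mon, LinearMap.id_apply]
      split_ifs
      · simp
      · exact Submodule.subset_span ⟨_, _, fun j => (Nat.sub_le _ _).trans_lt (hβ j), rfl⟩
    | inr k => exact Submodule.subset_span ⟨_, _, hβ, rfl⟩

/-! ### The Lie algebra `𝒲` and the outer derivation algebra -/

/-- The even part `𝒲` of `W(m,n;t)`. For even operators the bracket
`AB - (-1)^(p(A)p(B)) BA` of the Lie superalgebra is the commutator, so that `𝒲` is a Lie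
subalgebra of `End 𝔄(m,n)`. -/
def evenW (F : Type*) [Field F] (p : ℕ) [Fact p.Prime] [CharP F p] (m n : ℕ) (t : Fin m → ℕ) :
    LieSubalgebra F (Module.End F (Alg F m n)) :=
  { W F p m n t ⊓ endParity (Alg.parity F m n) 0 with
    lie_mem' := by
      rintro _ _ ⟨⟨f, hf, rfl⟩, hA⟩ ⟨⟨g, hg, rfl⟩, hB⟩
      refine ⟨⟨_, fun r => ?_, lie_vectorField (coeff_mem hA) (coeff_mem hB)⟩, ?_⟩
      · rw [vectorField_apply, vectorField_apply]
        exact sub_mem (sum_mem fun s _ => trunc_mul (hf s) (trunc_D s (hg r)))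
          (sum_mem fun s _ => trunc_mul (hg s) (trunc_D s (hf r)))
      · intro μ v hv
        have h1 := hA _ _ (hB _ _ hv)
        have h2 := hB _ _ (hA _ _ hv)
        rw [zero_add, zero_add] at h1 h2
        rw [zero_add, Ring.lie_def]
        exact sub_mem h1 h2 }

/-- The ideal `ad L` of inner derivations in the derivation algebra `Der L`. -/
def innerDer (F L : Type*) [CommRing F] [LieRing L] [LieAlgebra F L] :
    LieIdeal F (LieDerivation F L L) :=
  { LinearMap.range (LieDerivation.ad F L : L →ₗ[F] LieDerivation F L L) with
    lie_mem := by
      rintro d _ ⟨x, rfl⟩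
      refine ⟨d x, ?_⟩
      ext y
      simp }

/-- The outer derivation algebra `Der L / ad L`. -/
abbrev OuterDer (F L : Type*) [CommRing F] [LieRing L] [LieAlgebra F L] : Type _ :=
  LieDerivation F L L ⧸ innerDer F L

end CartanW

end

open scoped TensorProduct

noncomputable section

namespace CartanW

attribute [local instance] LieRing.ofAssociativeRing

variable {F : Type*} [Field F] {m n : ℕ}

/-! ### The monomial basis of the exterior algebra -/

namespace Ext

/-! Fields are expanded in the basis `x^(α) ξ_S D_r`, where `α i < p ^ t i` and `|S|` has the parity
of `r`. Two families of elements act transparently on coordinates: `ad D_i` shifts exponents by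
`ε_i`, without scalars because the powers are divided, and `ad (x_s D_s)` is diagonal with
eigenvalues `wt` in `F`. Hence a derivation killing every `D_i` sends a field, once it kills the
brackets of that field with the `D_i`, to a field with constant coefficients. If it also kills the
torus of the `x_s D_s`, it preserves weights. These two constraints carry the whole proof.

Given a derivation `d`, inner derivations are subtracted in turn. The values `d D_i` form a closed
system, `[D_i, d D_j] = [D_j, d D_i]`, which integrates in the truncated algebra unless the exponent
of `x_i` in `d D_i` reaches `p ^ t i - 1`. That obstruction is `(ad D_i) ^ (p ^ t i - 1) (d D_i)`,
which is central by `ad_pow_derivation_central`, and the center is zero (`exists_eq_on_elD`). On the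
torus `d` is then a cocycle: its parts of nonzero weight are a coboundary, and a part `∑ a_q ξ_q
D_q` of weight zero must satisfy `a_k + a_l = 0` for all pairs, so it vanishes because `n ≥ 3` and
`p ≠ 2` (`exists_eq_on_elH`). A torus element finally removes the scalars by which `d` acts on some
`ξ_k D_l` and on one field `ξ_k ξ_l D_j` (`exists_eq_on_gl`).

What this cannot remove is a constant term in `d (x_i^(p^s) D_r)` for `r ≠ i` and `1 ≤ s < t i`,
since `x_i^(p^s) D_r` and `D_r` have equal weights modulo `p`. The derivations `(ad D_i) ^ (p ^ s)`
produce precisely such terms, so a combination `powerDer` of them is subtracted. The result,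
`IsNormalized`, is zero: its kernel is a subalgebra, and `fullAt` shows by induction on the degree
of `x^(α)` that it contains every basis field. Weights settle generic `α`; exponents that are `-1`,
or `0` without vanishing, modulo `p` are reached by brackets whose binomial coefficients are prime
to `p`.

Conversely, if such a combination equals `ad u`, then `u` commutes with every `D_i` and has constant
coefficients, so `[u, x_i^(p^s) D_i]` has no constant term and the combination is trivial
(`eq_zero_of_powerDer_eq_ad`). The powers commute, being coordinate shifts, and there are `∑ (t i -
1)` of them. The argument runs in any `Model`, a Lie algebra embedded in the operators with image
`𝒲`. -/

/-- The monomials `ξ_S` as a basis of the exterior algebra. -/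
def basis (F : Type*) [Field F] (n : ℕ) : Module.Basis (Finset (Fin n)) F (Ext F n) :=
  (Pi.basisFun F (Fin n)).ExteriorAlgebra

/-- The generators `ξ_k` of the exterior algebra. -/
abbrev xi (F : Type*) [Field F] {n : ℕ} (k : Fin n) : Ext F n :=
  ExteriorAlgebra.ι F (Pi.single k 1)

theorem basis_empty : basis F n ∅ = 1 := by
  rw [basis, ExteriorAlgebra.basis_apply_ofCard _ Finset.card_empty]
  simp [ExteriorAlgebra.ιMulti_family]

theorem basis_singleton (k : Fin n) : basis F n {k} = xi F k := by
  rw [basis, ExteriorAlgebra.basis_apply_ofCard _ (Finset.card_singleton k)]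
  have h : (Set.powersetCard.ofFinEmbEquiv.symm
      (Set.powersetCard.ofCard (Finset.card_singleton k))) 0 = k := by
    have := (Set.powersetCard.mem_range_ofFinEmbEquiv_symm_iff_mem
      (Set.powersetCard.ofCard (Finset.card_singleton k)) k).mpr (by
        simp [Set.powersetCard.ofCard])
    obtain ⟨j, hj⟩ := this
    rwa [Subsingleton.elim j 0] at hj
  simp [ExteriorAlgebra.ιMulti_family, ExteriorAlgebra.ιMulti_apply, h]

theorem xi_mul_basis_of_mem {k : Fin n} {S : Finset (Fin n)} (hk : k ∈ S) :
    xi F k * basis F n S = 0 := by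
  rw [← basis_singleton, basis]
  exact ExteriorAlgebra.basis_mul_of_not_disjoint _
    (Set.powersetCard.ofCard (Finset.card_singleton k)) (Set.powersetCard.ofCard rfl)
    (by simpa [Set.powersetCard.ofCard] using hk)

theorem xi_mul_basis {k : Fin n} {S : Finset (Fin n)} (hk : k ∉ S) :
    ∃ c : F, c ≠ 0 ∧ xi F k * basis F n S = c • basis F n (insert k S) := by
  have hd : Disjoint (Set.powersetCard.ofCard (Finset.card_singleton k)).val
      (Set.powersetCard.ofCard (rfl : S.card = S.card)).val := by
    simpa [Set.powersetCard.ofCard] using hk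
  have h := ExteriorAlgebra.basis_mul_of_disjoint (Pi.basisFun F (Fin n)) _ _ hd
  rw [← basis_singleton, basis]
  refine ⟨((Set.powersetCard.permOfDisjoint hd).sign : ℤ), ?_, ?_⟩
  · rcases Int.units_eq_one_or (Set.powersetCard.permOfDisjoint hd).sign with h | h <;> simp [h]
  · refine h.trans ?_
    rw [Units.smul_def, ← Int.cast_smul_eq_zsmul F]
    congr 2
    rw [Finset.insert_eq]
    simp [Set.powersetCard.disjUnion, Set.powersetCard.ofCard]

/-- The sign is hidden in an unspecified scalar: later arguments only concern membership in
subspaces. -/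
theorem basis_insert {k : Fin n} {S : Finset (Fin n)} (hk : k ∉ S) :
    ∃ c : F, basis F n (insert k S) = c • (xi F k * basis F n S) := by
  obtain ⟨c, hc, h⟩ := xi_mul_basis (F := F) hk
  exact ⟨c⁻¹, by rw [h, inv_smul_smul₀ hc]⟩

theorem der_ι_mul (k : Fin n) (v : Fin n → F) (b : Ext F n) :
    der F k (ExteriorAlgebra.ι F v * b) = v k • b - ExteriorAlgebra.ι F v * der F k b :=
  CliffordAlgebra.contractLeft_ι_mul (Q := (0 : QuadraticForm F (Fin n → F))) _ _ b

theorem der_xi_mul (k l : Fin n) (b : Ext F n) :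
    der F k (xi F l * b) = (if k = l then b else 0) - xi F l * der F k b := by
  rw [xi, der_ι_mul, Pi.single_apply]
  split_ifs <;> simp

theorem der_one (k : Fin n) : der F k (1 : Ext F n) = 0 :=
  CliffordAlgebra.contractLeft_one (Q := (0 : QuadraticForm F (Fin n → F))) _

theorem der_xi (k l : Fin n) : der F k (xi F l) = if k = l then 1 else 0 := by
  have := der_xi_mul (F := F) k l 1
  rwa [der_one, mul_one, mul_zero, sub_zero] at this

theorem der_basis_of_notMem {k : Fin n} {S : Finset (Fin n)} (hk : k ∉ S) :
    der F k (basis F n S) = 0 := by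
  induction S using Finset.induction_on with
  | empty => rw [basis_empty, der_one]
  | insert a S ha ih =>
    rw [Finset.mem_insert, not_or] at hk
    obtain ⟨c, hc⟩ := basis_insert (F := F) ha
    rw [hc, map_smul, der_xi_mul, if_neg hk.1, ih hk.2]
    simp

/-- This diagonal action is the source of the exterior part of the weights. -/
theorem xi_mul_der_basis (k : Fin n) (S : Finset (Fin n)) :
    xi F k * der F k (basis F n S) = (if k ∈ S then (1 : F) else 0) • basis F n S := by
  split_ifs with hk
  · obtain ⟨c, hc⟩ := basis_insert (F := F) (Finset.notMem_erase k S)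
    rw [Finset.insert_erase hk] at hc
    rw [hc, map_smul, der_xi_mul, if_pos rfl, der_basis_of_notMem (Finset.notMem_erase k S)]
    simp
  · rw [der_basis_of_notMem hk]
    simp

open CliffordAlgebra in
theorem ι_mul_mem_evenOdd (v : Fin n → F) {b : Ext F n} {θ η : ZMod 2} (h : 1 + θ = η)
    (hb : b ∈ evenOdd (0 : QuadraticForm F (Fin n → F)) θ) :
    ExteriorAlgebra.ι F v * b ∈ evenOdd (0 : QuadraticForm F (Fin n → F)) η := by
  subst h
  exact SetLike.mul_mem_graded (ι_mem_evenOdd_one _ _) hb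

open CliffordAlgebra in
theorem basis_mem_evenOdd {S : Finset (Fin n)} {θ : ZMod 2} (h : (S.card : ZMod 2) = θ) :
    basis F n S ∈ evenOdd (0 : QuadraticForm F (Fin n → F)) θ := by
  subst h
  induction S using Finset.induction_on with
  | empty => rw [basis_empty, Finset.card_empty, Nat.cast_zero]; exact SetLike.one_mem_graded _
  | insert a S ha ih =>
    obtain ⟨c, hc⟩ := basis_insert (F := F) ha
    rw [hc, Finset.card_insert_of_notMem ha]
    exact Submodule.smul_mem _ _ (ι_mul_mem_evenOdd _ (by push_cast; ring) ih)

/-- The span of the monomials `ξ_S` with `|S|` of parity `θ`. -/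
def monSpan (F : Type*) [Field F] (n : ℕ) (θ : ZMod 2) : Submodule F (Ext F n) :=
  Submodule.span F {b | ∃ S : Finset (Fin n), (S.card : ZMod 2) = θ ∧ b = basis F n S}

theorem ι_mul_mem_monSpan (v : Fin n → F) {b : Ext F n} {θ : ZMod 2} (hb : b ∈ monSpan F n θ) :
    ExteriorAlgebra.ι F v * b ∈ monSpan F n (1 + θ) := by
  have hv : ExteriorAlgebra.ι F v = ∑ k, v k • xi F k := by
    conv_lhs => rw [← (Pi.basisFun F (Fin n)).sum_repr v]
    simp [map_sum, Pi.basisFun_apply]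
  rw [hv, Finset.sum_mul]
  refine sum_mem fun k _ => ?_
  rw [smul_mul_assoc]
  refine Submodule.smul_mem _ _ ?_
  induction hb using Submodule.span_induction with
  | zero => simp
  | add x y _ _ hx hy => rw [mul_add]; exact add_mem hx hy
  | smul c x _ hx => rw [mul_smul_comm]; exact Submodule.smul_mem _ c hx
  | mem x hx =>
    obtain ⟨S, hS, rfl⟩ := hx
    by_cases hk : k ∈ S
    · rw [xi_mul_basis_of_mem hk]; exact zero_mem _
    · obtain ⟨c, -, hc⟩ := xi_mul_basis (F := F) hk
      rw [hc]
      refine Submodule.smul_mem _ _ (Submodule.subset_span ⟨_, ?_, rfl⟩)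
      rw [Finset.card_insert_of_notMem hk, ← hS]
      push_cast; ring

/-- Makes parity visible on coordinates. The even and odd parts are built from `1` and from vectors
by multiplying with pairs of vectors, which preserves the parity of `|S|`. -/
theorem evenOdd_eq_monSpan (θ : ZMod 2) :
    CliffordAlgebra.evenOdd (0 : QuadraticForm F (Fin n → F)) θ = monSpan F n θ := by
  refine le_antisymm ?_ ?_
  · have hι (v w : Fin n → F) (x : Ext F n) (η : ZMod 2) (hx : x ∈ monSpan F n η) :
        CliffordAlgebra.ι (0 : QuadraticForm F (Fin n → F)) v * CliffordAlgebra.ι 0 w * x ∈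
          monSpan F n η := by
      rw [mul_assoc]
      have := ι_mul_mem_monSpan v (ι_mul_mem_monSpan w hx)
      rwa [← add_assoc, show (1 + 1 : ZMod 2) = 0 from rfl, zero_add] at this
    have h1 : (1 : Ext F n) ∈ monSpan F n 0 :=
      Submodule.subset_span ⟨∅, by simp, basis_empty.symm⟩
    intro b hb
    fin_cases θ
    · induction b, hb using CliffordAlgebra.even_induction with
      | algebraMap r =>
        rw [Algebra.algebraMap_eq_smul_one]
        exact Submodule.smul_mem _ _ h1
      | add x y _ _ hx hy => exact add_mem hx hy
      | ι_mul_ι_mul v w x _ hx => exact hι v w x _ hx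
    · induction b, hb using CliffordAlgebra.odd_induction with
      | ι v =>
        have := ι_mul_mem_monSpan v h1
        rwa [mul_one, add_zero] at this
      | add x y _ _ hx hy => exact add_mem hx hy
      | ι_mul_ι_mul v w x _ hx => exact hι v w x _ hx
  · refine Submodule.span_le.mpr ?_
    rintro _ ⟨S, hS, rfl⟩
    exact basis_mem_evenOdd hS

theorem der_mem_evenOdd (k : Fin n) {b : Ext F n} {θ η : ZMod 2} (h : 1 + θ = η)
    (hb : b ∈ CliffordAlgebra.evenOdd (0 : QuadraticForm F (Fin n → F)) θ) :
    der F k b ∈ CliffordAlgebra.evenOdd (0 : QuadraticForm F (Fin n → F)) η := by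
  subst h
  rw [evenOdd_eq_monSpan] at hb
  induction hb using Submodule.span_induction with
  | zero => simp
  | add x y _ _ hx hy => rw [map_add]; exact add_mem hx hy
  | smul c x _ hx => rw [map_smul]; exact Submodule.smul_mem _ c hx
  | mem x hx =>
    obtain ⟨S, hS, rfl⟩ := hx
    by_cases hk : k ∈ S
    · obtain ⟨c, hc⟩ := basis_insert (F := F) (Finset.notMem_erase k S)
      rw [Finset.insert_erase hk] at hc
      rw [hc, map_smul, der_xi_mul, if_pos rfl, der_basis_of_notMem (Finset.notMem_erase k S),
        mul_zero, sub_zero]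
      refine Submodule.smul_mem _ _ (basis_mem_evenOdd ?_)
      have h := Finset.card_erase_add_one hk
      rw [← hS, ← h]
      push_cast
      rw [add_left_comm, show (1 + 1 : ZMod 2) = 0 from rfl, add_zero]
    · rw [der_basis_of_notMem hk]; exact zero_mem _

end Ext

/-! ### Monomials and coordinates in `𝔄(m,n)` -/

open DividedPow (mon_mul_mon der_mon)

/-- The element `x^(α) b`. -/
def Alg.mon (α : Fin m → ℕ) (b : Ext F n) : Alg F m n := DividedPow.mon F α ⊗ₜ b

/-- The elements `x^(α) ξ_S` as a basis of `𝔄(m,n)`. -/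
def Alg.basis (F : Type*) [Field F] (m n : ℕ) :
    Module.Basis ((Fin m → ℕ) × Finset (Fin n)) F (Alg F m n) :=
  (DividedPow.basis F m).tensorProduct (Ext.basis F n)

theorem Alg.basis_apply (q : (Fin m → ℕ) × Finset (Fin n)) :
    Alg.basis F m n q = Alg.mon q.1 (Ext.basis F n q.2) := by
  rw [Alg.basis, Module.Basis.tensorProduct_apply']
  rfl

theorem Alg.mon_add (α : Fin m → ℕ) (b c : Ext F n) :
    Alg.mon α (b + c) = Alg.mon α b + Alg.mon α c := TensorProduct.tmul_add _ _ _

theorem Alg.mon_smul (α : Fin m → ℕ) (c : F) (b : Ext F n) :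
    Alg.mon α (c • b) = c • Alg.mon α b := TensorProduct.tmul_smul _ _ _

theorem Alg.mon_zero (α : Fin m → ℕ) : Alg.mon α (0 : Ext F n) = 0 := TensorProduct.tmul_zero _ _

theorem Alg.mon_neg (α : Fin m → ℕ) (b : Ext F n) :
    Alg.mon α (-b) = - Alg.mon α b := TensorProduct.tmul_neg _ _

theorem Alg.mon_zero_one : Alg.mon (0 : Fin m → ℕ) (1 : Ext F n) = 1 := rfl

theorem D_inl_mon (i : Fin m) (α : Fin m → ℕ) (b : Ext F n) :
    D F (Sum.inl i) (Alg.mon α b) = if α i = 0 then 0 else Alg.mon (α - Pi.single i 1) b := by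
  simp only [D, Alg.mon, TensorProduct.map_tmul, DividedPow.der_mon, LinearMap.id_apply]
  split_ifs
  · rw [TensorProduct.zero_tmul]
  · rfl

theorem D_inr_mon (k : Fin n) (α : Fin m → ℕ) (b : Ext F n) :
    D F (Sum.inr k) (Alg.mon α b) = Alg.mon α (Ext.der F k b) := rfl

theorem Alg.mon_mul_mon (α β : Fin m → ℕ) (b c : Ext F n) :
    Alg.mon α b * Alg.mon β c = (binom α β : F) • Alg.mon (α + β) (b * c) := by
  rw [Alg.mon, Alg.mon, Algebra.TensorProduct.tmul_mul_tmul, DividedPow.mon_mul_mon,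
    ← TensorProduct.smul_tmul']
  rfl

theorem gen_inl (i : Fin m) :
    (gen F (Sum.inl i) : Alg F m n) = Alg.mon (Pi.single i 1) 1 := rfl

theorem gen_inr (k : Fin n) : (gen F (Sum.inr k) : Alg F m n) = Alg.mon 0 (Ext.xi F k) := rfl

theorem binom_zero_left (α : Fin m → ℕ) : binom 0 α = 1 := by simp [binom]

theorem binom_zero_right (α : Fin m → ℕ) : binom α 0 = 1 := by simp [binom]

theorem binom_single (i : Fin m) (a : ℕ) (α : Fin m → ℕ) :
    binom (Pi.single i a) α = (a + α i).choose a := by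
  unfold binom
  rw [Finset.prod_eq_single i]
  · simp
  · intro j _ hj; simp [hj]
  · simp

theorem Alg.mon_mem_parity {α : Fin m → ℕ} {b : Ext F n} {θ : ZMod 2}
    (hb : b ∈ CliffordAlgebra.evenOdd (0 : QuadraticForm F (Fin n → F)) θ) :
    Alg.mon α b ∈ Alg.parity F m n θ :=
  Submodule.subset_span ⟨_, _, hb, rfl⟩

theorem Alg.mon_mem_trunc {p : ℕ} {t : Fin m → ℕ} {α : Fin m → ℕ} (hα : ∀ i, α i < p ^ t i)
    (b : Ext F n) : Alg.mon α b ∈ Alg.trunc F p m n t :=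
  Submodule.subset_span ⟨_, _, hα, rfl⟩

theorem Alg.mul_mem_parity {f g : Alg F m n} {θ η : ZMod 2} (hf : f ∈ Alg.parity F m n θ)
    (hg : g ∈ Alg.parity F m n η) : f * g ∈ Alg.parity F m n (θ + η) := by
  induction hf using Submodule.span_induction with
  | zero => simp
  | add x y _ _ hx hy => rw [add_mul]; exact add_mem hx hy
  | smul c x _ hx => rw [smul_mul_assoc]; exact Submodule.smul_mem _ c hx
  | mem x hx =>
    obtain ⟨a, b, hb, rfl⟩ := hx
    induction hg using Submodule.span_induction with
    | zero => simp
    | add x y _ _ hx hy => rw [mul_add]; exact add_mem hx hy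
    | smul c x _ hx => rw [mul_smul_comm]; exact Submodule.smul_mem _ c hx
    | mem y hy =>
      obtain ⟨a', b', hb', rfl⟩ := hy
      rw [Algebra.TensorProduct.tmul_mul_tmul]
      exact Submodule.subset_span ⟨_, _, SetLike.mul_mem_graded hb hb', rfl⟩

theorem D_mem_parity (r : Fin m ⊕ Fin n) {g : Alg F m n} {θ : ZMod 2}
    (hg : g ∈ Alg.parity F m n θ) : D F r g ∈ Alg.parity F m n (tau r + θ) := by
  induction hg using Submodule.span_induction with
  | zero => simp
  | add x y _ _ hx hy => rw [map_add]; exact add_mem hx hy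
  | smul c x _ hx => rw [map_smul]; exact Submodule.smul_mem _ c hx
  | mem y hy =>
    obtain ⟨a, b, hb, rfl⟩ := hy
    cases r with
    | inl i => exact Submodule.subset_span ⟨_, _, by rwa [tau, zero_add], rfl⟩
    | inr k => exact Submodule.subset_span ⟨_, _, Ext.der_mem_evenOdd k rfl hb, rfl⟩

theorem tau_add_self (r : Fin m ⊕ Fin n) : tau r + tau r = 0 := by
  cases r <;> rfl

/-! ### The fields `f D_r` -/

/-- The operator `f D_r`, as a linear function of `f`. -/
def fd (r : Fin m ⊕ Fin n) : Alg F m n →ₗ[F] Module.End F (Alg F m n) :=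
  LinearMap.lcomp F _ (D F r) ∘ₗ LinearMap.mul F _

theorem fd_apply (r : Fin m ⊕ Fin n) (f h : Alg F m n) : fd r f h = f * D F r h := rfl

theorem vectorField_eq_sum (f : Fin m ⊕ Fin n → Alg F m n) :
    vectorField f = ∑ r, fd r (f r) := rfl

theorem vectorField_single (r : Fin m ⊕ Fin n) (f : Alg F m n) :
    vectorField (Pi.single r f) = fd r f := by
  rw [vectorField_eq_sum, Finset.sum_eq_single r]
  · rw [Pi.single_eq_same]
  · intro s _ hs; rw [Pi.single_eq_of_ne hs, map_zero]
  · simp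

theorem single_mem_parity {r : Fin m ⊕ Fin n} {f : Alg F m n}
    (hf : f ∈ Alg.parity F m n (tau r)) (s : Fin m ⊕ Fin n) :
    (Pi.single r f : Fin m ⊕ Fin n → Alg F m n) s ∈ Alg.parity F m n (tau s) := by
  by_cases h : s = r
  · subst h; rwa [Pi.single_eq_same]
  · rw [Pi.single_eq_of_ne h]; exact zero_mem _

/-- The classical formula for vector fields; no signs appear because both fields are even, hence
honest derivations of the algebra. -/
theorem lie_fd {r s : Fin m ⊕ Fin n} {f g : Alg F m n} (hf : f ∈ Alg.parity F m n (tau r))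
    (hg : g ∈ Alg.parity F m n (tau s)) :
    ⁅fd r f, fd s g⁆ = fd s (f * D F r g) - fd r (g * D F s f) := by
  rw [← vectorField_single r, ← vectorField_single s,
    lie_vectorField (single_mem_parity hf) (single_mem_parity hg)]
  simp only [vectorField_single]
  rw [vectorField_eq_sum]
  simp only [map_sub, Finset.sum_sub_distrib]
  congr 1
  · rw [Finset.sum_eq_single s]
    · rw [Pi.single_eq_same, fd_apply]
    · intro s' _ hs; rw [Pi.single_eq_of_ne hs, map_zero, map_zero]
    · simp
  · rw [Finset.sum_eq_single r]
    · rw [Pi.single_eq_same, fd_apply]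
    · intro s' _ hs; rw [Pi.single_eq_of_ne hs, map_zero, map_zero]
    · simp

theorem fd_gen (r s : Fin m ⊕ Fin n) (f : Alg F m n) :
    fd r f (gen F s) = if r = s then f else 0 := by
  rw [fd_apply, D_gen]
  split_ifs <;> simp

/-- The coordinate of an operator at `x^(α) ξ_S D_r`. -/
def coord (α : Fin m → ℕ) (S : Finset (Fin n)) (r : Fin m ⊕ Fin n) :
    Module.End F (Alg F m n) →ₗ[F] F :=
  (Alg.basis F m n).coord (α, S) ∘ₗ LinearMap.applyₗ (gen F r)

theorem coord_apply (α : Fin m → ℕ) (S : Finset (Fin n)) (r : Fin m ⊕ Fin n)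
    (A : Module.End F (Alg F m n)) :
    coord α S r A = (Alg.basis F m n).coord (α, S) (A (gen F r)) := rfl

theorem basis_coord_mon (α β : Fin m → ℕ) (S T : Finset (Fin n)) :
    (Alg.basis F m n).coord (α, S) (Alg.mon β (Ext.basis F n T)) =
      if β = α ∧ T = S then 1 else 0 := by
  have h := Alg.basis_apply (F := F) (m := m) (n := n) (β, T)
  rw [← h, Module.Basis.coord_apply, Module.Basis.repr_self, Finsupp.single_apply]
  simp only [Prod.mk.injEq]

theorem coord_fd_mon (α β : Fin m → ℕ) (S T : Finset (Fin n)) (r s : Fin m ⊕ Fin n) :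
    coord α S r (fd s (Alg.mon β (Ext.basis F n T))) =
      if β = α ∧ T = S ∧ s = r then 1 else 0 := by
  rw [coord_apply, fd_gen]
  by_cases h : s = r
  · rw [if_pos h, basis_coord_mon]; simp [h]
  · rw [if_neg h, map_zero, if_neg (by tauto)]

theorem basis_coord_eq_zero_of_trunc {p : ℕ} {t : Fin m → ℕ} {f : Alg F m n}
    (hf : f ∈ Alg.trunc F p m n t) {α : Fin m → ℕ} {S : Finset (Fin n)} {i : Fin m}
    (hi : p ^ t i ≤ α i) : (Alg.basis F m n).coord (α, S) f = 0 := by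
  induction hf using Submodule.span_induction with
  | zero => simp
  | add x y _ _ hx hy => rw [map_add, hx, hy, add_zero]
  | smul c x _ hx => rw [map_smul, hx, smul_zero]
  | mem x hx =>
    obtain ⟨β, b, hβ, rfl⟩ := hx
    change (Alg.basis F m n).coord (α, S) (Alg.mon β b) = 0
    induction (Ext.basis F n).mem_span b using Submodule.span_induction with
    | mem y hy =>
      obtain ⟨T, rfl⟩ := hy
      rw [basis_coord_mon, if_neg]
      rintro ⟨rfl, -⟩
      exact absurd (hβ i) (by omega)
    | zero => rw [Alg.mon_zero, map_zero]
    | add x y _ _ hx hy => rw [Alg.mon_add, map_add, hx, hy, add_zero]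
    | smul c x _ hx => rw [Alg.mon_smul, map_smul, hx, smul_zero]

theorem basis_coord_eq_zero_of_parity {f : Alg F m n} {θ : ZMod 2}
    (hf : f ∈ Alg.parity F m n θ) {α : Fin m → ℕ} {S : Finset (Fin n)}
    (hS : (S.card : ZMod 2) ≠ θ) : (Alg.basis F m n).coord (α, S) f = 0 := by
  induction hf using Submodule.span_induction with
  | zero => simp
  | add x y _ _ hx hy => rw [map_add, hx, hy, add_zero]
  | smul c x _ hx => rw [map_smul, hx, smul_zero]
  | mem x hx =>
    obtain ⟨a, b, hb, rfl⟩ := hx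
    rw [Ext.evenOdd_eq_monSpan] at hb
    induction hb using Submodule.span_induction with
    | zero => simp
    | add x y _ _ hx hy => rw [TensorProduct.tmul_add, map_add, hx, hy, add_zero]
    | smul c x _ hx => rw [TensorProduct.tmul_smul, map_smul, hx, smul_zero]
    | mem x hx =>
      obtain ⟨T, hT, rfl⟩ := hx
      induction (DividedPow.basis F m).mem_span a using Submodule.span_induction with
      | mem y hy =>
        obtain ⟨β, rfl⟩ := hy
        change (Alg.basis F m n).coord (α, S) (Alg.mon β (Ext.basis F n T)) = 0
        rw [basis_coord_mon, if_neg]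
        rintro ⟨-, rfl⟩
        exact hS hT
      | zero => rw [TensorProduct.zero_tmul, map_zero]
      | add x y _ _ hx hy => rw [TensorProduct.add_tmul, map_add, hx, hy, add_zero]
      | smul c x _ hx => rw [← TensorProduct.smul_tmul', map_smul, hx, smul_zero]

/-! ### Coordinates of elements of `𝒲` -/

/-- The eigenvalue of `x_s D_s` on `x^(α) ξ_S`. -/
def wt₀ (F : Type*) [Field F] (α : Fin m → ℕ) (S : Finset (Fin n)) : Fin m ⊕ Fin n → F
  | Sum.inl i => α i
  | Sum.inr k => if k ∈ S then 1 else 0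

/-- The eigenvalue of `ad (x_s D_s)` on `x^(α) ξ_S D_r`. -/
def wt (F : Type*) [Field F] (α : Fin m → ℕ) (S : Finset (Fin n)) (r s : Fin m ⊕ Fin n) : F :=
  wt₀ F α S s - if s = r then 1 else 0

theorem gen_mul_D_inl_mon (i : Fin m) (α : Fin m → ℕ) (b : Ext F n) :
    gen F (Sum.inl i) * D F (Sum.inl i) (Alg.mon α b) = (α i : F) • Alg.mon α b := by
  rw [D_inl_mon]
  split_ifs with h
  · rw [h]; simp
  · have h2 : Pi.single i 1 + (α - Pi.single i 1) = α := by
      ext j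
      by_cases hj : j = i
      · subst hj; simp; omega
      · simp [hj]
    rw [gen_inl, Alg.mon_mul_mon, h2, one_mul, binom_single, Nat.choose_one_right]
    congr 2
    simp; omega

theorem gen_mul_D_mon (s : Fin m ⊕ Fin n) (α : Fin m → ℕ) (S : Finset (Fin n)) :
    gen F s * D F s (Alg.mon α (Ext.basis F n S)) =
      wt₀ F α S s • Alg.mon α (Ext.basis F n S) := by
  cases s with
  | inl i => rw [gen_mul_D_inl_mon]; rfl
  | inr k =>
    rw [D_inr_mon, gen_inr, Alg.mon_mul_mon, binom_zero_left, zero_add, Nat.cast_one, one_smul,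
      Ext.xi_mul_der_basis, Alg.mon_smul]
    rfl

theorem basis_coord_gen_mul_D (s : Fin m ⊕ Fin n) (α : Fin m → ℕ) (S : Finset (Fin n))
    (a : Alg F m n) : (Alg.basis F m n).coord (α, S) (gen F s * D F s a) =
      wt₀ F α S s * (Alg.basis F m n).coord (α, S) a := by
  induction (Alg.basis F m n).mem_span a using Submodule.span_induction with
  | zero => simp
  | add x y _ _ hx hy => rw [map_add, mul_add, map_add, hx, hy, map_add, mul_add]
  | smul c x _ hx => rw [map_smul, mul_smul_comm, map_smul, hx, map_smul, smul_eq_mul, smul_eq_mul,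
      mul_left_comm]
  | mem x hx =>
    obtain ⟨⟨β, T⟩, rfl⟩ := hx
    rw [Alg.basis_apply, gen_mul_D_mon, map_smul, basis_coord_mon, smul_eq_mul]
    split_ifs with h
    · rw [h.1, h.2]
    · simp

theorem basis_coord_D_inl (i : Fin m) (α : Fin m → ℕ) (S : Finset (Fin n)) (a : Alg F m n) :
    (Alg.basis F m n).coord (α, S) (D F (Sum.inl i) a) =
      (Alg.basis F m n).coord (α + Pi.single i 1, S) a := by
  induction (Alg.basis F m n).mem_span a using Submodule.span_induction with
  | zero => simp
  | add x y _ _ hx hy => rw [map_add, map_add, hx, hy, map_add]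
  | smul c x _ hx => rw [map_smul, map_smul, hx, map_smul]
  | mem x hx =>
    obtain ⟨⟨β, T⟩, rfl⟩ := hx
    rw [Alg.basis_apply, D_inl_mon, basis_coord_mon]
    by_cases h : β i = 0
    · rw [if_pos h, map_zero, if_neg]
      rintro ⟨h', -⟩
      simp only at h h'
      rw [h'] at h
      simp at h
    · rw [if_neg h, basis_coord_mon]
      refine if_congr (and_congr_left fun _ => ?_) rfl rfl
      simp only at h ⊢
      constructor
      · rintro rfl
        ext j
        by_cases hj : j = i
        · subst hj; simp; omega
        · simp [hj]
      · rintro rfl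
        simp

theorem vectorField_one (f : Fin m ⊕ Fin n → Alg F m n) : vectorField f 1 = 0 := by
  rw [vectorField_apply]
  refine Finset.sum_eq_zero fun r _ => ?_
  cases r with
  | inl i => rw [← Alg.mon_zero_one, D_inl_mon, if_pos (by simp), mul_zero]
  | inr k => rw [← Alg.mon_zero_one, D_inr_mon, Ext.der_one, Alg.mon_zero, mul_zero]

theorem coord_vectorField (f : Fin m ⊕ Fin n → Alg F m n) (α : Fin m → ℕ) (S : Finset (Fin n))
    (r : Fin m ⊕ Fin n) :
    coord α S r (vectorField f) = (Alg.basis F m n).coord (α, S) (f r) := by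
  rw [coord_apply, vectorField_gen]

/-- `D_i` sends each generator to `0` or `1`, and vector fields kill `1`, so `ad D_i` merely
differentiates the coefficients. -/
theorem coord_lie_D (i : Fin m) (f : Fin m ⊕ Fin n → Alg F m n) (α : Fin m → ℕ)
    (S : Finset (Fin n)) (r : Fin m ⊕ Fin n) :
    coord α S r ⁅(D F (Sum.inl i) : Module.End F (Alg F m n)), vectorField f⁆ =
      coord (α + Pi.single i 1) S r (vectorField f) := by
  rw [coord_apply, Ring.lie_def, LinearMap.sub_apply, Module.End.mul_apply, Module.End.mul_apply,
    D_gen]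
  have h : vectorField f (if Sum.inl i = r then 1 else 0) = 0 := by
    split_ifs
    · exact vectorField_one f
    · exact map_zero _
  rw [h, sub_zero, basis_coord_D_inl, coord_apply]

theorem coord_lie_fd_gen (s : Fin m ⊕ Fin n) (f : Fin m ⊕ Fin n → Alg F m n) (α : Fin m → ℕ)
    (S : Finset (Fin n)) (r : Fin m ⊕ Fin n) :
    coord α S r ⁅fd s (gen F s), vectorField f⁆ =
      wt F α S r s * coord α S r (vectorField f) := by
  rw [coord_apply, Ring.lie_def, LinearMap.sub_apply, Module.End.mul_apply, Module.End.mul_apply,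
    fd_gen, fd_apply, map_sub, basis_coord_gen_mul_D, coord_apply, wt]
  by_cases h : s = r
  · subst h; rw [if_pos rfl, if_pos rfl]; ring
  · rw [if_neg h, if_neg h]; simp

section

variable {p : ℕ} [Fact p.Prime] [CharP F p] {t : Fin m → ℕ}

theorem fd_mem {r : Fin m ⊕ Fin n} {f : Alg F m n} (hf : f ∈ Alg.trunc F p m n t)
    (hf' : f ∈ Alg.parity F m n (tau r)) : fd r f ∈ evenW F p m n t := by
  refine ⟨⟨Pi.single r f, fun s => ?_, (vectorField_single r f).symm⟩, fun μ v hv => ?_⟩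
  · by_cases h : s = r
    · subst h; rwa [Pi.single_eq_same]
    · rw [Pi.single_eq_of_ne h]; exact zero_mem _
  · rw [fd_apply]
    have := Alg.mul_mem_parity hf' (D_mem_parity r hv)
    rwa [← add_assoc, tau_add_self] at this

theorem fd_mon_mem {r : Fin m ⊕ Fin n} {α : Fin m → ℕ} (hα : ∀ i, α i < p ^ t i) {b : Ext F n}
    (hb : b ∈ CliffordAlgebra.evenOdd (0 : QuadraticForm F (Fin n → F)) (tau r)) :
    fd r (Alg.mon α b) ∈ evenW F p m n t :=
  fd_mem (Alg.mon_mem_trunc hα b) (Alg.mon_mem_parity hb)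

theorem exists_vectorField {A : Module.End F (Alg F m n)} (hA : A ∈ evenW F p m n t) :
    ∃ f : Fin m ⊕ Fin n → Alg F m n, (∀ r, f r ∈ Alg.trunc F p m n t) ∧
      (∀ r, f r ∈ Alg.parity F m n (tau r)) ∧ A = vectorField f := by
  obtain ⟨⟨f, hf, rfl⟩, hA⟩ := hA
  exact ⟨f, hf, coeff_mem hA, rfl⟩

theorem lt_of_coord_ne_zero {A : Module.End F (Alg F m n)} (hA : A ∈ evenW F p m n t)
    {α : Fin m → ℕ} {S : Finset (Fin n)} {r : Fin m ⊕ Fin n} (h : coord α S r A ≠ 0) (i : Fin m) :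
    α i < p ^ t i := by
  obtain ⟨f, hf, -, rfl⟩ := exists_vectorField hA
  by_contra hi
  rw [coord_vectorField, basis_coord_eq_zero_of_trunc (hf r) (not_lt.mp hi)] at h
  exact h rfl

theorem card_eq_of_coord_ne_zero {A : Module.End F (Alg F m n)} (hA : A ∈ evenW F p m n t)
    {α : Fin m → ℕ} {S : Finset (Fin n)} {r : Fin m ⊕ Fin n} (h : coord α S r A ≠ 0) :
    (S.card : ZMod 2) = tau r := by
  obtain ⟨f, -, hf, rfl⟩ := exists_vectorField hA
  by_contra hS
  rw [coord_vectorField, basis_coord_eq_zero_of_parity (hf r) hS] at h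
  exact h rfl

/-- A vector field is determined by its values on the generators, and these are its coefficients. -/
theorem evenW_ext {A B : Module.End F (Alg F m n)} (hA : A ∈ evenW F p m n t)
    (hB : B ∈ evenW F p m n t) (h : ∀ α S r, coord α S r A = coord α S r B) : A = B := by
  obtain ⟨f, -, -, rfl⟩ := exists_vectorField hA
  obtain ⟨g, -, -, rfl⟩ := exists_vectorField hB
  congr 1
  funext r
  refine (Alg.basis F m n).ext_elem fun q => ?_
  have := h q.1 q.2 r
  rwa [coord_vectorField, coord_vectorField] at this

/-- The condition that the coordinate be nonzero is kept in the spanning set: it yields the bound on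
`α` and the parity of `S` for each field that occurs. -/
theorem mem_span_of_mem_evenW {A : Module.End F (Alg F m n)} (hA : A ∈ evenW F p m n t) :
    A ∈ Submodule.span F {B | ∃ α S r, coord α S r A ≠ 0 ∧
      B = fd r (Alg.mon α (Ext.basis F n S))} := by
  obtain ⟨f, -, -, rfl⟩ := exists_vectorField hA
  have key (r : Fin m ⊕ Fin n) : fd r (f r) = ∑ q ∈ ((Alg.basis F m n).repr (f r)).support,
      (Alg.basis F m n).repr (f r) q • fd r (Alg.mon q.1 (Ext.basis F n q.2)) := by
    conv_lhs => rw [← (Alg.basis F m n).linearCombination_repr (f r)]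
    rw [Finsupp.linearCombination_apply, Finsupp.sum, map_sum]
    exact Finset.sum_congr rfl fun q _ => by rw [map_smul, Alg.basis_apply]
  refine sum_mem fun r _ => ?_
  change fd r (f r) ∈ _
  rw [key]
  refine sum_mem fun q hq => ?_
  refine Submodule.smul_mem _ _ (Submodule.subset_span ⟨q.1, q.2, r, ?_, rfl⟩)
  rw [coord_vectorField]
  exact Finsupp.mem_support_iff.mp hq

end

/-! ### Powers of derivations in positive characteristic -/

section LieAlgebra

variable {L : Type*} [LieRing L] [LieAlgebra F L]

theorem natCast_choose_pow_eq_zero (p : ℕ) [hp : Fact p.Prime] [CharP F p] {s i : ℕ} (h0 : i ≠ 0)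
    (h1 : i ≠ p ^ s) : ((p ^ s).choose i : F) = 0 :=
  (CharP.cast_eq_zero_iff F p _).mpr ((hp.out.dvd_choose_pow_iff).mpr ⟨h0, h1⟩)

/-- In characteristic `p`, the `p ^ s`-th power of a derivation is a derivation. -/
def derivationPow (p : ℕ) [Fact p.Prime] [CharP F p] (s : ℕ) (d : LieDerivation F L L) :
    LieDerivation F L L where
  toLinearMap := (d : L →ₗ[F] L) ^ p ^ s
  leibniz' a b := by
    have hq : p ^ s ≠ 0 := pow_ne_zero _ (Fact.out : p.Prime).ne_zero
    rw [Module.End.pow_apply, Module.End.pow_apply, Module.End.pow_apply]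
    change d^[p ^ s] ⁅a, b⁆ = ⁅a, d^[p ^ s] b⁆ - ⁅b, d^[p ^ s] a⁆
    -- In the iterated Leibniz rule only the two end terms survive, the inner binomial coefficients
    -- being divisible by `p`.
    rw [d.iterate_apply_lie', Finset.sum_eq_add_of_mem 0 (p ^ s) (by simp) (by simp) hq.symm]
    · simp only [Nat.choose_zero_right, one_smul, Nat.choose_self, Nat.sub_zero, Nat.sub_self,
        Function.iterate_zero, id]
      rw [← lie_skew b]
      abel
    · intro i hi h
      rw [← Nat.cast_smul_eq_nsmul F, natCast_choose_pow_eq_zero p h.1 h.2, zero_smul]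

theorem derivationPow_apply (p : ℕ) [Fact p.Prime] [CharP F p] (s : ℕ) (d : LieDerivation F L L)
    (a : L) : derivationPow p s d a = ((d : L →ₗ[F] L) ^ p ^ s) a := rfl

/-- If `(ad x) ^ p ^ s = 0` and `d` is a derivation, then `(ad x) ^ (p ^ s - 1) (d x)` is
central. -/
theorem ad_pow_derivation_central (p : ℕ) [Fact p.Prime] [CharP F p] {s : ℕ}
    (d : LieDerivation F L L) {x : L} (hx : LieAlgebra.ad F L x ^ p ^ s = 0) (y : L) :
    ⁅(LieAlgebra.ad F L x ^ (p ^ s - 1)) (d x), y⁆ = 0 := by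
  rcases subsingleton_or_nontrivial L with hL | hL
  · exact Subsingleton.elim _ _
  have hc : CharP (Module.End F (Module.End F L)) p :=
    charP_of_injective_algebraMap (FaithfulSMul.algebraMap_injective F _) p
  -- With `X = ad x`, `ad X` is left minus right multiplication by `X`. These commute, so in
  -- characteristic `p` the power is left minus right multiplication by `X ^ p ^ s = 0`.
  have h1 : LieAlgebra.ad F (Module.End F L) (LieAlgebra.ad F L x) ^ p ^ s = 0 := by
    rw [LieAlgebra.ad_eq_lmul_left_sub_lmul_right]
    change (LinearMap.mulLeft F (LieAlgebra.ad F L x) - LinearMap.mulRight F _) ^ p ^ s = 0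
    rw [sub_pow_char_pow_of_commute p s (LinearMap.commute_mulLeft_right _ _),
      LinearMap.pow_mulLeft, LinearMap.pow_mulRight, hx, LinearMap.mulLeft_zero_eq_zero,
      LinearMap.mulRight_zero_eq_zero, sub_zero]
  have h2 (k : ℕ) (u : L) :
      (LieAlgebra.ad F (Module.End F L) (LieAlgebra.ad F L x) ^ k) (LieAlgebra.ad F L u) =
        LieAlgebra.ad F L ((LieAlgebra.ad F L x ^ k) u) := by
    induction k with
    | zero => rfl
    | succ k ih =>
      rw [pow_succ', pow_succ', Module.End.mul_apply, Module.End.mul_apply, ih,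
        LieAlgebra.ad_apply, LieAlgebra.ad_apply, LieHom.map_lie]
  -- One application of `ad (ad x)` turns `d` into an inner derivation; `p ^ s - 1` applications
  -- remain for `d x`.
  have h3 : LieAlgebra.ad F (Module.End F L) (LieAlgebra.ad F L x) (d : L →ₗ[F] L) =
      - LieAlgebra.ad F L (d x) := by
    ext z
    rw [LieAlgebra.ad_apply, Ring.lie_def]
    simp only [LinearMap.sub_apply, Module.End.mul_apply, LieAlgebra.ad_apply,
      LieDerivation.coeFn_coe, LinearMap.neg_apply, LieDerivation.apply_lie_eq_add]
    abel
  have hq : p ^ s = p ^ s - 1 + 1 :=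
    (Nat.sub_add_cancel (Nat.one_le_pow _ _ (Fact.out : p.Prime).pos)).symm
  rw [hq, pow_succ] at h1
  have h4 := congrArg (fun f => f (d : L →ₗ[F] L)) h1
  simp only [Module.End.mul_apply] at h4
  rw [h3, map_neg, h2, LinearMap.zero_apply, neg_eq_zero] at h4
  rw [← LieAlgebra.ad_apply F, h4, LinearMap.zero_apply]

end LieAlgebra

/-! ### The standard elements of `𝒲` -/

theorem lie_fd_gen_fd_mon (s r : Fin m ⊕ Fin n) (α : Fin m → ℕ) {S : Finset (Fin n)}
    (hS : (S.card : ZMod 2) = tau r) :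
    ⁅fd s (gen F s), fd r (Alg.mon α (Ext.basis F n S))⁆ =
      wt F α S r s • fd r (Alg.mon α (Ext.basis F n S)) := by
  rw [lie_fd (gen_mem s) (Alg.mon_mem_parity (Ext.basis_mem_evenOdd hS)), gen_mul_D_mon, map_smul,
    wt, D_gen]
  by_cases h : r = s
  · subst h
    rw [if_pos rfl, if_pos rfl, mul_one]
    refine LinearMap.ext fun x => ?_
    rw [LinearMap.sub_apply, LinearMap.smul_apply, LinearMap.smul_apply, sub_smul, one_smul]
  · rw [if_neg h, if_neg (Ne.symm h), mul_zero, map_zero, sub_zero, sub_zero]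

theorem D_mon_zero_inl (i : Fin m) (b : Ext F n) : D F (Sum.inl i) (Alg.mon 0 b) = 0 := by
  rw [D_inl_mon, if_pos (by simp)]

theorem fd_one (r : Fin m ⊕ Fin n) : fd r (Alg.mon 0 1) = D F r := by
  refine LinearMap.ext fun h => ?_
  rw [fd_apply, Alg.mon_zero_one, one_mul]

theorem lie_D_fd_mon (i : Fin m) (r : Fin m ⊕ Fin n) (α : Fin m → ℕ) {b : Ext F n}
    (hb : b ∈ CliffordAlgebra.evenOdd (0 : QuadraticForm F (Fin n → F)) (tau r)) :
    ⁅(D F (Sum.inl i) : Module.End F (Alg F m n)), fd r (Alg.mon α b)⁆ =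
      if α i = 0 then 0 else fd r (Alg.mon (α - Pi.single i 1) b) := by
  have h1 : D F r (Alg.mon (0 : Fin m → ℕ) (1 : Ext F n)) = 0 := by
    cases r with
    | inl i => exact D_mon_zero_inl i _
    | inr k => rw [D_inr_mon, Ext.der_one, Alg.mon_zero]
  rw [← fd_one, lie_fd (Alg.mon_mem_parity (SetLike.one_mem_graded _)) (Alg.mon_mem_parity hb),
    h1, mul_zero, map_zero, sub_zero, Alg.mon_zero_one, one_mul, D_inl_mon]
  split_ifs
  · rw [map_zero]
  · rfl

variable (p : ℕ) [hp : Fact p.Prime] (t : Fin m → ℕ)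

theorem zero_lt_pow (i : Fin m) : (0 : Fin m → ℕ) i < p ^ t i :=
  pow_pos hp.out.pos _

theorem gen_mem_trunc {t : Fin m → ℕ} (ht : ∀ i, 1 ≤ t i) (s : Fin m ⊕ Fin n) :
    gen F s ∈ Alg.trunc F p m n t := by
  cases s with
  | inl i =>
    refine Alg.mon_mem_trunc (fun j => ?_) _
    have := Nat.one_lt_pow (n := t j) (by have := ht j; omega) hp.out.one_lt
    by_cases h : j = i
    · subst h; simpa using this
    · simp [h]; omega
  | inr k => exact Alg.mon_mem_trunc (zero_lt_pow p t) _

variable {p t}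

variable [CharP F p]

/-- A Lie algebra `L` with an isomorphism onto `𝒲`. -/
structure Model (F : Type*) [Field F] (p : ℕ) [Fact p.Prime] [CharP F p] (m n : ℕ)
    (t : Fin m → ℕ) (L : Type*) [LieRing L] [LieAlgebra F L] where
  /-- The elements of `L` as operators. -/
  toEnd : L →ₗ[F] Module.End F (Alg F m n)
  injective : Function.Injective toEnd
  toEnd_lie : ∀ x y, toEnd ⁅x, y⁆ = ⁅toEnd x, toEnd y⁆
  mem : ∀ x, toEnd x ∈ evenW F p m n t
  exists_eq : ∀ A ∈ evenW F p m n t, ∃ x, toEnd x = A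

variable {L : Type*} [LieRing L] [LieAlgebra F L] (φ : Model F p m n t L)

/-- The element of `L` given by an operator in `𝒲`. -/
def Model.lift {A : Module.End F (Alg F m n)} (hA : A ∈ evenW F p m n t) : L :=
  (φ.exists_eq A hA).choose

theorem Model.toEnd_lift {A : Module.End F (Alg F m n)} (hA : A ∈ evenW F p m n t) :
    φ.toEnd (φ.lift hA) = A :=
  (φ.exists_eq A hA).choose_spec

theorem D_mem (i : Fin m) : D F (Sum.inl i) ∈ evenW F p m n t := by
  rw [← fd_one]
  exact fd_mon_mem (zero_lt_pow p t) (SetLike.one_mem_graded _)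

/-- The element `D_i` of `𝒲`. -/
def elD (i : Fin m) : L := φ.lift (D_mem i)

theorem toEnd_elD (i : Fin m) : φ.toEnd (elD φ i) = D F (Sum.inl i) := φ.toEnd_lift _

/-- The element `x_s D_s` of `𝒲`. -/
def elH (ht : ∀ i, 1 ≤ t i) (s : Fin m ⊕ Fin n) : L :=
  φ.lift (fd_mem (gen_mem_trunc p ht s) (gen_mem s))

theorem toEnd_elH (ht : ∀ i, 1 ≤ t i) (s : Fin m ⊕ Fin n) :
    φ.toEnd (elH φ ht s) = fd s (gen F s) := φ.toEnd_lift _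

/-- The coordinate of an element of `𝒲` at `x^(α) ξ_S D_r`. -/
def co (α : Fin m → ℕ) (S : Finset (Fin n)) (r : Fin m ⊕ Fin n) : L →ₗ[F] F :=
  coord α S r ∘ₗ φ.toEnd

theorem co_apply (α : Fin m → ℕ) (S : Finset (Fin n)) (r : Fin m ⊕ Fin n) (y : L) :
    co φ α S r y = coord α S r (φ.toEnd y) := rfl

theorem co_lie_elD (i : Fin m) (y : L) (α : Fin m → ℕ) (S : Finset (Fin n))
    (r : Fin m ⊕ Fin n) : co φ α S r ⁅elD φ i, y⁆ = co φ (α + Pi.single i 1) S r y := by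
  obtain ⟨f, -, -, hf⟩ := exists_vectorField (φ.mem y)
  rw [co_apply, co_apply, φ.toEnd_lie, toEnd_elD, hf]
  exact coord_lie_D i f α S r

theorem co_lie_elH (ht : ∀ i, 1 ≤ t i) (s : Fin m ⊕ Fin n) (y : L)
    (α : Fin m → ℕ) (S : Finset (Fin n)) (r : Fin m ⊕ Fin n) :
    co φ α S r ⁅elH φ ht s, y⁆ = wt F α S r s * co φ α S r y := by
  obtain ⟨f, -, -, hf⟩ := exists_vectorField (φ.mem y)
  rw [co_apply, co_apply, φ.toEnd_lie, toEnd_elH, hf]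
  exact coord_lie_fd_gen s f α S r

theorem co_ad_elD_pow (i : Fin m) (k : ℕ) (y : L) (α : Fin m → ℕ)
    (S : Finset (Fin n)) (r : Fin m ⊕ Fin n) :
    co φ α S r ((LieAlgebra.ad F _ (elD φ i) ^ k) y) = co φ (α + Pi.single i k) S r y := by
  induction k generalizing α with
  | zero => simp
  | succ k ih =>
    rw [pow_succ', Module.End.mul_apply, LieAlgebra.ad_apply, co_lie_elD, ih, add_assoc,
      ← Pi.single_add, add_comm 1 k]

theorem ext_co {y z : L} (h : ∀ α S r, co φ α S r y = co φ α S r z) : y = z :=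
  φ.injective (evenW_ext (φ.mem y) (φ.mem z) h)

theorem ad_elD_pow_eq_zero (i : Fin m) : LieAlgebra.ad F _ (elD φ i) ^ p ^ t i = 0 := by
  refine LinearMap.ext fun y => ext_co φ fun α S r => ?_
  rw [co_ad_elD_pow, LinearMap.zero_apply]
  by_contra h
  rw [map_zero] at h
  have := lt_of_coord_ne_zero (φ.mem y) h i
  simp at this

theorem lie_elH_of_toEnd_eq (ht : ∀ i, 1 ≤ t i) (s r : Fin m ⊕ Fin n) {α : Fin m → ℕ}
    {S : Finset (Fin n)} (hS : (S.card : ZMod 2) = tau r) {y : L}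
    (hy : φ.toEnd y = fd r (Alg.mon α (Ext.basis F n S))) :
    ⁅elH φ ht s, y⁆ = wt F α S r s • y := by
  refine φ.injective ?_
  rw [φ.toEnd_lie, toEnd_elH, map_smul, hy]
  exact lie_fd_gen_fd_mon s r α hS

theorem lie_elD_of_toEnd_eq (i : Fin m) {r : Fin m ⊕ Fin n} {α : Fin m → ℕ} {b : Ext F n}
    (hb : b ∈ CliffordAlgebra.evenOdd (0 : QuadraticForm F (Fin n → F)) (tau r)) {y : L}
    (hy : φ.toEnd y = fd r (Alg.mon α b)) (hi : α i = 0) : ⁅elD φ i, y⁆ = 0 := by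
  refine φ.injective ?_
  rw [φ.toEnd_lie, toEnd_elD, map_zero, hy]
  have h := lie_D_fd_mon (m := m) i r α hb
  rwa [if_pos hi] at h

theorem smul_lie_end (c : F) (A B : Module.End F (Alg F m n)) : ⁅c • A, B⁆ = c • ⁅A, B⁆ :=
  LinearMap.ext fun x => by
    simp only [Ring.lie_def, LinearMap.sub_apply, Module.End.mul_apply, LinearMap.smul_apply,
      map_smul, smul_sub]

/-! ### Constant fields of exterior weight zero, and the center -/

section

variable {p : ℕ} [hp : Fact p.Prime] [CharP F p] {t : Fin m → ℕ}
  {L : Type*} [LieRing L] [LieAlgebra F L] (φ : Model F p m n t L)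

theorem sub_single_add_single {α : Fin m → ℕ} {i : Fin m} (hi : α i ≠ 0) :
    α - Pi.single i 1 + Pi.single i 1 = α := by
  ext j
  by_cases hj : j = i
  · subst hj; simp; omega
  · simp [hj]

theorem wt_inr_ne_zero_of {S : Finset (Fin n)} {r : Fin m ⊕ Fin n}
    (h : ∀ k, wt F (0 : Fin m → ℕ) S r (Sum.inr k) = 0) :
    (∃ a, r = Sum.inl a ∧ S = ∅) ∨ ∃ q, r = Sum.inr q ∧ S = {q} := by
  simp only [wt, wt₀] at h
  cases r with
  | inl a =>
    refine Or.inl ⟨a, rfl, Finset.eq_empty_of_forall_notMem fun k hk => ?_⟩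
    have := h k
    simp [hk] at this
  | inr q =>
    refine Or.inr ⟨q, rfl, Finset.ext fun k => ?_⟩
    have := h k
    rw [Finset.mem_singleton]
    by_cases hk : k ∈ S <;> by_cases hq : k = q <;> simp_all

theorem gen_inr_eq (q : Fin n) :
    (gen F (Sum.inr q) : Alg F m n) = Alg.mon 0 (Ext.basis F n {q}) := by
  rw [gen_inr, Ext.basis_singleton]

/-- An element of `𝒲` with constant coefficients and exterior weight zero. -/
theorem eq_sum_of_wt_inr_eq_zero (v : L)
    (h0 : ∀ α S r, α ≠ 0 → co φ α S r v = 0)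
    (hw : ∀ S r k, wt F (0 : Fin m → ℕ) S r (Sum.inr k) ≠ 0 →
      co φ 0 S r v = 0) :
    (φ.toEnd v) =
      ∑ a, co φ 0 ∅ (Sum.inl a) v • D F (Sum.inl a) +
      ∑ q, co φ 0 {q} (Sum.inr q) v •
        fd (Sum.inr q) (gen F (Sum.inr q)) := by
  refine evenW_ext (φ.mem v) (add_mem (sum_mem fun a _ => Submodule.smul_mem _ _ (D_mem a))
    (sum_mem fun q _ => Submodule.smul_mem _ _ ?_)) fun α S r => ?_
  · rw [gen_inr_eq]
    exact fd_mon_mem (zero_lt_pow p t) (Ext.basis_mem_evenOdd (by simp [tau]))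
  rw [← co_apply φ]
  simp only [map_add, map_sum, map_smul, smul_eq_mul, gen_inr_eq, ← fd_one, ← Ext.basis_empty,
    coord_fd_mon]
  by_cases hα : α = 0
  · subst hα
    by_cases h : ∀ k, wt F (0 : Fin m → ℕ) S r (Sum.inr k) = 0
    · rcases wt_inr_ne_zero_of h with ⟨a, rfl, rfl⟩ | ⟨q, rfl, rfl⟩
      · simp
      · simp
    · have h' := h
      push Not at h'
      obtain ⟨k, hk⟩ := h'
      rw [hw S r k hk, Finset.sum_eq_zero, Finset.sum_eq_zero, add_zero]
      · rintro q -
        rw [if_neg, mul_zero]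
        rintro ⟨-, rfl, rfl⟩
        exact hk (by simp [wt, wt₀])
      · rintro a -
        rw [if_neg, mul_zero]
        rintro ⟨-, rfl, rfl⟩
        exact hk (by simp [wt, wt₀])
  · rw [h0 α S r hα, Finset.sum_eq_zero, Finset.sum_eq_zero, add_zero]
    · rintro q -
      rw [if_neg (fun h => hα h.1.symm), mul_zero]
    · rintro a -
      rw [if_neg (fun h => hα h.1.symm), mul_zero]

theorem lie_eq_sum_smul (v : L)
    (h0 : ∀ α S r, α ≠ 0 → co φ α S r v = 0)
    (hw : ∀ S r k, wt F (0 : Fin m → ℕ) S r (Sum.inr k) ≠ 0 →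
      co φ 0 S r v = 0) (j : Fin m) {S : Finset (Fin n)}
    (hS : (S.card : ZMod 2) = 0) :
    ⁅(φ.toEnd v), fd (Sum.inl j) (Alg.mon 0 (Ext.basis F n S))⁆ =
      (∑ q ∈ S, co φ 0 {q} (Sum.inr q) v) •
        fd (Sum.inl j) (Alg.mon 0 (Ext.basis F n S)) := by
  have h1 (a : Fin m) : ⁅(D F (Sum.inl a) : Module.End F (Alg F m n)),
      fd (Sum.inl j) (Alg.mon 0 (Ext.basis F n S))⁆ = 0 := by
    rw [lie_D_fd_mon a (Sum.inl j) 0 (Ext.basis_mem_evenOdd hS), if_pos (by simp)]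
  have h2 (q : Fin n) : ⁅(fd (Sum.inr q) (gen F (Sum.inr q)) : Module.End F (Alg F m n)),
      fd (Sum.inl j) (Alg.mon 0 (Ext.basis F n S))⁆ =
        (if q ∈ S then (1 : F) else 0) • fd (Sum.inl j) (Alg.mon 0 (Ext.basis F n S)) := by
    rw [lie_fd_gen_fd_mon _ (Sum.inl j) 0 hS]
    simp [wt, wt₀]
  conv_lhs => rw [eq_sum_of_wt_inr_eq_zero φ v h0 hw]
  simp only [add_lie, sum_lie, smul_lie_end, h1, h2, smul_zero, Finset.sum_const_zero, zero_add,
    smul_smul, ← Finset.sum_smul, mul_ite, mul_one, mul_zero, Finset.sum_ite_mem, Finset.univ_inter]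

/-- Here `v` is a combination of the `D_a` and of terms `a_q ξ_q D_q`, and it scales `ξ_k ξ_l D_j`
by `a_k + a_l`. Used for the center, the torus and the main induction, wherever weights alone cannot
exclude `ξ_q D_q`. -/
theorem co_inr_eq_zero (hn : 3 ≤ n) (h2 : (2 : F) ≠ 0) (v : L)
    (h0 : ∀ α S r, α ≠ 0 → co φ α S r v = 0)
    (hw : ∀ S r k, wt F (0 : Fin m → ℕ) S r (Sum.inr k) ≠ 0 →
      co φ 0 S r v = 0) (j : Fin m)
    (hz : ∀ S : Finset (Fin n), S.card = 2 →
      ⁅(φ.toEnd v), fd (Sum.inl j) (Alg.mon 0 (Ext.basis F n S))⁆ = 0)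
    (α : Fin m → ℕ) (S : Finset (Fin n)) (k : Fin n) :
    co φ α S (Sum.inr k) v = 0 := by
  have key (T : Finset (Fin n)) (hT : T.card = 2) :
      ∑ q ∈ T, co φ 0 {q} (Sum.inr q) v = 0 := by
    have h := hz T hT
    rw [lie_eq_sum_smul φ v h0 hw j (by rw [hT]; rfl)] at h
    have h' := congrArg (coord 0 T (Sum.inl j)) h
    rwa [map_smul, coord_fd_mon, if_pos ⟨rfl, rfl, rfl⟩, smul_eq_mul, mul_one, map_zero] at h'
  by_cases hα : α = 0
  swap
  · exact h0 _ _ _ hα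
  subst hα
  by_cases h : ∀ l, wt F (0 : Fin m → ℕ) S (Sum.inr k) (Sum.inr l) = 0
  swap
  · push Not at h
    obtain ⟨l, hl⟩ := h
    exact hw _ _ l hl
  rcases wt_inr_ne_zero_of h with ⟨a, ha, -⟩ | ⟨q, hq, rfl⟩
  · cases ha
  · cases hq
    -- Since `n ≥ 3` there are distinct `k, l, q`; the three vanishing pair sums combine to `2 a_k =
    -- 0`.
    obtain ⟨l, hl⟩ : ∃ l, l ∉ ({k} : Finset (Fin n)) := by
      by_contra! hc
      have := Finset.card_le_card (fun x (_ : x ∈ Finset.univ) => hc x)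
      simp at this
      omega
    obtain ⟨q, hq⟩ : ∃ q, q ∉ ({k, l} : Finset (Fin n)) := by
      by_contra! hc
      have := (Finset.card_le_card (fun x (_ : x ∈ Finset.univ) => hc x)).trans Finset.card_le_two
      simp at this
      omega
    simp only [Finset.mem_insert, Finset.mem_singleton, not_or] at hl hq
    have e1 := key {k, l} (Finset.card_pair (Ne.symm hl))
    have e2 := key {k, q} (Finset.card_pair (Ne.symm hq.1))
    have e3 := key {l, q} (Finset.card_pair (Ne.symm hq.2))
    rw [Finset.sum_pair (Ne.symm hl)] at e1
    rw [Finset.sum_pair (Ne.symm hq.1)] at e2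
    rw [Finset.sum_pair (Ne.symm hq.2)] at e3
    refine (mul_eq_zero.mp ?_).resolve_left h2
    linear_combination e1 + e2 - e3

/-- `𝒲` has trivial center. -/
theorem eq_zero_of_central (φ : Model F p m n t L) (hn : 3 ≤ n) (hm : 0 < m) (h2 : (2 : F) ≠ 0)
    (ht : ∀ i, 1 ≤ t i) (u : L) (hu : ∀ y : L, ⁅u, y⁆ = 0) : u = 0 := by
  have h0 (α S r) (hα : α ≠ 0) : co φ α S r u = 0 := by
    obtain ⟨i, hi⟩ := Function.ne_iff.mp hα
    have h := co_lie_elD φ i u (α - Pi.single i 1) S r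
    rw [← lie_skew, hu, neg_zero, map_zero] at h
    rw [h, sub_single_add_single hi]
  have hw (S r s) (hs : wt F (0 : Fin m → ℕ) S r s ≠ 0) :
      co φ 0 S r u = 0 := by
    have h := co_lie_elH φ ht s u 0 S r
    rw [← lie_skew, hu, neg_zero, map_zero] at h
    exact (mul_eq_zero.mp h.symm).resolve_left hs
  refine ext_co φ fun α S r => ?_
  rw [map_zero]
  cases r with
  | inl a =>
    by_cases hα : α = 0
    · subst hα
      exact hw _ _ (Sum.inl a) (by simp [wt, wt₀])
    · exact h0 _ _ _ hα
  | inr k =>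
    refine co_inr_eq_zero φ hn h2 u h0 (fun S r k => hw S r _) ⟨0, hm⟩ (fun T hT => ?_) α S k
    have hz := φ.toEnd_lift (fd_mon_mem (zero_lt_pow p t) (r := Sum.inl ⟨0, hm⟩)
      (Ext.basis_mem_evenOdd (F := F) (S := T) (by rw [hT]; rfl)))
    rw [← hz, ← φ.toEnd_lie, hu, map_zero]

end

/-! ### Making a derivation vanish on the `D_i` and on the torus -/

section

variable {p : ℕ} [hp : Fact p.Prime] [CharP F p] {t : Fin m → ℕ}
  {L : Type*} [LieRing L] [LieAlgebra F L] (φ : Model F p m n t L)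

theorem exists_co_eq (c : (Fin m → ℕ) → Finset (Fin n) → Fin m ⊕ Fin n → F)
    (hc : ∀ β S r, c β S r ≠ 0 → (∀ i, β i < p ^ t i) ∧ (S.card : ZMod 2) = tau r) :
    ∃ u : L, ∀ β S r, co φ β S r u = c β S r := by
  have hmem : ∑ β ∈ Fintype.piFinset fun i => Finset.range (p ^ t i), ∑ S, ∑ r,
      c β S r • fd r (Alg.mon β (Ext.basis F n S)) ∈ evenW F p m n t := by
    refine sum_mem fun β _ => sum_mem fun S _ => sum_mem fun r _ => ?_
    by_cases h : c β S r = 0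
    · rw [h, zero_smul]; exact zero_mem _
    · exact Submodule.smul_mem (evenW F p m n t).toSubmodule _
        (fd_mon_mem (hc β S r h).1 (Ext.basis_mem_evenOdd (hc β S r h).2))
  refine ⟨φ.lift hmem, fun β S r => ?_⟩
  rw [co_apply, φ.toEnd_lift]
  simp only [map_sum, map_smul, coord_fd_mon, smul_eq_mul, mul_ite, mul_one, mul_zero]
  rw [Finset.sum_comm, Finset.sum_eq_single S]
  · rw [Finset.sum_comm, Finset.sum_eq_single r]
    · by_cases h : c β S r = 0
      · rw [Finset.sum_eq_zero, h]
        intro γ _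
        split_ifs with h'
        · rw [h'.1, h]
        · rfl
      · rw [Finset.sum_eq_single β]
        · simp
        · intro γ _ hγ
          rw [if_neg (fun h' => hγ h'.1)]
        · intro h'
          exact absurd (Fintype.mem_piFinset.mpr fun i => Finset.mem_range.mpr
            ((hc β S r h).1 i)) h'
    · intro s _ hs
      exact Finset.sum_eq_zero fun γ _ => if_neg fun h' => hs h'.2.2
    · simp
  · intro T _ hT
    exact Finset.sum_eq_zero fun γ _ => Finset.sum_eq_zero fun s _ => if_neg fun h' => hT h'.2.1
  · simp

theorem lie_elD_apply {d : LieDerivation F L L}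
    (hd : ∀ i, d (elD φ i) = 0) (i : Fin m) (y : L) :
    ⁅elD φ i, d y⁆ = d ⁅elD φ i, y⁆ := by
  rw [d.apply_lie_eq_add, hd, zero_lie, add_zero]

theorem lie_elD_elD (i j : Fin m) : ⁅elD φ i, elD φ j⁆ = 0 := by
  exact lie_elD_of_toEnd_eq φ i (SetLike.one_mem_graded _) ((toEnd_elD φ j).trans (fd_one _).symm)
    rfl

theorem lie_elH_elH (ht : ∀ i, 1 ≤ t i) (r s : Fin m ⊕ Fin n) :
    ⁅(elH φ ht r), elH φ ht s⁆ = 0 := by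
  refine φ.injective ?_
  rw [φ.toEnd_lie, toEnd_elH, toEnd_elH, map_zero, lie_fd (gen_mem r) (gen_mem s), D_gen, D_gen]
  by_cases h : r = s
  · subst h; rw [sub_self]
  · rw [if_neg h, if_neg (Ne.symm h)]; simp

theorem lie_elH_elD (ht : ∀ i, 1 ≤ t i) (s : Fin m ⊕ Fin n) (i : Fin m) :
    ⁅elH φ ht s, elD φ i⁆ =
      wt F (0 : Fin m → ℕ) (∅ : Finset (Fin n)) (Sum.inl i) s • elD φ i := by
  refine lie_elH_of_toEnd_eq φ ht s (Sum.inl i) (by simp [tau]) ?_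
  rw [toEnd_elD, Ext.basis_empty, fd_one]

/-- Every derivation agrees with an inner one on the elements `D_i`. -/
theorem exists_eq_on_elD (hn : 3 ≤ n) (hm : 0 < m) (h2 : (2 : F) ≠ 0) (ht : ∀ i, 1 ≤ t i)
    (d : LieDerivation F L L) :
    ∃ u : L, ∀ i, d (elD φ i) = ⁅u, elD φ i⁆ := by
  classical
  let f (i : Fin m) (α : Fin m → ℕ) (S : Finset (Fin n)) (r : Fin m ⊕ Fin n) : F :=
    co φ α S r (d (elD φ i))
  -- Closedness, from applying `d` to `[D_i, D_j] = 0`.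
  have hcl (i j α S r) : f i (α + Pi.single j 1) S r = f j (α + Pi.single i 1) S r := by
    have h : ⁅elD φ i, d (elD φ j)⁆ = ⁅elD φ j, d (elD φ i)⁆ := by
      have := d.apply_lie_eq_sub (elD φ i) (elD φ j)
      rw [lie_elD_elD φ, map_zero] at this
      exact (sub_eq_zero.mp this.symm)
    change co φ _ _ _ _ = co φ _ _ _ _
    rw [← co_lie_elD, ← co_lie_elD, h]
  -- The obstruction to integration: coordinates whose exponent at `i` is at least `p ^ t i - 1` are
  -- coordinates of a central element, hence zero.
  have htop (i α S r) (h : p ^ t i - 1 ≤ α i) : f i α S r = 0 := by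
    have h1 := eq_zero_of_central φ hn hm h2 ht _
      (ad_pow_derivation_central p d (ad_elD_pow_eq_zero φ i))
    have h2 := co_ad_elD_pow φ i (p ^ t i - 1) (d (elD φ i))
      (α - Pi.single i (p ^ t i - 1)) S r
    rw [h1, map_zero] at h2
    change co φ _ _ _ _ = _
    rw [h2]
    congr 2
    ext j
    by_cases hj : j = i
    · subst hj; simp; omega
    · simp [hj]
  -- Coefficients of a primitive, found by lowering any nonzero exponent; closedness makes the
  -- choice immaterial. The constant coefficients are free and set to `0`.
  let c (β : Fin m → ℕ) (S : Finset (Fin n)) (r : Fin m ⊕ Fin n) : F :=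
    if h : ∃ i, β i ≠ 0 then f h.choose (β - Pi.single h.choose 1) S r else 0
  have hc (β S r i) (hi : β i ≠ 0) : c β S r = f i (β - Pi.single i 1) S r := by
    have h : ∃ i, β i ≠ 0 := ⟨i, hi⟩
    simp only [c, dif_pos h]
    generalize hj : h.choose = j
    have hj' : β j ≠ 0 := hj ▸ h.choose_spec
    by_cases hij : j = i
    · rw [hij]
    have e1 : β - Pi.single j 1 = (β - Pi.single j 1 - Pi.single i 1) + Pi.single i 1 :=
      (sub_single_add_single (by simp [Ne.symm hij, hi])).symm
    have e2 : β - Pi.single i 1 = (β - Pi.single j 1 - Pi.single i 1) + Pi.single j 1 := by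
      rw [tsub_right_comm]
      exact (sub_single_add_single (by simp [hij, hj'])).symm
    rw [e1, hcl, ← e2]
  have hc0 (β S r) (h : ∀ i, β i = 0) : c β S r = 0 := by
    rw [← not_exists_not] at h
    exact dif_neg h
  obtain ⟨u, hu⟩ := exists_co_eq φ c (fun β S r h => by
    obtain ⟨i, hi⟩ : ∃ i, β i ≠ 0 := by
      by_contra! h'
      exact h (hc0 _ _ _ h')
    refine ⟨fun j => ?_, ?_⟩
    -- An exponent `β j ≥ p ^ t j` stays at least `p ^ t j - 1` after lowering, where `htop`
    -- applies; so the primitive lies in the truncated algebra.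
    · by_contra hj
      have hj0 : β j ≠ 0 := by
        have := Nat.pos_of_ne_zero (pow_ne_zero (t j) hp.out.ne_zero)
        omega
      rw [hc β S r j hj0, htop] at h
      · exact h rfl
      · simp; omega
    · rw [hc β S r i hi] at h
      exact card_eq_of_coord_ne_zero (φ.mem (d (elD φ i))) h)
  refine ⟨-u, fun i => ext_co φ fun α S r => ?_⟩
  rw [neg_lie, lie_skew, co_lie_elD, hu, hc _ _ _ i (by simp), add_tsub_cancel_right]

/-- `d y` commutes with every `D_i`, and commuting with `D_i` means that no coefficient involves
`x_i`. -/
theorem co_apply_eq_zero {d : LieDerivation F L L}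
    (hd : ∀ i, d (elD φ i) = 0) {y : L}
    (hy : ∀ i, d ⁅elD φ i, y⁆ = 0) {α : Fin m → ℕ} (S : Finset (Fin n)) (r : Fin m ⊕ Fin n)
    (hα : α ≠ 0) : co φ α S r (d y) = 0 := by
  obtain ⟨i, hi⟩ := Function.ne_iff.mp hα
  have h := co_lie_elD φ i (d y) (α - Pi.single i 1) S r
  rw [lie_elD_apply φ hd, hy, map_zero, sub_single_add_single hi] at h
  exact h.symm

theorem wt_eq_of_co_ne_zero {d : LieDerivation F L L}
    {ht : ∀ i, 1 ≤ t i} {s : Fin m ⊕ Fin n} (hd : d (elH φ ht s) = 0) {y : L}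
    {w : F} (hy : ⁅elH φ ht s, y⁆ = w • y) {α : Fin m → ℕ} {S : Finset (Fin n)}
    {r : Fin m ⊕ Fin n} (h : co φ α S r (d y) ≠ 0) :
    wt F α S r s = w := by
  have h1 := co_lie_elH φ ht s (d y) α S r
  have h2 : ⁅elH φ ht s, d y⁆ = w • d y := by
    rw [← map_smul, ← hy, d.apply_lie_eq_add, hd, zero_lie, add_zero]
  rw [h2, map_smul, smul_eq_mul] at h1
  exact (mul_right_cancel₀ h h1).symm

/-- A cocycle of the torus with values in a sum of nontrivial weight spaces is a coboundary. -/
theorem exists_primitive_of_cocycle (v : Fin m ⊕ Fin n → L)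
    (h0 : ∀ s α S r, α ≠ 0 → co φ α S r (v s) = 0)
    (hcoc : ∀ s s' α S r, wt F α S r s * co φ α S r (v s') =
        wt F α S r s' * co φ α S r (v s)) :
    ∃ u : L,
      (∀ α S r, α ≠ 0 → co φ α S r u = 0) ∧
      ∀ α S r s s', wt F α S r s' ≠ 0 →
        wt F α S r s * co φ α S r u =
          co φ α S r (v s) := by
  classical
  -- Divide by any nonzero weight; the cocycle identity makes the quotient independent of which one.
  -- At weight zero the value is arbitrary.
  let c (α : Fin m → ℕ) (S : Finset (Fin n)) (r : Fin m ⊕ Fin n) : F :=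
    if h : ∃ s, wt F α S r s ≠ 0 then
      co φ α S r (v h.choose) / wt F α S r h.choose else 0
  have hc (α S r s) (h : ∃ s, wt F α S r s ≠ 0) : wt F α S r s * c α S r =
      co φ α S r (v s) := by
    simp only [c, dif_pos h]
    rw [← mul_div_assoc, hcoc, mul_div_cancel_left₀ _ h.choose_spec]
  have hc0 (α S r) (hα : α ≠ 0) : c α S r = 0 := by
    simp only [c]
    split_ifs with h
    · rw [h0 _ _ _ _ hα, zero_div]
    · rfl
  obtain ⟨u, hu⟩ := exists_co_eq φ c (fun α S r h => by
    simp only [c] at h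
    split_ifs at h with h'
    · have h'' := (div_ne_zero_iff.mp h).1
      exact ⟨lt_of_coord_ne_zero (φ.mem (v _)) h'', card_eq_of_coord_ne_zero (φ.mem (v _)) h''⟩
    · exact absurd rfl h)
  exact ⟨u, fun α S r hα => by rw [hu, hc0 _ _ _ hα],
    fun α S r s s' hs => by rw [hu, hc _ _ _ _ ⟨s', hs⟩]⟩

/-- Apply `d'` to `[x_s D_s, z] = w z` with `z = ξ_T D_0`, `|T| = 2`, and compare coordinates at
`z`: the terms containing `d' z` cancel, so `d' (x_s D_s)` acts on `z` by the scalar zero. -/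
theorem apply_elH_eq_zero (hn : 3 ≤ n) (hm : 0 < m) (h2 : (2 : F) ≠ 0) (ht : ∀ i, 1 ≤ t i)
    (d' : LieDerivation F L L) (s : Fin m ⊕ Fin n)
    (k0 : ∀ α S r, α ≠ 0 → co φ α S r (d' (elH φ ht s)) = 0)
    (kw : ∀ α S r s', wt F α S r s' ≠ 0 →
      co φ α S r (d' (elH φ ht s)) = 0) :
    d' (elH φ ht s) = 0 := by
  refine ext_co φ fun α S r => ?_
  rw [map_zero]
  cases r with
  | inl a =>
    by_cases hα : α = 0
    · subst hα
      exact kw _ _ _ (Sum.inl a) (by simp [wt, wt₀])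
    · exact k0 _ _ _ hα
  | inr k =>
    refine co_inr_eq_zero φ hn h2 _ k0 (fun S r k => kw 0 S r _) ⟨0, hm⟩ (fun T hT => ?_) α S k
    have hT' : (T.card : ZMod 2) = 0 := by rw [hT]; rfl
    have hz := φ.toEnd_lift (fd_mon_mem (zero_lt_pow p t) (r := Sum.inl ⟨0, hm⟩)
      (Ext.basis_mem_evenOdd (F := F) hT'))
    generalize φ.lift _ = z at hz
    have e2 := d'.apply_lie_eq_add (elH φ ht s) z
    rw [lie_elH_of_toEnd_eq φ ht s (Sum.inl ⟨0, hm⟩) hT' hz, map_smul] at e2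
    have e3 := congrArg (co φ 0 T (Sum.inl ⟨0, hm⟩)) e2
    have e4 := lie_eq_sum_smul φ (d' (elH φ ht s)) k0 (fun S r k => kw 0 S r _) ⟨0, hm⟩ hT'
    rw [map_smul, map_add, co_lie_elH, smul_eq_mul, left_eq_add, co_apply, φ.toEnd_lie, hz, e4,
      map_smul, coord_fd_mon, if_pos ⟨rfl, rfl, rfl⟩, smul_eq_mul, mul_one] at e3
    rw [e4, e3, zero_smul]

/-- A derivation vanishing on the `D_i` agrees on the torus with an inner derivation vanishing on
the `D_i`. -/
theorem exists_eq_on_elH (hn : 3 ≤ n) (hm : 0 < m) (h2 : (2 : F) ≠ 0) (ht : ∀ i, 1 ≤ t i)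
    (d : LieDerivation F L L) (hd : ∀ i, d (elD φ i) = 0) :
    ∃ u : L, (∀ i, ⁅u, elD φ i⁆ = 0) ∧
      ∀ s, d (elH φ ht s) = ⁅u, elH φ ht s⁆ := by
  classical
  have h0 (s : Fin m ⊕ Fin n) (α S r) (hα : α ≠ 0) :
      co φ α S r (d (elH φ ht s)) = 0 := by
    refine co_apply_eq_zero φ hd (fun i => ?_) S r hα
    rw [← lie_skew, lie_elH_elD φ, map_neg, map_smul, hd, smul_zero, neg_zero]
  have hcoc (s s' : Fin m ⊕ Fin n) (α S r) :
      wt F α S r s * co φ α S r (d (elH φ ht s')) =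
        wt F α S r s' * co φ α S r (d (elH φ ht s)) := by
    rw [← co_lie_elH φ ht, ← co_lie_elH φ ht]
    have := d.apply_lie_eq_sub (elH φ ht s) (elH φ ht s')
    rw [lie_elH_elH φ, map_zero] at this
    rw [sub_eq_zero.mp this.symm]
  obtain ⟨u, hc0, hc⟩ := exists_primitive_of_cocycle φ (fun s => d (elH φ ht s)) h0 hcoc
  have huD (i : Fin m) : ⁅elD φ i, u⁆ = 0 := by
    refine ext_co φ fun α S r => ?_
    rw [co_lie_elD, hc0, map_zero]
    exact fun h => by simpa using congrFun h i
  refine ⟨-u, fun i => by rw [neg_lie, lie_skew, huD], fun s => ?_⟩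
  rw [neg_lie, lie_skew, ← sub_eq_zero]
  obtain ⟨d', hd'⟩ : ∃ d', d' = d + LieDerivation.ad F _ u := ⟨_, rfl⟩
  have hv : d (elH φ ht s) - ⁅elH φ ht s, u⁆ = d' (elH φ ht s) := by
    rw [hd', LieDerivation.add_apply, LieDerivation.ad_apply_apply, sub_eq_add_neg, lie_skew]
  have hcoord (α S r) : co φ α S r (d' (elH φ ht s)) =
      co φ α S r (d (elH φ ht s)) - wt F α S r s * co φ α S r u := by
    rw [← hv, ← co_lie_elH φ ht, map_sub]
  rw [hv]
  have k0 (α S r) (hα : α ≠ 0) : co φ α S r (d' (elH φ ht s)) = 0 := by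
    rw [hcoord, h0 _ _ _ _ hα, hc0 _ _ _ hα, mul_zero, sub_zero]
  have kw (α S r s') (hs : wt F α S r s' ≠ 0) :
      co φ α S r (d' (elH φ ht s)) = 0 := by
    rw [hcoord, hc _ _ _ _ _ hs, sub_self]
  exact apply_elH_eq_zero φ hn hm h2 ht d' s k0 kw

end

/-! ### Scalars on constant fields, and the derivations `(ad D_i) ^ (p ^ s)` -/

section

variable {p : ℕ} [hp : Fact p.Prime] [CharP F p] {t : Fin m → ℕ}
  {L : Type*} [LieRing L] [LieAlgebra F L] (φ : Model F p m n t L)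

theorem eq_of_wt_inr_eq {α β : Fin m → ℕ} {S T : Finset (Fin n)} {r : Fin m ⊕ Fin n}
    (h : ∀ k, wt F α S r (Sum.inr k) = wt F β T r (Sum.inr k)) : S = T := by
  ext k
  have := sub_left_inj.mp (h k)
  simp only [wt₀] at this
  by_cases h1 : k ∈ S <;> by_cases h2 : k ∈ T <;> simp_all

theorem co_of_toEnd_eq {y : L} {r : Fin m ⊕ Fin n} {α : Fin m → ℕ} {S : Finset (Fin n)}
    (hy : φ.toEnd y = fd r (Alg.mon α (Ext.basis F n S))) (β : Fin m → ℕ) (T : Finset (Fin n))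
    (s : Fin m ⊕ Fin n) : co φ β T s y = if α = β ∧ S = T ∧ r = s then 1 else 0 := by
  rw [co_apply, hy, coord_fd_mon]

/-- A derivation vanishing on the `D_i` and the torus acts by a scalar on each constant basis
element that is determined by its weight. -/
theorem exists_apply_eq_smul {ht : ∀ i, 1 ≤ t i} {d : LieDerivation F L L}
    (hD : ∀ i, d (elD φ i) = 0) (hH : ∀ s, d (elH φ ht s) = 0) {y : L} {r : Fin m ⊕ Fin n}
    {S : Finset (Fin n)} (hS : (S.card : ZMod 2) = tau r)
    (hy : φ.toEnd y = fd r (Alg.mon 0 (Ext.basis F n S)))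
    (hr : ∀ T r', (∀ s, wt F (0 : Fin m → ℕ) T r' s = wt F (0 : Fin m → ℕ) S r s) → r' = r) :
    ∃ c : F, d y = c • y := by
  refine ⟨co φ 0 S r (d y), ext_co φ fun α T r' => ?_⟩
  rw [map_smul, smul_eq_mul, co_of_toEnd_eq φ hy]
  by_cases hα : α = 0
  · subst hα
    by_cases h : co φ 0 T r' (d y) = 0
    · rw [h]
      split_ifs with h'
      · rw [h'.2.1, h'.2.2, h, zero_mul]
      · rw [mul_zero]
    · have hw (s : Fin m ⊕ Fin n) := wt_eq_of_co_ne_zero φ (hH s)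
        (lie_elH_of_toEnd_eq φ ht s r hS hy) h
      have h1 := hr T r' hw
      subst h1
      have h2 := eq_of_wt_inr_eq fun k => hw (Sum.inr k)
      subst h2
      simp
  · rw [if_neg (fun h => hα h.1.symm), mul_zero]
    refine co_apply_eq_zero φ hD (fun i => ?_) T r' hα
    rw [lie_elD_of_toEnd_eq φ i (Ext.basis_mem_evenOdd hS) hy rfl, map_zero]

theorem eq_inl_of_wt_eq {S T : Finset (Fin n)} {r : Fin m ⊕ Fin n} {a : Fin m}
    (h : wt F (0 : Fin m → ℕ) T r (Sum.inl a) = wt F (0 : Fin m → ℕ) S (Sum.inl a) (Sum.inl a)) :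
    r = Sum.inl a := by
  by_contra hr
  simp [wt, wt₀, Ne.symm hr] at h

/-- The weight at `q` is `-1`, whereas a constant field in another direction has weight `0` or `1`
there. -/
theorem eq_inr_of_wt_eq (h2 : (2 : F) ≠ 0) {S T : Finset (Fin n)} {r : Fin m ⊕ Fin n} {q : Fin n}
    (hq : q ∉ S) (h : wt F (0 : Fin m → ℕ) T r (Sum.inr q) =
      wt F (0 : Fin m → ℕ) S (Sum.inr q) (Sum.inr q)) : r = Sum.inr q := by
  by_contra hr
  simp only [wt, wt₀, Ne.symm hr, hq, if_false, if_true, sub_zero, zero_sub] at h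
  split_ifs at h
  · exact h2 (by linear_combination h)
  · simp at h

/-- The action of a torus element `∑ a_q ξ_q D_q`. -/
theorem sum_smul_elH_lie (ht : ∀ i, 1 ≤ t i) (a : Fin n → F) {r : Fin m ⊕ Fin n} {α : Fin m → ℕ}
    {S : Finset (Fin n)} (hS : (S.card : ZMod 2) = tau r) {y : L}
    (hy : φ.toEnd y = fd r (Alg.mon α (Ext.basis F n S))) :
    ⁅∑ q, a q • elH φ ht (Sum.inr q), y⁆ =
      (∑ q, a q * wt F α S r (Sum.inr q)) • y := by
  rw [sum_lie, Finset.sum_smul]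
  refine Finset.sum_congr rfl fun q _ => ?_
  rw [smul_lie, lie_elH_of_toEnd_eq φ ht _ r hS hy, smul_smul]

/-- By weights, `d` scales `ξ_k D_{k₀}` by some `c k` and `ξ_{k₀} ξ_{k₁} D_j` by some `e`. A torus
element `∑ a_q ξ_q D_q` scales them by `a_k - a_{k₀}` and `a_{k₀} + a_{k₁}`, and these can be
matched. -/
theorem exists_eq_on_gl (ht : ∀ i, 1 ≤ t i) (h2 : (2 : F) ≠ 0) {d : LieDerivation F L L}
    (hD : ∀ i, d (elD φ i) = 0) (hH : ∀ s, d (elH φ ht s) = 0) {k₀ k₁ : Fin n} (hk : k₀ ≠ k₁)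
    (j : Fin m) : ∃ u : L, (∀ i, ⁅u, elD φ i⁆ = 0) ∧ (∀ s, ⁅u, elH φ ht s⁆ = 0) ∧
      (∀ k, k ≠ k₀ → ∀ y, φ.toEnd y = fd (Sum.inr k₀) (Alg.mon 0 (Ext.basis F n {k})) →
        d y = ⁅u, y⁆) ∧
      ∀ z, φ.toEnd z = fd (Sum.inl j) (Alg.mon 0 (Ext.basis F n {k₀, k₁})) → d z = ⁅u, z⁆ := by
  have hS (k : Fin n) : ((({k} : Finset (Fin n)).card : ℕ) : ZMod 2) =
      tau (Sum.inr k₀ : Fin m ⊕ Fin n) := by simp [tau]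
  have hS' : ((({k₀, k₁} : Finset (Fin n)).card : ℕ) : ZMod 2) =
      tau (Sum.inl j : Fin m ⊕ Fin n) := by rw [Finset.card_pair hk]; rfl
  have h1 (k : Fin n) : ∃ c : F, k ≠ k₀ →
      ∀ y, φ.toEnd y = fd (Sum.inr k₀) (Alg.mon 0 (Ext.basis F n {k})) → d y = c • y := by
    by_cases hk0 : k = k₀
    · exact ⟨0, fun h => absurd hk0 h⟩
    have hy := φ.toEnd_lift (fd_mon_mem (zero_lt_pow p t) (Ext.basis_mem_evenOdd (F := F) (hS k)))
    obtain ⟨c, hc⟩ := exists_apply_eq_smul φ hD hH (hS k) hy (fun T r' h =>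
      eq_inr_of_wt_eq h2 (by simpa using Ne.symm hk0) (h (Sum.inr k₀)))
    refine ⟨c, fun _ y' hy' => ?_⟩
    rwa [← φ.injective (hy.trans hy'.symm)]
  choose c hc using h1
  have hz := φ.toEnd_lift (fd_mon_mem (zero_lt_pow p t) (Ext.basis_mem_evenOdd (F := F) hS'))
  obtain ⟨e, he⟩ := exists_apply_eq_smul φ hD hH hS' hz (fun T r' h =>
      eq_inl_of_wt_eq (h (Sum.inl j)))
  -- The solution of `a_k - a_{k₀} = c k` for `k ≠ k₀` and `a_{k₀} + a_{k₁} = e`; it needs a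
  -- division by `2`.
  let a (q : Fin n) : F := (if q = k₀ then 0 else c q) + (e - c k₁) / 2
  refine ⟨∑ q, a q • elH φ ht (Sum.inr q), fun i => ?_, fun s => ?_, fun k hk' y hy => ?_,
    fun z' hz' => ?_⟩
  · rw [sum_lie]
    refine Finset.sum_eq_zero fun q _ => ?_
    rw [smul_lie, lie_elH_elD]
    simp [wt, wt₀]
  · rw [sum_lie]
    refine Finset.sum_eq_zero fun q _ => ?_
    rw [smul_lie, lie_elH_elH, smul_zero]
  · rw [hc k hk' y hy, sum_smul_elH_lie φ ht a (hS k) hy]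
    congr 1
    simp [wt, wt₀, mul_sub, a, hk']
  · rw [← φ.injective (hz.trans hz'.symm), he, sum_smul_elH_lie φ ht a hS' hz]
    congr 1
    simp only [wt, wt₀, reduceCtorEq, if_false, sub_zero, mul_ite, mul_one, mul_zero,
      Finset.sum_ite_mem, Finset.univ_inter, Finset.sum_pair hk, a, if_pos, if_neg hk.symm]
    field_simp
    ring

theorem co_derivationPow_ad (i : Fin m) (s : ℕ) (y : L) (α : Fin m → ℕ) (S : Finset (Fin n))
    (r : Fin m ⊕ Fin n) :
    co φ α S r (derivationPow p s (LieDerivation.ad F L (elD φ i)) y) =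
      co φ (α + Pi.single i (p ^ s)) S r y := by
  rw [derivationPow_apply, LieDerivation.coe_ad_apply_eq_ad_apply, co_ad_elD_pow]

/-- The derivation `∑ c i s (ad D_i) ^ (p ^ s)`, the sum running over `1 ≤ s < t i`. -/
def powerDer (c : (i : Fin m) → ℕ → F) : LieDerivation F L L :=
  ∑ i, ∑ s ∈ Finset.Ico 1 (t i), c i s • derivationPow p s (LieDerivation.ad F L (elD φ i))

theorem co_powerDer (c : (i : Fin m) → ℕ → F) (y : L) (α : Fin m → ℕ) (S : Finset (Fin n))
    (r : Fin m ⊕ Fin n) : co φ α S r (powerDer φ c y) =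
      ∑ i, ∑ s ∈ Finset.Ico 1 (t i), c i s * co φ (α + Pi.single i (p ^ s)) S r y := by
  have h (y : L) : powerDer φ c y = ∑ i, ∑ s ∈ Finset.Ico 1 (t i),
      c i s • derivationPow p s (LieDerivation.ad F L (elD φ i)) y := by
    let ev : LieDerivation F L L →+ L := (Pi.evalAddMonoidHom (fun _ => L) y).comp
      LieDerivation.coeFnAddMonoidHom
    change ev _ = _
    rw [powerDer, map_sum]
    refine Finset.sum_congr rfl fun i _ => ?_
    rw [map_sum]
    rfl
  rw [h]
  simp only [map_sum, map_smul, smul_eq_mul, co_derivationPow_ad]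

/-- Each summand reads coordinates at exponents at least `p ^ s ≥ 2`, because `s ≥ 1`. Hence
subtracting `powerDer` preserves the earlier normalizations. -/
theorem powerDer_apply_eq_zero (c : (i : Fin m) → ℕ → F) {y : L} {r : Fin m ⊕ Fin n}
    {α : Fin m → ℕ} (hα : ∀ i, α i < 2) {S : Finset (Fin n)}
    (hy : φ.toEnd y = fd r (Alg.mon α (Ext.basis F n S))) : powerDer φ c y = 0 := by
  refine ext_co φ fun β T s => ?_
  rw [co_powerDer, map_zero]
  refine Finset.sum_eq_zero fun i _ => Finset.sum_eq_zero fun k hk => ?_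
  rw [co_of_toEnd_eq φ hy, if_neg, mul_zero]
  rintro ⟨rfl, -⟩
  have h1 := hα i
  have h2 := Nat.pow_le_pow_right hp.out.pos (Finset.mem_Ico.mp hk).1
  have h3 := hp.out.two_le
  rw [pow_one] at h2
  simp at h1
  omega

/-- Only the shift by `p ^ s` in direction `i` moves this monomial to the constant one, so `c` can
be read off. -/
theorem co_powerDer_single (c : (i : Fin m) → ℕ → F) {i : Fin m} {s : ℕ}
    (hs : s ∈ Finset.Ico 1 (t i)) {y : L} {r : Fin m ⊕ Fin n} {S : Finset (Fin n)}
    (hy : φ.toEnd y = fd r (Alg.mon (Pi.single i (p ^ s)) (Ext.basis F n S))) :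
    co φ 0 S r (powerDer φ c y) = c i s := by
  have hne : p ^ s ≠ 0 := pow_ne_zero _ hp.out.ne_zero
  rw [co_powerDer, Finset.sum_eq_single i, Finset.sum_eq_single s]
  · rw [co_of_toEnd_eq φ hy, if_pos ⟨by simp, rfl, rfl⟩, mul_one]
  · intro k _ hk
    rw [co_of_toEnd_eq φ hy, if_neg, mul_zero]
    rintro ⟨h, -⟩
    have h := congrFun h i
    simp only [Pi.single_eq_same, zero_add] at h
    exact hk (Nat.pow_right_injective hp.out.two_le h).symm
  · exact fun h => absurd hs h
  · intro l _ hl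
    refine Finset.sum_eq_zero fun k _ => ?_
    rw [co_of_toEnd_eq φ hy, if_neg, mul_zero]
    rintro ⟨h, -⟩
    have h := congrFun h i
    simp only [Pi.single_eq_same, Pi.add_apply, Pi.zero_apply, Pi.single_eq_of_ne (Ne.symm hl),
      add_zero] at h
    exact hne h
  · simp

end

/-! ### Normalized derivations and the weight criterion -/

section

variable {p : ℕ} [hp : Fact p.Prime] [CharP F p] {t : Fin m → ℕ}
  {L : Type*} [LieRing L] [LieAlgebra F L] (φ : Model F p m n t L)

/-- A derivation that vanishes on the `D_i`, the torus, the root elements `ξ_k D_{k₀}`, the element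
`ξ_{k₀} ξ_{k₁} D_{j₀}`, and has no constant part on `x_i^(p ^ s) D_{ν i}`. -/
structure IsNormalized (ht : ∀ i, 1 ≤ t i) (k₀ k₁ : Fin n) (j₀ : Fin m) (ν : Fin m → Fin m)
    (d : LieDerivation F L L) : Prop where
  apply_elD : ∀ i, d (elD φ i) = 0
  apply_elH : ∀ s, d (elH φ ht s) = 0
  apply_gl : ∀ k, k ≠ k₀ → ∀ y,
    φ.toEnd y = fd (Sum.inr k₀) (Alg.mon 0 (Ext.basis F n {k})) → d y = 0
  apply_quadratic : ∀ z,
    φ.toEnd z = fd (Sum.inl j₀) (Alg.mon 0 (Ext.basis F n {k₀, k₁})) → d z = 0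
  apply_power : ∀ i, ∀ s ∈ Finset.Ico 1 (t i), ∀ y,
    φ.toEnd y = fd (Sum.inl (ν i)) (Alg.mon (Pi.single i (p ^ s)) (Ext.basis F n ∅)) →
      co φ 0 ∅ (Sum.inl (ν i)) (d y) = 0

/-- The kernel of a derivation, as a space of operators. -/
def kerEnd (d : LieDerivation F L L) : Submodule F (Module.End F (Alg F m n)) :=
  (LinearMap.ker (d : L →ₗ[F] L)).map φ.toEnd

variable {φ} {d : LieDerivation F L L}

theorem toEnd_mem_kerEnd {y : L} : φ.toEnd y ∈ kerEnd φ d ↔ d y = 0 := by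
  refine ⟨fun ⟨z, hz, h⟩ => ?_, fun h => ⟨y, h, rfl⟩⟩
  rw [← φ.injective h]
  exact hz

theorem lie_mem_kerEnd {A B : Module.End F (Alg F m n)} (hA : A ∈ kerEnd φ d)
    (hB : B ∈ kerEnd φ d) : ⁅A, B⁆ ∈ kerEnd φ d := by
  obtain ⟨x, hx, rfl⟩ := hA
  obtain ⟨y, hy, rfl⟩ := hB
  rw [← φ.toEnd_lie, toEnd_mem_kerEnd, d.apply_lie_eq_add]
  change d x = 0 at hx
  change d y = 0 at hy
  rw [hx, hy, lie_zero, zero_lie, add_zero]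

theorem fd_mon_mem_kerEnd {r : Fin m ⊕ Fin n} {α : Fin m → ℕ}
    (h : ∀ S : Finset (Fin n), (S.card : ZMod 2) = tau r →
      fd r (Alg.mon α (Ext.basis F n S)) ∈ kerEnd φ d) {b : Ext F n}
    (hb : b ∈ CliffordAlgebra.evenOdd (0 : QuadraticForm F (Fin n → F)) (tau r)) :
    fd r (Alg.mon α b) ∈ kerEnd φ d := by
  rw [Ext.evenOdd_eq_monSpan] at hb
  induction hb using Submodule.span_induction with
  | zero => rw [Alg.mon_zero, map_zero]; exact zero_mem _
  | add x y _ _ hx hy => rw [Alg.mon_add, map_add]; exact add_mem hx hy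
  | smul c x _ hx => rw [Alg.mon_smul, map_smul]; exact Submodule.smul_mem _ c hx
  | mem x hx =>
    obtain ⟨S, hS, rfl⟩ := hx
    exact h S hS

/-- The bracket of two fields with monomial coefficients. -/
theorem lie_fd_mon {r s : Fin m ⊕ Fin n} {α β : Fin m → ℕ} {b c : Ext F n}
    (hb : b ∈ CliffordAlgebra.evenOdd (0 : QuadraticForm F (Fin n → F)) (tau r))
    (hc : c ∈ CliffordAlgebra.evenOdd (0 : QuadraticForm F (Fin n → F)) (tau s)) :
    ⁅(fd r (Alg.mon α b) : Module.End F (Alg F m n)), fd s (Alg.mon β c)⁆ =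
      fd s (Alg.mon α b * D F r (Alg.mon β c)) - fd r (Alg.mon β c * D F s (Alg.mon α b)) :=
  lie_fd (Alg.mon_mem_parity hb) (Alg.mon_mem_parity hc)

variable {ht : ∀ i, 1 ≤ t i} {k₀ k₁ : Fin n} {j₀ : Fin m} {ν : Fin m → Fin m}

namespace IsNormalized

theorem co_eq_zero (hd : IsNormalized φ ht k₀ k₁ j₀ ν d) {r : Fin m ⊕ Fin n} {α : Fin m → ℕ}
    {S : Finset (Fin n)} (hS : (S.card : ZMod 2) = tau r)
    (hlow : ∀ i, α i ≠ 0 → fd r (Alg.mon (α - Pi.single i 1) (Ext.basis F n S)) ∈ kerEnd φ d)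
    {y : L} (hy : φ.toEnd y = fd r (Alg.mon α (Ext.basis F n S)))
    {β : Fin m → ℕ} (T : Finset (Fin n)) (r' : Fin m ⊕ Fin n) (hβ : β ≠ 0) :
    co φ β T r' (d y) = 0 := by
  refine co_apply_eq_zero φ hd.apply_elD (fun i => ?_) T r' hβ
  rw [← toEnd_mem_kerEnd (φ := φ), φ.toEnd_lie, toEnd_elD, hy,
    lie_D_fd_mon i r α (Ext.basis_mem_evenOdd hS)]
  split_ifs with h
  · exact zero_mem _
  · exact hlow i h

theorem wt_eq (hd : IsNormalized φ ht k₀ k₁ j₀ ν d) {r : Fin m ⊕ Fin n} {α : Fin m → ℕ}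
    {S : Finset (Fin n)} (hS : (S.card : ZMod 2) = tau r)
    {y : L} (hy : φ.toEnd y = fd r (Alg.mon α (Ext.basis F n S)))
    {β : Fin m → ℕ} {T : Finset (Fin n)} {r' : Fin m ⊕ Fin n} (h : co φ β T r' (d y) ≠ 0)
    (s : Fin m ⊕ Fin n) : wt F β T r' s = wt F α S r s :=
  wt_eq_of_co_ne_zero φ (hd.apply_elH s) (lie_elH_of_toEnd_eq φ ht s r hS hy) h

/-- The main tool: once the fields below are killed, `d y` has constant coefficients and the weight
of `y`, so only constant fields of that weight need inspection. -/
theorem mem_of_co (hd : IsNormalized φ ht k₀ k₁ j₀ ν d) {r : Fin m ⊕ Fin n} {α : Fin m → ℕ}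
    (hα : ∀ i, α i < p ^ t i) {S : Finset (Fin n)} (hS : (S.card : ZMod 2) = tau r)
    (hlow : ∀ i, α i ≠ 0 → fd r (Alg.mon (α - Pi.single i 1) (Ext.basis F n S)) ∈ kerEnd φ d)
    (h : ∀ y, φ.toEnd y = fd r (Alg.mon α (Ext.basis F n S)) → ∀ T r',
      (∀ s, wt F (0 : Fin m → ℕ) T r' s = wt F α S r s) → co φ 0 T r' (d y) = 0) :
    fd r (Alg.mon α (Ext.basis F n S)) ∈ kerEnd φ d := by
  have hy := φ.toEnd_lift (fd_mon_mem hα (Ext.basis_mem_evenOdd (F := F) hS))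
  rw [← hy, toEnd_mem_kerEnd]
  refine ext_co φ fun β T r' => ?_
  rw [map_zero]
  by_cases hβ : β = 0
  · subst hβ
    by_contra hne
    exact hne (h _ hy T r' (hd.wt_eq hS hy hne))
  · exact hd.co_eq_zero hS hlow hy T r' hβ

/-- Constant fields have weight `0` or `-1` under `x_i D_i`, never `1` when `2 ≠ 0`. -/
theorem mem_of_wt_eq_one (hd : IsNormalized φ ht k₀ k₁ j₀ ν d) (h2 : (2 : F) ≠ 0)
    {r : Fin m ⊕ Fin n} {α : Fin m → ℕ}
    (hα : ∀ i, α i < p ^ t i) {S : Finset (Fin n)} (hS : (S.card : ZMod 2) = tau r)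
    (hlow : ∀ i, α i ≠ 0 → fd r (Alg.mon (α - Pi.single i 1) (Ext.basis F n S)) ∈ kerEnd φ d)
    {i : Fin m} (hi : wt F α S r (Sum.inl i) = 1) :
    fd r (Alg.mon α (Ext.basis F n S)) ∈ kerEnd φ d := by
  refine hd.mem_of_co hα hS hlow fun y _ T r' hw => ?_
  have := hw (Sum.inl i)
  rw [hi] at this
  simp only [wt, wt₀] at this
  split_ifs at this
  · exact absurd (by simpa using this) (fun h : (-1 : F) = 1 => h2 (by linear_combination -h))
  · simp at this

theorem single_lt (ht : ∀ i, 1 ≤ t i) (j : Fin m) (i : Fin m) :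
    (Pi.single j 1 : Fin m → ℕ) i < p ^ t i := by
  have h1 : 1 < p ^ t i := Nat.one_lt_pow (by have := ht i; omega) hp.out.one_lt
  by_cases h : i = j
  · subst h; simpa using h1
  · simp [h]; omega

theorem mem_single (hd : IsNormalized φ ht k₀ k₁ j₀ ν d) (h2 : (2 : F) ≠ 0)
    {r : Fin m ⊕ Fin n} {j : Fin m} (hr : r ≠ Sum.inl j) {S : Finset (Fin n)}
    (hS : (S.card : ZMod 2) = tau r) (h : fd r (Alg.mon 0 (Ext.basis F n S)) ∈ kerEnd φ d) :
    fd r (Alg.mon (Pi.single j 1) (Ext.basis F n S)) ∈ kerEnd φ d := by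
  refine hd.mem_of_wt_eq_one h2 (single_lt ht j) hS (fun i hi => ?_) (i := j) ?_
  · have hij : i = j := by
      by_contra hij
      simp [hij] at hi
    subst hij
    rwa [tsub_self]
  · simp [wt, wt₀, hr.symm]

theorem mem_gen (hd : IsNormalized φ ht k₀ k₁ j₀ ν d) (s : Fin m ⊕ Fin n) :
    fd s (gen F s) ∈ kerEnd φ d := by
  rw [← toEnd_elH φ ht, toEnd_mem_kerEnd]
  exact hd.apply_elH s

theorem mem_D (hd : IsNormalized φ ht k₀ k₁ j₀ ν d) (i : Fin m) :
    fd (Sum.inl i) (Alg.mon 0 1) ∈ kerEnd φ d := by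
  rw [fd_one, ← toEnd_elD φ, toEnd_mem_kerEnd]
  exact hd.apply_elD i

end IsNormalized

end

/-! ### Constant fields, and the passage from odd to even coefficients -/

section

variable {p : ℕ} [hp : Fact p.Prime] [CharP F p] {t : Fin m → ℕ}
  {L : Type*} [LieRing L] [LieAlgebra F L] {φ : Model F p m n t L} {d : LieDerivation F L L}
  {ht : ∀ i, 1 ≤ t i} {k₀ k₁ : Fin n} {j₀ : Fin m} {ν : Fin m → Fin m}

theorem Alg.mon_zero_mul_mon (α : Fin m → ℕ) (b c : Ext F n) :
    Alg.mon 0 b * Alg.mon α c = Alg.mon α (b * c) := by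
  rw [Alg.mon_mul_mon, binom_zero_left, zero_add, Nat.cast_one, one_smul]

theorem Alg.mon_mul_mon_zero (α : Fin m → ℕ) (b c : Ext F n) :
    Alg.mon α b * Alg.mon 0 c = Alg.mon α (b * c) := by
  rw [Alg.mon_mul_mon, binom_zero_right, add_zero, Nat.cast_one, one_smul]

theorem D_inl_mon_single (j : Fin m) (b : Ext F n) :
    D F (Sum.inl j) (Alg.mon (Pi.single j 1) b) = Alg.mon 0 b := by
  rw [D_inl_mon, if_neg (by simp), tsub_self]

theorem Ext.xi_mem_odd (k : Fin n) :
    xi F k ∈ CliffordAlgebra.evenOdd (0 : QuadraticForm F (Fin n → F)) 1 :=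
  CliffordAlgebra.ι_mem_evenOdd_one _ _

theorem Ext.xi_mul_xi_mem_even (k l : Fin n) :
    xi F k * xi F l ∈ CliffordAlgebra.evenOdd (0 : QuadraticForm F (Fin n → F)) 0 :=
  CliffordAlgebra.ι_mul_ι_mem_evenOdd_zero _ _ _

theorem lie_fd_inr_inr (k l : Fin n) (α β : Fin m → ℕ) {b c : Ext F n}
    (hb : b ∈ CliffordAlgebra.evenOdd (0 : QuadraticForm F (Fin n → F)) 1)
    (hc : c ∈ CliffordAlgebra.evenOdd (0 : QuadraticForm F (Fin n → F)) 1) :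
    ⁅(fd (Sum.inr k) (Alg.mon α b) : Module.End F (Alg F m n)), fd (Sum.inr l) (Alg.mon β c)⁆ =
      fd (Sum.inr l) (Alg.mon α b * Alg.mon β (Ext.der F k c)) -
        fd (Sum.inr k) (Alg.mon β c * Alg.mon α (Ext.der F l b)) :=
  lie_fd_mon (r := Sum.inr k) (s := Sum.inr l) hb hc

theorem lie_fd_inr_inl (k : Fin n) (j : Fin m) (α β : Fin m → ℕ) {b c : Ext F n}
    (hb : b ∈ CliffordAlgebra.evenOdd (0 : QuadraticForm F (Fin n → F)) 1)
    (hc : c ∈ CliffordAlgebra.evenOdd (0 : QuadraticForm F (Fin n → F)) 0) :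
    ⁅(fd (Sum.inr k) (Alg.mon α b) : Module.End F (Alg F m n)), fd (Sum.inl j) (Alg.mon β c)⁆ =
      fd (Sum.inl j) (Alg.mon α b * Alg.mon β (Ext.der F k c)) -
        fd (Sum.inr k) (Alg.mon β c * D F (Sum.inl j) (Alg.mon α b)) :=
  lie_fd_mon (r := Sum.inr k) (s := Sum.inl j) hb hc

theorem lie_fd_inl_inr (j : Fin m) (k : Fin n) (α β : Fin m → ℕ) {b c : Ext F n}
    (hb : b ∈ CliffordAlgebra.evenOdd (0 : QuadraticForm F (Fin n → F)) 0)
    (hc : c ∈ CliffordAlgebra.evenOdd (0 : QuadraticForm F (Fin n → F)) 1) :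
    ⁅(fd (Sum.inl j) (Alg.mon α b) : Module.End F (Alg F m n)), fd (Sum.inr k) (Alg.mon β c)⁆ =
      fd (Sum.inr k) (Alg.mon α b * D F (Sum.inl j) (Alg.mon β c)) -
        fd (Sum.inl j) (Alg.mon β c * Alg.mon α (Ext.der F k b)) :=
  lie_fd_mon (r := Sum.inl j) (s := Sum.inr k) hb hc

theorem lie_fd_inl_inl (i j : Fin m) (α β : Fin m → ℕ) {b c : Ext F n}
    (hb : b ∈ CliffordAlgebra.evenOdd (0 : QuadraticForm F (Fin n → F)) 0)
    (hc : c ∈ CliffordAlgebra.evenOdd (0 : QuadraticForm F (Fin n → F)) 0) :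
    ⁅(fd (Sum.inl i) (Alg.mon α b) : Module.End F (Alg F m n)), fd (Sum.inl j) (Alg.mon β c)⁆ =
      fd (Sum.inl j) (Alg.mon α b * D F (Sum.inl i) (Alg.mon β c)) -
        fd (Sum.inl i) (Alg.mon β c * D F (Sum.inl j) (Alg.mon α b)) :=
  lie_fd_mon (r := Sum.inl i) (s := Sum.inl j) hb hc

namespace IsNormalized

theorem mem_gl_left (hd : IsNormalized φ ht k₀ k₁ j₀ ν d) {k : Fin n} (hk : k ≠ k₀) :
    fd (Sum.inr k₀) (Alg.mon 0 (Ext.xi F k)) ∈ kerEnd φ d := by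
  have hy := φ.toEnd_lift (fd_mon_mem (zero_lt_pow p t) (Ext.xi_mem_odd (F := F) k)
    (r := Sum.inr k₀))
  rw [← hy, toEnd_mem_kerEnd]
  exact hd.apply_gl k hk _ (by rw [hy, Ext.basis_singleton])

/-- By weights `d` scales `ξ_{k₀} D_l`. Its bracket with the killed field `ξ_l D_{k₀}` is `ξ_l D_l -
ξ_{k₀} D_{k₀}` up to sign, a nonzero torus element that is also killed, so the scalar is zero. -/
theorem mem_gl_right (hd : IsNormalized φ ht k₀ k₁ j₀ ν d) (h2 : (2 : F) ≠ 0) {l : Fin n}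
    (hl : l ≠ k₀) : fd (Sum.inr l) (Alg.mon 0 (Ext.xi F k₀)) ∈ kerEnd φ d := by
  have hS : ((({k₀} : Finset (Fin n)).card : ℕ) : ZMod 2) = tau (Sum.inr l : Fin m ⊕ Fin n) := by
    simp [tau]
  have hy := φ.toEnd_lift (fd_mon_mem (zero_lt_pow p t) (Ext.basis_mem_evenOdd (F := F) hS))
  rw [← Ext.basis_singleton, ← hy, toEnd_mem_kerEnd]
  obtain ⟨c, hc⟩ := exists_apply_eq_smul φ hd.apply_elD hd.apply_elH hS hy (fun T r' h =>
    eq_inr_of_wt_eq h2 (by simpa using hl) (h (Sum.inr l)))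
  obtain ⟨x, hx, hx'⟩ := hd.mem_gl_left hl
  change d x = 0 at hx
  generalize φ.lift _ = y at hy hc
  have hb : φ.toEnd ⁅x, y⁆ = fd (Sum.inr l) (gen F (Sum.inr l)) -
      fd (Sum.inr k₀) (gen F (Sum.inr k₀)) := by
    rw [φ.toEnd_lie, hx', hy, Ext.basis_singleton,
      lie_fd_inr_inr k₀ l 0 0 (Ext.xi_mem_odd l) (Ext.xi_mem_odd k₀), Ext.der_xi, Ext.der_xi,
      if_pos rfl, if_pos rfl, Alg.mon_zero_mul_mon, Alg.mon_zero_mul_mon, mul_one,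
      mul_one]
    rfl
  have h0 : d ⁅x, y⁆ = 0 := by
    rw [← toEnd_mem_kerEnd (φ := φ), hb]
    exact sub_mem (hd.mem_gen _) (hd.mem_gen _)
  rw [d.apply_lie_eq_add, hx, zero_lie, add_zero, hc, lie_smul] at h0
  have h3 := congrArg (co φ 0 {l} (Sum.inr l)) h0
  rw [map_smul, co_apply, hb, map_sub, gen_inr_eq, gen_inr_eq, coord_fd_mon, coord_fd_mon,
    if_pos ⟨rfl, rfl, rfl⟩, if_neg (by simp [Ne.symm hl]), sub_zero, smul_eq_mul, mul_one,
    map_zero] at h3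
  rw [hc, h3, zero_smul]

theorem mem_gl (hd : IsNormalized φ ht k₀ k₁ j₀ ν d) (h2 : (2 : F) ≠ 0) (k l : Fin n) :
    fd (Sum.inr l) (Alg.mon 0 (Ext.xi F k)) ∈ kerEnd φ d := by
  by_cases hkl : k = l
  · subst hkl; exact hd.mem_gen (Sum.inr k)
  by_cases hl : l = k₀
  · subst hl; exact hd.mem_gl_left hkl
  by_cases hk : k = k₀
  · subst hk; exact hd.mem_gl_right h2 hl
  have h := lie_mem_kerEnd (hd.mem_gl_left hk) (hd.mem_gl_right h2 hl)
  rwa [lie_fd_inr_inr k₀ l 0 0 (Ext.xi_mem_odd k) (Ext.xi_mem_odd k₀), Ext.der_xi, Ext.der_xi,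
    if_pos rfl, if_neg (Ne.symm hkl), Alg.mon_zero_mul_mon, mul_one, Alg.mon_zero,
    mul_zero, map_zero, sub_zero] at h

theorem mem_quadratic_step (hd : IsNormalized φ ht k₀ k₁ j₀ ν d) (h2 : (2 : F) ≠ 0)
    {a b : Fin n} {j : Fin m}
    (h : fd (Sum.inl j) (Alg.mon 0 (Ext.xi F a * Ext.xi F b)) ∈ kerEnd φ d) (k q : Fin n) :
    fd (Sum.inl j) (Alg.mon 0 (Ext.xi F k * Ext.der F q (Ext.xi F a * Ext.xi F b))) ∈
      kerEnd φ d := by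
  have h := lie_mem_kerEnd (hd.mem_gl h2 k q) h
  rwa [lie_fd_inr_inl q j 0 0 (Ext.xi_mem_odd k) (Ext.xi_mul_xi_mem_even a b),
    Alg.mon_zero_mul_mon, D_mon_zero_inl, mul_zero, map_zero, sub_zero] at h

/-- Brackets with the `ξ_k D_q` replace the exterior indices one at a time, and a bracket with
`x_{j₀} D_j` changes the direction. -/
theorem mem_quadratic (hd : IsNormalized φ ht k₀ k₁ j₀ ν d) (h2 : (2 : F) ≠ 0) (hk : k₀ ≠ k₁)
    (k l : Fin n) (j : Fin m) :
    fd (Sum.inl j) (Alg.mon 0 (Ext.xi F k * Ext.xi F l)) ∈ kerEnd φ d := by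
  have h0 : fd (Sum.inl j₀) (Alg.mon 0 (Ext.xi F k₀ * Ext.xi F k₁)) ∈ kerEnd φ d := by
    obtain ⟨c, -, hc⟩ := Ext.xi_mul_basis (F := F) (k := k₀) (S := {k₁}) (by simpa using hk)
    rw [Ext.basis_singleton] at hc
    rw [hc, Alg.mon_smul, map_smul]
    refine Submodule.smul_mem _ _ ?_
    have hS : ((({k₀, k₁} : Finset (Fin n)).card : ℕ) : ZMod 2) =
        tau (Sum.inl j₀ : Fin m ⊕ Fin n) := by rw [Finset.card_pair hk]; rfl
    have hz := φ.toEnd_lift (fd_mon_mem (zero_lt_pow p t) (Ext.basis_mem_evenOdd (F := F) hS))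
    rw [← hz, toEnd_mem_kerEnd]
    exact hd.apply_quadratic _ hz
  have h1 (k : Fin n) : fd (Sum.inl j₀) (Alg.mon 0 (Ext.xi F k * Ext.xi F k₁)) ∈ kerEnd φ d := by
    have h := hd.mem_quadratic_step h2 h0 k k₀
    rwa [Ext.der_xi_mul, if_pos rfl, Ext.der_xi, if_neg hk, mul_zero, sub_zero] at h
  have h3 (k l : Fin n) : fd (Sum.inl j₀) (Alg.mon 0 (Ext.xi F k * Ext.xi F l)) ∈ kerEnd φ d := by
    by_cases hl : l = k₁
    · rw [hl]; exact h1 k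
    · have h := hd.mem_quadratic_step h2 (h1 l) k k₁
      rw [Ext.der_xi_mul, if_neg (Ne.symm hl), Ext.der_xi, if_pos rfl, mul_one, zero_sub, mul_neg,
        Alg.mon_neg, map_neg] at h
      exact neg_mem_iff.mp h
  by_cases hj : j = j₀
  · rw [hj]; exact h3 k l
  · have hx : fd (Sum.inl j) (Alg.mon (Pi.single j₀ 1) (Ext.basis F n ∅)) ∈ kerEnd φ d := by
      refine hd.mem_single h2 (by simpa using hj) (by simp [tau]) ?_
      rw [Ext.basis_empty]
      exact hd.mem_D j
    have h := lie_mem_kerEnd (h3 k l) hx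
    rwa [Ext.basis_empty, lie_fd_inl_inl j₀ j 0 (Pi.single j₀ 1) (Ext.xi_mul_xi_mem_even k l)
      (SetLike.one_mem_graded _), D_inl_mon_single, D_mon_zero_inl, mul_zero, map_zero, sub_zero,
      Alg.mon_zero_mul_mon, mul_one] at h

/-- The constant odd fields lie in the kernel. -/
theorem mem_const_odd_basis (hd : IsNormalized φ ht k₀ k₁ j₀ ν d) (h2 : (2 : F) ≠ 0)
    (hk : k₀ ≠ k₁) (q : Fin n) (N : ℕ) (S : Finset (Fin n)) (hN : S.card ≤ N)
    (hS : (S.card : ZMod 2) = 1) :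
    fd (Sum.inr q) (Alg.mon 0 (Ext.basis F n S)) ∈ kerEnd φ d := by
  induction N using Nat.strong_induction_on generalizing S with
  | _ N ih =>
  have hodd : S.card % 2 = 1 := by
    have := (ZMod.natCast_eq_natCast_iff' S.card 1 2).mp (by simpa using hS)
    simpa using this
  by_cases h1 : S.card = 1
  · obtain ⟨k, rfl⟩ := Finset.card_eq_one.mp h1
    rw [Ext.basis_singleton]
    exact hd.mem_gl h2 k q
  -- `|S|` is odd and not `1`, hence at least `3`, which leaves two indices other than `q`.
  obtain ⟨k, hkS, l, hlS, hkl⟩ : ∃ k ∈ S.erase q, ∃ l ∈ S.erase q, k ≠ l := by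
    refine Finset.one_lt_card.mp ?_
    have := Finset.pred_card_le_card_erase (s := S) (a := q)
    omega
  rw [Finset.mem_erase] at hkS hlS
  have hl' : l ∈ S.erase k := Finset.mem_erase.mpr ⟨hkl.symm, hlS.2⟩
  obtain ⟨c₁, hc₁⟩ := Ext.basis_insert (F := F) (Finset.notMem_erase k S)
  obtain ⟨c₂, hc₂⟩ := Ext.basis_insert (F := F) (Finset.notMem_erase l (S.erase k))
  rw [Finset.insert_erase hkS.2] at hc₁
  rw [Finset.insert_erase hl'] at hc₂
  have e1 := Finset.card_erase_add_one hkS.2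
  have e2 := Finset.card_erase_add_one hl'
  rw [hc₁, hc₂, mul_smul_comm, smul_smul, ← mul_assoc, Alg.mon_smul, map_smul]
  refine Submodule.smul_mem _ _ ?_
  have hS' : ((((S.erase k).erase l).card : ℕ) : ZMod 2) = 1 := by
    rw [← hS, ← e1, ← e2]
    push_cast
    rw [add_assoc, show (1 + 1 : ZMod 2) = 0 from rfl, add_zero]
  -- With `S'` the set `S` without `k, l`, `[ξ_k ξ_l D_{j₀}, x_{j₀} ξ_{S'} D_q] = ξ_k ξ_l ξ_{S'}
  -- D_q`; the other term vanishes since `q` is neither `k` nor `l`.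
  have h := lie_mem_kerEnd (hd.mem_quadratic h2 hk k l j₀)
    (hd.mem_single h2 (r := Sum.inr q) (j := j₀) (by simp) hS'
      (ih _ (by omega) ((S.erase k).erase l) le_rfl hS'))
  rwa [lie_fd_inl_inr j₀ q 0 (Pi.single j₀ 1) (Ext.xi_mul_xi_mem_even k l)
    (Ext.basis_mem_evenOdd hS'), D_inl_mon_single, Ext.der_xi_mul, if_neg (Ne.symm hkS.1),
    Ext.der_xi, if_neg (Ne.symm hlS.1),
    mul_zero, sub_zero, Alg.mon_zero, mul_zero, map_zero, sub_zero, Alg.mon_zero_mul_mon] at h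

/-- For odd `b` and `k ≠ l`, `[x^(α) b D_k, ξ_k ξ_l D_r]` equals `x^(α) b ξ_l D_r` up to a field
along `D_k` with exponent `α - ε_r`. Such products `b ξ_l`, together with `1`, span the even
coefficients. -/
theorem mem_even_of_odd (hk : k₀ ≠ k₁) (h2 : (2 : F) ≠ 0)
    (hd : IsNormalized φ ht k₀ k₁ j₀ ν d) {α : Fin m → ℕ} {r : Fin m}
    (hodd : ∀ q, ∀ b ∈ CliffordAlgebra.evenOdd (0 : QuadraticForm F (Fin n → F)) 1,
      fd (Sum.inr q) (Alg.mon α b) ∈ kerEnd φ d)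
    (hone : fd (Sum.inl r) (Alg.mon α 1) ∈ kerEnd φ d)
    (hlow : α r ≠ 0 → ∀ q, ∀ b ∈ CliffordAlgebra.evenOdd (0 : QuadraticForm F (Fin n → F)) 1,
      fd (Sum.inr q) (Alg.mon (α - Pi.single r 1) b) ∈ kerEnd φ d)
    {b : Ext F n} (hb : b ∈ CliffordAlgebra.evenOdd (0 : QuadraticForm F (Fin n → F)) 0) :
    fd (Sum.inl r) (Alg.mon α b) ∈ kerEnd φ d := by
  have key (l : Fin n) (b : Ext F n)
      (hb : b ∈ CliffordAlgebra.evenOdd (0 : QuadraticForm F (Fin n → F)) 1) :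
      fd (Sum.inl r) (Alg.mon α (b * Ext.xi F l)) ∈ kerEnd φ d := by
    obtain ⟨k, hkl⟩ : ∃ k, k ≠ l := by
      by_contra! h
      exact hk ((h k₀).trans (h k₁).symm)
    have h := lie_mem_kerEnd (hodd k b hb) (hd.mem_quadratic h2 hk k l r)
    rw [lie_fd_inr_inl k r α 0 hb (Ext.xi_mul_xi_mem_even k l), Ext.der_xi_mul, if_pos rfl,
      Ext.der_xi, if_neg hkl, mul_zero, sub_zero, Alg.mon_mul_mon_zero] at h
    refine (Submodule.sub_mem_iff_left _ ?_).mp h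
    rw [D_inl_mon]
    split_ifs with hr
    · rw [mul_zero, map_zero]; exact zero_mem _
    · rw [Alg.mon_zero_mul_mon]
      refine hlow hr k _ ?_
      have := SetLike.mul_mem_graded (Ext.xi_mul_xi_mem_even (F := F) k l) hb
      rwa [zero_add] at this
  induction b, hb using CliffordAlgebra.even_induction with
  | algebraMap c =>
    rw [Algebra.algebraMap_eq_smul_one, Alg.mon_smul, map_smul]
    exact Submodule.smul_mem _ _ hone
  | add x y _ _ hx hy => rw [Alg.mon_add, map_add]; exact add_mem hx hy
  | ι_mul_ι_mul v w x hx _ =>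
    have hw : CliffordAlgebra.ι (0 : QuadraticForm F (Fin n → F)) w = ∑ k, w k • Ext.xi F k := by
      conv_lhs => rw [← (Pi.basisFun F (Fin n)).sum_repr w]
      simp only [map_sum, map_smul, Pi.basisFun_repr, Pi.basisFun_apply]
    -- As `x` is even, `w` moves to the right end, leaving `v x` as the odd factor.
    rw [mul_assoc, ← Ext.even_comm hx, ← mul_assoc, hw, Finset.mul_sum, Alg.mon,
      TensorProduct.tmul_sum, map_sum]
    refine sum_mem fun l _ => ?_
    rw [mul_smul_comm, TensorProduct.tmul_smul, map_smul]
    refine Submodule.smul_mem _ _ (key l _ ?_)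
    exact Ext.ι_mul_mem_evenOdd v rfl hx

end IsNormalized

end

/-! ### Induction on the degree of the divided power coefficient -/

section

variable {p : ℕ} [hp : Fact p.Prime] [CharP F p] {t : Fin m → ℕ}
  {L : Type*} [LieRing L] [LieAlgebra F L] {φ : Model F p m n t L} {d : LieDerivation F L L}
  {ht : ∀ i, 1 ≤ t i} {k₀ k₁ : Fin n} {j₀ : Fin m} {ν : Fin m → Fin m}

/-- All fields with coefficients `x^(α) b` lie in the kernel of `d`. -/
def FullAt (φ : Model F p m n t L) (d : LieDerivation F L L) (α : Fin m → ℕ) : Prop :=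
  (∀ q, ∀ b ∈ CliffordAlgebra.evenOdd (0 : QuadraticForm F (Fin n → F)) 1,
    fd (Sum.inr q) (Alg.mon α b) ∈ kerEnd φ d) ∧
  ∀ r, ∀ b ∈ CliffordAlgebra.evenOdd (0 : QuadraticForm F (Fin n → F)) 0,
    fd (Sum.inl r) (Alg.mon α b) ∈ kerEnd φ d

theorem FullAt.one {α : Fin m → ℕ} (h : FullAt φ d α) (r : Fin m) :
    fd (Sum.inl r) (Alg.mon α 1) ∈ kerEnd φ d :=
  h.2 r 1 (SetLike.one_mem_graded _)

theorem FullAt.basis {α : Fin m → ℕ} (h : FullAt φ d α) {r : Fin m ⊕ Fin n} {S : Finset (Fin n)}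
    (hS : (S.card : ZMod 2) = tau r) : fd r (Alg.mon α (Ext.basis F n S)) ∈ kerEnd φ d := by
  have hb := Ext.basis_mem_evenOdd (F := F) hS
  cases r with
  | inl i => exact h.2 i _ hb
  | inr k => exact h.1 k _ hb

/-- The bracket of two fields with coefficients in the divided power algebra. -/
theorem lie_fd_mon_one (i j : Fin m) (α β : Fin m → ℕ) :
    ⁅(fd (Sum.inl i) (Alg.mon α (1 : Ext F n)) : Module.End F (Alg F m n)),
      fd (Sum.inl j) (Alg.mon β (1 : Ext F n))⁆ =
      (if β i = 0 then 0 else (binom α (β - Pi.single i 1) : F) •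
        fd (Sum.inl j) (Alg.mon (α + (β - Pi.single i 1)) (1 : Ext F n))) -
      if α j = 0 then 0 else (binom β (α - Pi.single j 1) : F) •
        fd (Sum.inl i) (Alg.mon (β + (α - Pi.single j 1)) (1 : Ext F n)) := by
  rw [lie_fd_inl_inl i j α β (SetLike.one_mem_graded _) (SetLike.one_mem_graded _), D_inl_mon,
    D_inl_mon]
  congr 1
  · split_ifs
    · rw [mul_zero, map_zero]
    · rw [Alg.mon_mul_mon, mul_one, map_smul]
  · split_ifs
    · rw [mul_zero, map_zero]
    · rw [Alg.mon_mul_mon, mul_one, map_smul]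

theorem single_pow_lt {i : Fin m} {s : ℕ} (hs : s < t i) (j : Fin m) :
    (Pi.single i (p ^ s) : Fin m → ℕ) j < p ^ t j := by
  by_cases hj : j = i
  · subst hj
    simpa using Nat.pow_lt_pow_right hp.out.one_lt hs
  · simpa [hj] using pow_pos hp.out.pos _

theorem single_sub_single (i : Fin m) (a b : ℕ) :
    (Pi.single i a - Pi.single i b : Fin m → ℕ) = Pi.single i (a - b) := by
  ext j
  by_cases hj : j = i
  · subst hj; simp
  · simp [hj]

/-- Modulo `p` one has `a = -1`, so `a (a - 1) = 2`. -/
theorem not_dvd_choose_two {p a : ℕ} (hp : p.Prime) (h3 : 3 < p) (h : p ∣ a + 1) :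
    ¬ p ∣ a.choose 2 := by
  intro hd
  have h1 : p ∣ a * (a - 1) := by
    rw [Nat.choose_two_right] at hd
    exact hd.trans (Nat.div_dvd_of_dvd (Nat.even_mul_pred_self a).two_dvd)
  rcases hp.dvd_mul.mp h1 with h1 | h1
  · have h2 := (Nat.dvd_add_right h1).mp h
    have := Nat.le_of_dvd one_pos h2
    omega
  · have ha : a + 1 = a - 1 + 2 := by
      have := Nat.le_of_dvd (Nat.succ_pos _) h
      omega
    rw [ha] at h
    have := Nat.le_of_dvd two_pos ((Nat.dvd_add_right h1).mp h)
    omega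

/-- By Lucas' theorem, `choose (p ^ s * u) (p ^ s)` is prime to `p` if `u` is. -/
theorem not_dvd_choose_pow {p s u : ℕ} [hp : Fact p.Prime] (hu : ¬ p ∣ u) :
    ¬ p ∣ (p ^ s * u).choose (p ^ s) := by
  induction s with
  | zero => simpa using hu
  | succ s ih =>
    have h := Choose.choose_modEq_choose_mod_mul_choose_div_nat (p := p) (n := p ^ (s + 1) * u)
      (k := p ^ (s + 1))
    have e1 : p ^ (s + 1) * u = p * (p ^ s * u) := by ring
    have e2 : p ^ (s + 1) = p * p ^ s := by ring
    rw [e1, e2, Nat.mul_mod_right, Nat.mul_mod_right, Nat.mul_div_cancel_left _ hp.out.pos,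
      Nat.mul_div_cancel_left _ hp.out.pos, Nat.choose_self, one_mul] at h
    rwa [e1, e2, h.dvd_iff dvd_rfl]

namespace IsNormalized

theorem fullAt_zero (hd : IsNormalized φ ht k₀ k₁ j₀ ν d) (h2 : (2 : F) ≠ 0) (hk : k₀ ≠ k₁) :
    FullAt φ d 0 := by
  have hodd (q : Fin n) : ∀ b ∈ CliffordAlgebra.evenOdd (0 : QuadraticForm F (Fin n → F)) 1,
      fd (Sum.inr q) (Alg.mon 0 b) ∈ kerEnd φ d := fun b hb =>
    fd_mon_mem_kerEnd (r := Sum.inr q) (fun S hS =>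
      hd.mem_const_odd_basis h2 hk q _ S le_rfl hS) hb
  exact ⟨hodd, fun r b hb => hd.mem_even_of_odd hk h2 hodd (hd.mem_D r)
    (fun h => absurd rfl h) hb⟩

/-- Exterior coefficients come for free: `[x^(α) D_{j₀}, x_{j₀} b D_q] = x^(α) b D_q` gives the odd
fields, and `mem_even_of_odd` then gives the even ones. -/
theorem fullAt_of_one (hd : IsNormalized φ ht k₀ k₁ j₀ ν d) (h2 : (2 : F) ≠ 0) (hk : k₀ ≠ k₁)
    {α : Fin m → ℕ} (h0 : FullAt φ d 0) (hα : ∀ r, fd (Sum.inl r) (Alg.mon α 1) ∈ kerEnd φ d)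
    (hlow : ∀ i, α i ≠ 0 → FullAt φ d (α - Pi.single i 1)) : FullAt φ d α := by
  have hodd (q : Fin n) : ∀ b ∈ CliffordAlgebra.evenOdd (0 : QuadraticForm F (Fin n → F)) 1,
      fd (Sum.inr q) (Alg.mon α b) ∈ kerEnd φ d := fun b hb => by
    have hx : fd (Sum.inr q) (Alg.mon (Pi.single j₀ 1) b) ∈ kerEnd φ d :=
      fd_mon_mem_kerEnd (r := Sum.inr q) (fun S hS =>
        hd.mem_single h2 (by simp) hS (h0.basis hS)) hb
    have h := lie_mem_kerEnd (hα j₀) hx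
    rwa [lie_fd_inl_inr j₀ q α _ (SetLike.one_mem_graded _) hb, D_inl_mon_single, Ext.der_one,
      Alg.mon_zero, mul_zero, map_zero, sub_zero, Alg.mon_mul_mon_zero, one_mul] at h
  exact ⟨hodd, fun r b hb => hd.mem_even_of_odd hk h2 hodd (hα r) (fun h => (hlow r h).1) hb⟩

/-- Multiplication by `x_a` via a bracket with `x_a^(2) D_a`. -/
theorem one_mem_of_dvd_add_one (h3 : 3 < p) {α : Fin m → ℕ} (hα : ∀ i, α i < p ^ t i)
    (ih : ∀ β : Fin m → ℕ, (∀ i, β i < p ^ t i) → ∑ i, β i < ∑ i, α i → FullAt φ d β)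
    {a r : Fin m} (har : a ≠ r) (ha : p ∣ α a + 1) :
    fd (Sum.inl r) (Alg.mon α 1) ∈ kerEnd φ d := by
  -- From `α a ≥ p - 1` and `p > 3`; so `x_a^(2)` has smaller degree than `x^(α)` and the induction
  -- hypothesis covers it.
  have h4 : 3 ≤ α a := by have := Nat.le_of_dvd (Nat.succ_pos _) ha; omega
  have hle : ∀ β : Fin m → ℕ, β ≤ α → β a < α a → FullAt φ d β := fun β hβ hlt =>
    ih β (fun i => (hβ i).trans_lt (hα i))
      (Finset.sum_lt_sum (fun i _ => hβ i) ⟨a, Finset.mem_univ _, hlt⟩)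
  -- `[x_a^(2) D_a, x^(α - ε_a) D_r]` is `(α a).choose 2` times `x^(α) D_r`.
  have h := lie_mem_kerEnd
    ((hle (Pi.single a 2) (by intro i; by_cases hi : i = a <;> [(subst hi; simp; omega); simp [hi]])
      (by simp; omega)).one a)
    ((hle (α - Pi.single a 1) tsub_le_self (by simp; omega)).one r)
  rw [lie_fd_mon_one, if_neg (by simp; omega), if_pos (by simp [har.symm]), sub_zero,
    Submodule.smul_mem_iff] at h
  · convert h using 3
    ext i
    by_cases hi : i = a
    · subst hi; simp; omega
    · simp [hi]
  · rw [binom_single, Ne, CharP.cast_eq_zero_iff F p]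
    have e : 2 + (α - Pi.single a 1 - Pi.single a 1 : Fin m → ℕ) a = α a := by simp; omega
    rw [e]
    exact not_dvd_choose_two hp.out h3 ha

/-- In direction `ν i`, weights leave only the constant term along `D_{ν i}`, which the
normalization excludes. Bracketing with `x_{ν i} D_r` gives the other directions. -/
theorem one_mem_single_pow (hd : IsNormalized φ ht k₀ k₁ j₀ ν d) (h2 : (2 : F) ≠ 0)
    (hν : ∀ i, ν i ≠ i) (h0 : FullAt φ d 0) {i : Fin m} {s : ℕ}
    (hs : s ∈ Finset.Ico 1 (t i)) (hlow : FullAt φ d (Pi.single i (p ^ s - 1))) {r : Fin m}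
    (hr : r ≠ i) : fd (Sum.inl r) (Alg.mon (Pi.single i (p ^ s)) 1) ∈ kerEnd φ d := by
  have h1 : fd (Sum.inl (ν i)) (Alg.mon (Pi.single i (p ^ s)) 1) ∈ kerEnd φ d := by
    rw [← Ext.basis_empty]
    refine hd.mem_of_co (single_pow_lt (Finset.mem_Ico.mp hs).2) (by simp [tau])
      (fun j hj => ?_) fun y hy T r' hw => ?_
    · have hji : j = i := by
        by_contra h
        simp [h] at hj
      subst hji
      rw [single_sub_single]
      exact hlow.basis (by simp [tau])
    · have hr' : r' = Sum.inl (ν i) := eq_inl_of_wt_eq (S := ∅) (by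
        rw [hw]; simp [wt, wt₀, hν])
      subst hr'
      have hT : T = ∅ := eq_of_wt_inr_eq fun k => hw (Sum.inr k)
      subst hT
      exact hd.apply_power i s hs y hy
  by_cases hrν : r = ν i
  · rwa [hrν]
  have hx : fd (Sum.inl r) (Alg.mon (Pi.single (ν i) 1) 1) ∈ kerEnd φ d := by
    rw [← Ext.basis_empty]
    exact hd.mem_single h2 (by simpa using hrν) (by simp [tau]) (h0.basis (by simp [tau]))
  have h := lie_mem_kerEnd h1 hx
  rwa [lie_fd_mon_one, if_neg (by simp), if_pos (by simp [hr]), sub_zero, tsub_self,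
    binom_zero_right, add_zero, Nat.cast_one, one_smul] at h

/-- Write `α i = p ^ s * u` with `u` prime to `p`. Unless `x^(α)` is `x_i^(p^s)` itself, bracketing
`x_i^(p^s) D_i` with `x^(α - (p^s - 1) ε_i) D_r` gives `(p ^ s * u).choose (p ^ s)` times `x^(α)
D_r`. -/
theorem one_mem_of_dvd (hd : IsNormalized φ ht k₀ k₁ j₀ ν d) (h2 : (2 : F) ≠ 0)
    (hν : ∀ i, ν i ≠ i) (h0 : FullAt φ d 0)
    {α : Fin m → ℕ} (hα : ∀ i, α i < p ^ t i)
    (ih : ∀ β : Fin m → ℕ, (∀ i, β i < p ^ t i) → ∑ i, β i < ∑ i, α i → FullAt φ d β)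
    {i r : Fin m} (hir : r ≠ i) (hi : p ∣ α i) (hi0 : α i ≠ 0) :
    fd (Sum.inl r) (Alg.mon α 1) ∈ kerEnd φ d := by
  obtain ⟨s, u, hu, hsu⟩ := Nat.exists_eq_pow_mul_and_not_dvd hi0 p hp.out.ne_one
  have hs1 : 1 ≤ s := by
    by_contra h
    rw [show s = 0 by omega, pow_zero, one_mul] at hsu
    exact hu (hsu ▸ hi)
  have hu0 : 1 ≤ u := Nat.pos_of_ne_zero (by rintro rfl; exact hu (dvd_zero p))
  have hle : p ^ s ≤ α i := by rw [hsu]; exact Nat.le_mul_of_pos_right _ hu0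
  have hst : s < t i := (Nat.pow_lt_pow_iff_right hp.out.one_lt).mp (hle.trans_lt (hα i))
  have hp1 : 1 < p ^ s := Nat.one_lt_pow (by omega) hp.out.one_lt
  have hsingle (c : ℕ) (hc : c ≤ α i) : (Pi.single i c : Fin m → ℕ) ≤ α := fun j => by
    by_cases hj : j = i
    · subst hj; simpa using hc
    · simp [hj]
  have hfull : ∀ β : Fin m → ℕ, β ≤ α → β ≠ α → FullAt φ d β := fun β hβ hne => by
    obtain ⟨j, hj⟩ : ∃ j, β j ≠ α j := by
      by_contra! h
      exact hne (funext h)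
    exact ih β (fun i => (hβ i).trans_lt (hα i))
      (Finset.sum_lt_sum (fun i _ => hβ i) ⟨j, Finset.mem_univ _, lt_of_le_of_ne (hβ j) hj⟩)
  by_cases hαs : Pi.single i (p ^ s) = α
  · rw [← hαs]
    refine hd.one_mem_single_pow h2 hν h0 (Finset.mem_Ico.mpr ⟨hs1, hst⟩)
      (hfull _ (hsingle _ (by omega)) ?_) hir
    rw [← hαs]
    intro h
    have := congrFun h i
    simp only [Pi.single_eq_same] at this
    omega
  · have h := lie_mem_kerEnd ((hfull _ (hsingle _ hle) hαs).one i)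
      ((hfull (α - Pi.single i (p ^ s - 1)) tsub_le_self (fun h => by
        have := congrFun h i
        simp at this
        omega)).one r)
    have e : α - Pi.single i (p ^ s - 1) - Pi.single i 1 = α - Pi.single i (p ^ s) := by
      rw [tsub_tsub, ← Pi.single_add, Nat.sub_add_cancel hp1.le]
    rw [lie_fd_mon_one, if_neg (by simp; omega), if_pos (by simp [hir]), sub_zero, e,
      add_tsub_cancel_of_le (hsingle _ hle), Submodule.smul_mem_iff] at h
    · exact h
    · rw [binom_single, Ne, CharP.cast_eq_zero_iff F p]
      have e' : p ^ s + (α - Pi.single i (p ^ s) : Fin m → ℕ) i = p ^ s * u := by simp; omega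
      rw [e']
      exact not_dvd_choose_pow hu

/-- With `l ≠ r`, `[x_r^(a) D_l, x_l D_r] = x_r^(a) D_r - x_l x_r^(a-1) D_l`. The last field has
exponent `-1` modulo `p` at `r ≠ l`, so `one_mem_of_dvd_add_one` applies to it. -/
theorem one_mem_single (hd : IsNormalized φ ht k₀ k₁ j₀ ν d) (h2 : (2 : F) ≠ 0) (h3 : 3 < p)
    (hν : ∀ i, ν i ≠ i) (h0 : FullAt φ d 0) {r : Fin m} {a : ℕ} (ha : p ∣ a) (ha0 : a ≠ 0)
    (hα : a < p ^ t r)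
    (ih : ∀ β : Fin m → ℕ, (∀ i, β i < p ^ t i) → ∑ i, β i < a → FullAt φ d β) :
    fd (Sum.inl r) (Alg.mon (Pi.single r a) 1) ∈ kerEnd φ d := by
  set l := ν r
  have hl : l ≠ r := hν r
  have hsum (c : ℕ) (i : Fin m) : ∑ j, (Pi.single i c : Fin m → ℕ) j = c := by
    simp [Finset.sum_pi_single']
  have hx : fd (Sum.inl r) (Alg.mon (Pi.single l 1) 1) ∈ kerEnd φ d := by
    rw [← Ext.basis_empty]
    exact hd.mem_single h2 (by simpa using hl.symm) (by simp [tau]) (h0.basis (by simp [tau]))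
  have hα' : ∀ j, (Pi.single r a : Fin m → ℕ) j < p ^ t j := fun j => by
    by_cases hj : j = r
    · subst hj; simpa using hα
    · simpa [hj] using pow_pos hp.out.pos _
  have hy : fd (Sum.inl l) (Alg.mon (Pi.single r a) 1) ∈ kerEnd φ d :=
    hd.one_mem_of_dvd h2 hν h0 hα' (by rwa [hsum]) hl (by simpa using ha) (by simpa using ha0)
  have hz : fd (Sum.inl l) (Alg.mon (Pi.single l 1 + Pi.single r (a - 1)) 1) ∈ kerEnd φ d := by
    refine one_mem_of_dvd_add_one h3 (fun j => ?_) (fun β hβ hlt => ih β hβ ?_) hl.symm ?_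
    · by_cases hj : j = r
      · subst hj; simp [hl.symm]; omega
      · simpa [hj] using single_lt ht l j
    · refine hlt.trans_eq ?_
      simp only [Pi.add_apply, Finset.sum_add_distrib, hsum]
      omega
    · simp only [Pi.add_apply, Pi.single_eq_same, Pi.single_eq_of_ne hl.symm, zero_add]
      rwa [Nat.sub_add_cancel (by omega)]
  have h := lie_mem_kerEnd hy hx
  rw [lie_fd_mon_one, if_neg (by simp), if_neg (by simpa using ha0), tsub_self, binom_zero_right,
    add_zero, Nat.cast_one, one_smul, single_sub_single] at h
  exact (Submodule.sub_mem_iff_left _ (Submodule.smul_mem _ _ hz)).mp h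

/-- The weight of `x^(α) D_r` agrees with that of `D_r` only if all exponents vanish modulo `p`, and
with that of `D_a`, `a ≠ r`, only if `α a = -1` modulo `p`. The bracket lemmas treat these cases;
otherwise `mem_of_co` concludes. -/
theorem one_mem (hd : IsNormalized φ ht k₀ k₁ j₀ ν d) (hn : 3 ≤ n) (h2 : (2 : F) ≠ 0) (h3 : 3 < p)
    (hν : ∀ i, ν i ≠ i) (h0 : FullAt φ d 0)
    {α : Fin m → ℕ} (hα : ∀ i, α i < p ^ t i)
    (ih : ∀ β : Fin m → ℕ, (∀ i, β i < p ^ t i) → ∑ i, β i < ∑ i, α i → FullAt φ d β)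
    (r : Fin m) : fd (Sum.inl r) (Alg.mon α 1) ∈ kerEnd φ d := by
  by_cases hα0 : α = 0
  · rw [hα0]; exact h0.one r
  by_cases hA : ∃ a, a ≠ r ∧ p ∣ α a + 1
  · obtain ⟨a, ha, hpa⟩ := hA
    exact one_mem_of_dvd_add_one h3 hα ih ha hpa
  by_cases hB : ∃ i, r ≠ i ∧ p ∣ α i ∧ α i ≠ 0
  · obtain ⟨i, hi, hpi, hi0⟩ := hB
    exact hd.one_mem_of_dvd h2 hν h0 hα ih hi hpi hi0
  push Not at hA hB
  by_cases hdvd : ∀ i, p ∣ α i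
  · have hα' : α = Pi.single r (α r) := by
      ext i
      by_cases hi : i = r
      · subst hi; simp
      · simpa [hi] using hB i (Ne.symm hi) (hdvd i)
    have hr0 : α r ≠ 0 := fun h => hα0 (by rw [hα', h, Pi.single_zero])
    rw [hα']
    refine hd.one_mem_single h2 h3 hν h0 (hdvd r) hr0 (hα r) fun β hβ hlt => ih β hβ ?_
    exact hlt.trans_le (Finset.single_le_sum (fun _ _ => Nat.zero_le _) (Finset.mem_univ r))
  · have hlow (i : Fin m) (hi : α i ≠ 0) : FullAt φ d (α - Pi.single i 1) :=
      ih _ (fun j => (Nat.sub_le _ _).trans_lt (hα j))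
        (Finset.sum_lt_sum (fun j _ => Nat.sub_le _ _) ⟨i, Finset.mem_univ _, by simp; omega⟩)
    have hS : (((∅ : Finset (Fin n)).card : ℕ) : ZMod 2) = tau (Sum.inl r : Fin m ⊕ Fin n) := by
      simp [tau]
    rw [← Ext.basis_empty]
    refine hd.mem_of_co hα hS (fun i hi => (hlow i hi).basis hS) fun y hy T r' hw => ?_
    cases r' with
    | inl a =>
      exfalso
      by_cases har : a = r
      · subst har
        refine hdvd fun i => ?_
        have h := sub_left_inj.mp (hw (Sum.inl i))
        simp only [wt₀, Pi.zero_apply, Nat.cast_zero] at h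
        exact (CharP.cast_eq_zero_iff F p _).mp h.symm
      · have h := hw (Sum.inl a)
        simp only [wt, wt₀, Pi.zero_apply, Nat.cast_zero, if_true, Sum.inl.injEq, if_neg har,
          sub_zero, zero_sub] at h
        refine hA a har ((CharP.cast_eq_zero_iff F p _).mp ?_)
        push_cast
        linear_combination -h
    | inr k =>
      -- Weights do not exclude `ξ_q D_q` when all exponents other than that of `x_r` vanish.
      -- Instead, `d y` is shown to commute with `ξ_T D_r` for `|T| = 2`, because `[y, ξ_T D_r]` has
      -- lower degree.
      refine co_inr_eq_zero φ hn h2 (d y)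
        (fun β T r' hβ => hd.co_eq_zero hS (fun i hi => (hlow i hi).basis hS) hy T r' hβ)
        (fun T r' q hne => ?_) r (fun T hT => ?_) 0 T k
      · by_contra h
        exact hne (by rw [hd.wt_eq hS hy h]; simp [wt, wt₀])
      · have hT' : (T.card : ZMod 2) = tau (Sum.inl r : Fin m ⊕ Fin n) := by rw [hT]; rfl
        obtain ⟨x, hx, hxe⟩ := h0.basis hT'
        change d x = 0 at hx
        have h : d ⁅y, x⁆ = 0 := by
          rw [← toEnd_mem_kerEnd (φ := φ), φ.toEnd_lie, hxe, hy, Ext.basis_empty,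
            lie_fd_inl_inl r r α 0 (SetLike.one_mem_graded _) (Ext.basis_mem_evenOdd hT'),
            D_mon_zero_inl, mul_zero, map_zero, zero_sub, neg_mem_iff, D_inl_mon]
          split_ifs with hr
          · rw [mul_zero, map_zero]; exact zero_mem _
          · rw [Alg.mon_zero_mul_mon, mul_one]
            exact (hlow r hr).basis hT'
        rw [d.apply_lie_eq_add, hx, lie_zero, zero_add] at h
        rw [← hxe, ← φ.toEnd_lie, h, map_zero]

theorem fullAt (hd : IsNormalized φ ht k₀ k₁ j₀ ν d) (hn : 3 ≤ n) (h2 : (2 : F) ≠ 0) (h3 : 3 < p)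
    (hν : ∀ i, ν i ≠ i) (hk : k₀ ≠ k₁) {N : ℕ} {α : Fin m → ℕ} (hα : ∀ i, α i < p ^ t i)
    (hN : ∑ i, α i = N) : FullAt φ d α := by
  induction N using Nat.strong_induction_on generalizing α with
  | _ N ih =>
  subst hN
  have h0 := hd.fullAt_zero h2 hk
  refine hd.fullAt_of_one h2 hk h0 (hd.one_mem hn h2 h3 hν h0 hα fun β hβ hlt =>
    ih _ hlt hβ rfl) fun i hi => ih _ ?_ (fun j => (Nat.sub_le _ _).trans_lt (hα j)) rfl
  exact Finset.sum_lt_sum (fun j _ => Nat.sub_le _ _) ⟨i, Finset.mem_univ _, by simp; omega⟩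

theorem eq_zero (hd : IsNormalized φ ht k₀ k₁ j₀ ν d) (hn : 3 ≤ n) (h2 : (2 : F) ≠ 0) (h3 : 3 < p)
    (hν : ∀ i, ν i ≠ i) (hk : k₀ ≠ k₁) (y : L) : d y = 0 := by
  rw [← toEnd_mem_kerEnd (φ := φ)]
  refine Submodule.span_le.mpr ?_ (mem_span_of_mem_evenW (φ.mem y))
  rintro _ ⟨α, S, r, hne, rfl⟩
  exact (hd.fullAt hn h2 h3 hν hk (lt_of_coord_ne_zero (φ.mem y) hne) rfl).basis
    (card_eq_of_coord_ne_zero (φ.mem y) hne)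

end IsNormalized

end

/-! ### The outer derivation algebra -/

section

variable {p : ℕ} [hp : Fact p.Prime] [CharP F p] {t : Fin m → ℕ}
  {L : Type*} [LieRing L] [LieAlgebra F L] (φ : Model F p m n t L)

theorem coord_fd_mon_of_ne {α β : Fin m → ℕ} (h : β ≠ α) (S : Finset (Fin n))
    (r s : Fin m ⊕ Fin n) (b : Ext F n) : coord α S r (fd s (Alg.mon β b)) = 0 := by
  have e : (coord α S r ∘ₗ fd s ∘ₗ TensorProduct.mk F _ (Ext F n) (DividedPow.mon F β)) = 0 := by
    refine (Ext.basis F n).ext fun T => ?_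
    change coord α S r (fd s (Alg.mon β (Ext.basis F n T))) = 0
    rw [coord_fd_mon, if_neg fun h' => h h'.1]
  exact LinearMap.congr_fun e b

/-- Bracketing with a constant field lowers the exponent by at most one unit, so degree at least two
leaves no constant term. -/
theorem coord_zero_lie_fd_mon {β : Fin m → ℕ} (h0 : β ≠ 0) (h1 : ∀ i, β ≠ Pi.single i 1)
    {r s : Fin m ⊕ Fin n} {b c : Ext F n}
    (hb : b ∈ CliffordAlgebra.evenOdd (0 : QuadraticForm F (Fin n → F)) (tau r))
    (hc : c ∈ CliffordAlgebra.evenOdd (0 : QuadraticForm F (Fin n → F)) (tau s))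
    (S : Finset (Fin n)) (q : Fin m ⊕ Fin n) :
    coord 0 S q
      (⁅(fd r (Alg.mon 0 b) : Module.End F (Alg F m n)), fd s (Alg.mon β c)⁆) = 0 := by
  have e1 : coord 0 S q (fd s (Alg.mon 0 b * D F r (Alg.mon β c))) = 0 := by
    cases r with
    | inl i =>
      rw [D_inl_mon]
      split_ifs with hi
      · rw [mul_zero, map_zero, map_zero]
      · rw [Alg.mon_zero_mul_mon]
        refine coord_fd_mon_of_ne (fun h => h1 i ?_) _ _ _ _
        have h' := tsub_eq_zero_iff_le.mp h
        ext j
        have := h' j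
        by_cases hj : j = i
        · subst hj
          simp at this ⊢
          omega
        · simpa [hj] using this
    | inr k =>
      rw [D_inr_mon, Alg.mon_zero_mul_mon]
      exact coord_fd_mon_of_ne h0 _ _ _ _
  have e2 : coord 0 S q (fd r (Alg.mon β c * D F s (Alg.mon 0 b))) = 0 := by
    cases s with
    | inl i => rw [D_mon_zero_inl, mul_zero, map_zero, map_zero]
    | inr k =>
      rw [D_inr_mon, Alg.mon_mul_mon_zero]
      exact coord_fd_mon_of_ne h0 _ _ _ _
  rw [lie_fd_mon hb hc, map_sub, e1, e2, sub_zero]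

theorem co_zero_lie_eq_zero {u : L} (hu : ∀ i, ⁅u, elD φ i⁆ = 0) {β : Fin m → ℕ} (h0 : β ≠ 0)
    (h1 : ∀ i, β ≠ Pi.single i 1) {s : Fin m ⊕ Fin n} {c : Ext F n}
    (hc : c ∈ CliffordAlgebra.evenOdd (0 : QuadraticForm F (Fin n → F)) (tau s)) {y : L}
    (hy : φ.toEnd y = fd s (Alg.mon β c)) (S : Finset (Fin n)) (q : Fin m ⊕ Fin n) :
    co φ 0 S q ⁅u, y⁆ = 0 := by
  rw [co_apply, φ.toEnd_lie, hy]
  have key : ∀ A ∈ Submodule.span F {B | ∃ α S r, coord α S r (φ.toEnd u) ≠ 0 ∧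
      B = fd r (Alg.mon α (Ext.basis F n S))}, coord 0 S q (⁅A, fd s (Alg.mon β c)⁆) = 0 := by
    intro A hA
    induction hA using Submodule.span_induction with
    | zero => rw [zero_lie, map_zero]
    | add x y _ _ hx hy => rw [add_lie, map_add, hx, hy, add_zero]
    | smul a x _ hx => rw [smul_lie_end, map_smul, hx, smul_zero]
    | mem B hB =>
      obtain ⟨α, T, r, hne, rfl⟩ := hB
      have hα : α = 0 := by
        by_contra hα
        obtain ⟨i, hi⟩ : ∃ i, α i ≠ 0 := by
          by_contra! h
          exact hα (funext h)
        refine hne ?_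
        have h := co_lie_elD φ i u (α - Pi.single i 1) T r
        rw [sub_single_add_single hi, ← lie_skew, hu, neg_zero, map_zero] at h
        exact h.symm
      subst hα
      exact coord_zero_lie_fd_mon h0 h1
        (Ext.basis_mem_evenOdd (card_eq_of_coord_ne_zero (φ.mem u) hne)) hc S q
  exact key _ (mem_span_of_mem_evenW (φ.mem u))

theorem powerDer_elD (c : (i : Fin m) → ℕ → F) (i : Fin m) : powerDer φ c (elD φ i) = 0 :=
  powerDer_apply_eq_zero φ c (α := 0) (S := ∅) (fun _ => two_pos)
    (by rw [toEnd_elD, Ext.basis_empty, fd_one])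

theorem powerDer_elH (ht : ∀ i, 1 ≤ t i) (c : (i : Fin m) → ℕ → F) (s : Fin m ⊕ Fin n) :
    powerDer φ c (elH φ ht s) = 0 := by
  cases s with
  | inl i =>
    refine powerDer_apply_eq_zero φ c (α := Pi.single i 1) (S := ∅) (fun j => ?_)
      (by rw [toEnd_elH, Ext.basis_empty, gen_inl])
    by_cases h : j = i
    · subst h; simp
    · simp [h]
  | inr k =>
    exact powerDer_apply_eq_zero φ c (α := 0) (S := {k}) (fun _ => two_pos)
      (by rw [toEnd_elH, Ext.basis_singleton, gen_inr])

/-- A combination of the powers of the `ad D_i` is inner only if it is trivial. -/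
theorem eq_zero_of_powerDer_eq_ad {c : (i : Fin m) → ℕ → F} {u : L}
    (h : powerDer φ c = LieDerivation.ad F L u) {i : Fin m} {s : ℕ}
    (hs : s ∈ Finset.Ico 1 (t i)) : c i s = 0 := by
  have hs' := Finset.mem_Ico.mp hs
  have hp1 : 1 < p ^ s := Nat.one_lt_pow (by omega) hp.out.one_lt
  have hu (j : Fin m) : ⁅u, elD φ j⁆ = 0 := by
    rw [← LieDerivation.ad_apply_apply F, ← h, powerDer_elD]
  have hc : Ext.basis F n ∅ ∈ CliffordAlgebra.evenOdd (0 : QuadraticForm F (Fin n → F))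
      (tau (Sum.inl i : Fin m ⊕ Fin n)) := Ext.basis_mem_evenOdd (by simp [tau])
  have hy := φ.toEnd_lift (fd_mon_mem (single_pow_lt (p := p) hs'.2) hc)
  -- Test on `x_i^(p^s) D_i`: `powerDer` has constant term `c i s` there, while `u` has constant
  -- coefficients and `p ^ s > 1`, so `ad u` has none.
  rw [← co_powerDer_single φ c hs hy, h, LieDerivation.ad_apply_apply]
  refine co_zero_lie_eq_zero φ hu (fun h0 => ?_) (fun j h1 => ?_) hc hy _ _
  · have := congrFun h0 i
    rw [Pi.single_eq_same, Pi.zero_apply] at this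
    omega
  · have := congrFun h1 i
    rw [Pi.single_eq_same] at this
    by_cases hij : i = j
    · subst hij
      rw [Pi.single_eq_same] at this
      omega
    · rw [Pi.single_eq_of_ne hij] at this
      omega

/-- Every derivation is inner up to powers of the `ad D_i`. -/
theorem exists_eq_ad_add_powerDer (hm : 3 ≤ m) (hn : 3 ≤ n) (hp3 : 3 < p) (ht : ∀ i, 1 ≤ t i)
    (d : LieDerivation F L L) :
    ∃ (u : L) (c : (i : Fin m) → ℕ → F), d = LieDerivation.ad F L u + powerDer φ c := by
  have h2 : (2 : F) ≠ 0 := by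
    have h : ((2 : ℕ) : F) ≠ 0 := by
      rw [Ne, CharP.cast_eq_zero_iff F p]
      exact fun h => by have := Nat.le_of_dvd two_pos h; omega
    exact_mod_cast h
  have : Nontrivial (Fin m) := Fin.nontrivial_iff_two_le.mpr (by omega)
  have : Nontrivial (Fin n) := Fin.nontrivial_iff_two_le.mpr (by omega)
  choose ν hν using fun i : Fin m => exists_ne i
  obtain ⟨k₀, k₁, hk⟩ := exists_pair_ne (Fin n)
  obtain ⟨j₀, -, -⟩ := exists_pair_ne (Fin m)
  obtain ⟨u₁, hu₁⟩ := exists_eq_on_elD φ hn (by omega) h2 ht d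
  have hD₁ (i : Fin m) : (d - LieDerivation.ad F L u₁) (elD φ i) = 0 := by
    rw [LieDerivation.sub_apply, LieDerivation.ad_apply_apply, hu₁, sub_self]
  obtain ⟨u₂, hu₂, hu₂'⟩ := exists_eq_on_elH φ hn (by omega) h2 ht _ hD₁
  have hD₂ (i : Fin m) : (d - LieDerivation.ad F L u₁ - LieDerivation.ad F L u₂) (elD φ i) = 0 := by
    rw [LieDerivation.sub_apply, LieDerivation.ad_apply_apply, hD₁, hu₂, sub_self]
  have hH₂ (s : Fin m ⊕ Fin n) :
      (d - LieDerivation.ad F L u₁ - LieDerivation.ad F L u₂) (elH φ ht s) = 0 := by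
    rw [LieDerivation.sub_apply, LieDerivation.ad_apply_apply, hu₂', sub_self]
  obtain ⟨u₃, hu₃, hu₃', hgl, hz⟩ := exists_eq_on_gl φ ht h2 hD₂ hH₂ hk j₀
  generalize hd₂ : d - LieDerivation.ad F L u₁ - LieDerivation.ad F L u₂ = d₂ at *
  -- The constant term to be removed. When the field is not in the algebra, the value is irrelevant
  -- and set to `0`.
  have hex (i : Fin m) (s : ℕ) : ∃ c : F, ∀ y, φ.toEnd y =
      fd (Sum.inl (ν i)) (Alg.mon (Pi.single i (p ^ s)) (Ext.basis F n ∅)) →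
        co φ 0 ∅ (Sum.inl (ν i)) ((d₂ - LieDerivation.ad F L u₃) y) = c := by
    by_cases h : ∃ y, φ.toEnd y =
      fd (Sum.inl (ν i)) (Alg.mon (Pi.single i (p ^ s)) (Ext.basis F n ∅))
    · obtain ⟨y, hy⟩ := h
      exact ⟨_, fun z hz => by rw [φ.injective (hz.trans hy.symm)]⟩
    · exact ⟨0, fun y hy => absurd ⟨y, hy⟩ h⟩
  choose c hc using hex
  have hN : IsNormalized φ ht k₀ k₁ j₀ ν (d₂ - LieDerivation.ad F L u₃ - powerDer φ c) := by
    refine ⟨fun i => ?_, fun s => ?_, fun k hk y hy => ?_, fun z hz' => ?_, fun i s hs y hy => ?_⟩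
    · rw [LieDerivation.sub_apply, LieDerivation.sub_apply, LieDerivation.ad_apply_apply, hD₂,
        hu₃, powerDer_elD, sub_self, sub_self]
    · rw [LieDerivation.sub_apply, LieDerivation.sub_apply, LieDerivation.ad_apply_apply, hH₂,
        hu₃', powerDer_elH, sub_self, sub_self]
    · rw [LieDerivation.sub_apply, LieDerivation.sub_apply, LieDerivation.ad_apply_apply,
        hgl k hk y hy, powerDer_apply_eq_zero φ c (fun _ => two_pos) hy, sub_self, sub_self]
    · rw [LieDerivation.sub_apply, LieDerivation.sub_apply, LieDerivation.ad_apply_apply,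
        hz z hz', powerDer_apply_eq_zero φ c (fun _ => two_pos) hz', sub_self, sub_self]
    · rw [LieDerivation.sub_apply, map_sub, hc i s y hy, co_powerDer_single φ c hs hy, sub_self]
  refine ⟨u₁ + u₂ + u₃, c, LieDerivation.ext fun y => ?_⟩
  have h := hN.eq_zero hn h2 hp3 hν hk y
  rw [← hd₂] at h
  simp only [LieDerivation.sub_apply, LieDerivation.ad_apply_apply] at h
  rw [LieDerivation.add_apply, LieDerivation.ad_apply_apply, add_lie, add_lie,
    ← sub_eq_zero, ← h]
  abel

/-- Both derivations translate coordinates, and translations commute. -/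
theorem lie_derivationPow_ad (i j : Fin m) (s k : ℕ) :
    ⁅derivationPow p s (LieDerivation.ad F L (elD φ i)),
      derivationPow p k (LieDerivation.ad F L (elD φ j))⁆ = 0 := by
  refine LieDerivation.ext fun y => ext_co φ fun α S r => ?_
  rw [LieDerivation.commutator_apply, map_sub, co_derivationPow_ad, co_derivationPow_ad,
    co_derivationPow_ad, co_derivationPow_ad, add_right_comm, sub_self, LieDerivation.zero_apply,
    map_zero]

theorem lie_powerDer (c c' : (i : Fin m) → ℕ → F) : ⁅powerDer φ c, powerDer φ c'⁆ = 0 := by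
  simp only [powerDer, sum_lie, lie_sum, smul_lie, LieAlgebra.lie_smul, lie_derivationPow_ad,
    smul_zero,
    Finset.sum_const_zero]

theorem isLieAbelian_outerDer (φ : Model F p m n t L) (hm : 3 ≤ m) (hn : 3 ≤ n) (hp3 : 3 < p)
    (ht : ∀ i, 1 ≤ t i) :
    IsLieAbelian (OuterDer F L) := by
  have hmk (x : OuterDer F L) : ∃ c, LieSubmodule.Quotient.mk (powerDer φ c) = x := by
    obtain ⟨d, rfl⟩ := LieSubmodule.Quotient.surjective_mk' _ x
    obtain ⟨u, c, rfl⟩ := exists_eq_ad_add_powerDer φ hm hn hp3 ht d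
    refine ⟨c, ((Submodule.Quotient.eq _).mpr ⟨-u, ?_⟩)⟩
    rw [sub_add_cancel_right]
    exact map_neg (LieDerivation.ad F L) u
  refine ⟨fun x y => ?_⟩
  obtain ⟨c, rfl⟩ := hmk x
  obtain ⟨c', rfl⟩ := hmk y
  rw [← LieSubmodule.Quotient.mk_bracket, lie_powerDer]
  rfl

/-- The classes of the `(ad D_i) ^ (p ^ s)`, with `1 ≤ s < t i`, are coordinates on the outer
derivation algebra. -/
theorem exists_outerDer_equiv (φ : Model F p m n t L) (hm : 3 ≤ m) (hn : 3 ≤ n) (hp3 : 3 < p)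
    (ht : ∀ i, 1 ≤ t i) :
    Nonempty (((Σ i : Fin m, Finset.Ico 1 (t i)) → F) ≃ₗ[F] OuterDer F L) := by
  let Φ : ((Σ i : Fin m, Finset.Ico 1 (t i)) → F) →ₗ[F] LieDerivation F L L :=
    Fintype.linearCombination F fun x => derivationPow p x.2 (LieDerivation.ad F L (elD φ x.1))
  have hΦ (c : (i : Fin m) → ℕ → F) : Φ (fun x => c x.1 x.2) = powerDer φ c := by
    rw [Fintype.linearCombination_apply, Fintype.sum_sigma, powerDer]
    exact Finset.sum_congr rfl fun i _ => Finset.sum_coe_sort (Finset.Ico 1 (t i))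
      fun s => c i s • derivationPow p s (LieDerivation.ad F L (elD φ i))
  let Ψ : ((Σ i : Fin m, Finset.Ico 1 (t i)) → F) →ₗ[F] OuterDer F L :=
    (innerDer F L).toSubmodule.mkQ ∘ₗ Φ
  refine ⟨LinearEquiv.ofBijective Ψ ⟨(injective_iff_map_eq_zero Ψ).mpr fun f hf => ?_,
    fun x => ?_⟩⟩
  · obtain ⟨c, rfl⟩ : ∃ c : (i : Fin m) → ℕ → F, f = fun x => c x.1 x.2 :=
      ⟨fun i s => if h : s ∈ Finset.Ico 1 (t i) then f ⟨i, s, h⟩ else 0, by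
        funext ⟨i, s, hs⟩
        dsimp only
        rw [dif_pos hs]⟩
    obtain ⟨u, hu⟩ := (Submodule.Quotient.mk_eq_zero _).mp hf
    rw [hΦ] at hu
    exact funext fun x => eq_zero_of_powerDer_eq_ad φ hu.symm x.2.2
  · obtain ⟨d, rfl⟩ := Submodule.mkQ_surjective _ x
    obtain ⟨u, c, rfl⟩ := exists_eq_ad_add_powerDer φ hm hn hp3 ht d
    refine ⟨fun x => c x.1 x.2, (Submodule.Quotient.eq _).mpr ⟨-u, ?_⟩⟩
    rw [hΦ, sub_add_cancel_right]
    exact map_neg (LieDerivation.ad F L) u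

theorem outerDer_structure (φ : Model F p m n t L) (hm : 3 ≤ m) (hn : 3 ≤ n) (hp3 : 3 < p)
    (ht : ∀ i, 1 ≤ t i) :
    IsLieAbelian (OuterDer F L) ∧ FiniteDimensional F (OuterDer F L) ∧
      (Module.finrank F (OuterDer F L) : ℤ) = (∑ i, (t i : ℤ)) - (m : ℤ) := by
  obtain ⟨e⟩ := exists_outerDer_equiv φ hm hn hp3 ht
  refine ⟨isLieAbelian_outerDer φ hm hn hp3 ht, Module.Finite.equiv e, ?_⟩
  rw [← e.finrank_eq, Module.finrank_fintype_fun_eq_card, Fintype.card_sigma, Nat.cast_sum]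
  have h (i : Fin m) : ((Fintype.card (Finset.Ico 1 (t i)) : ℕ) : ℤ) = t i - 1 := by
    rw [Fintype.card_coe, Nat.card_Ico, Nat.cast_sub (ht i), Nat.cast_one]
  simp only [h, Finset.sum_sub_distrib, Finset.sum_const, Finset.card_univ, Fintype.card_fin,
    nsmul_eq_mul, mul_one]

/-- The Lie algebra `𝒲` as a model of itself. -/
def evenWModel (F : Type*) [Field F] (p : ℕ) [Fact p.Prime] [CharP F p] (m n : ℕ)
    (t : Fin m → ℕ) : Model F p m n t (evenW F p m n t) where
  toEnd := (evenW F p m n t).toSubmodule.subtype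
  injective := Subtype.val_injective
  toEnd_lie _ _ := rfl
  mem x := x.2
  exists_eq A hA := ⟨⟨A, hA⟩, rfl⟩

end

end CartanW

end

/-- The outer derivation algebra of the even part `𝒲` of `W(m,n;t)` is abelian, of dimension
`∑ t i - m`. -/
theorem theorem5p1p2 (F : Type*) [Field F] (p : ℕ) [Fact p.Prime] [CharP F p] (hp : 3 < p)
    (m n : ℕ) (hm : 3 ≤ m) (hn : 3 ≤ n) (t : Fin m → ℕ) (ht : ∀ i, 1 ≤ t i) :
    IsLieAbelian (CartanW.OuterDer F (CartanW.evenW F p m n t)) ∧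
    FiniteDimensional F (CartanW.OuterDer F (CartanW.evenW F p m n t)) ∧
    (Module.finrank F (CartanW.OuterDer F (CartanW.evenW F p m n t)) : ℤ) =
      (∑ i, (t i : ℤ)) - (m : ℤ) := by
  exact CartanW.outerDer_structure (CartanW.evenWModel F p m n t) hm hn hp ht
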